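/- **Setting.** Let $n\ge 1$ and let $\Omega\subset\mathbb R^n$ be a bounded domain with $C^2$ boundary; $dS$ is the surface measure on $\partial\Omega$, $\mathbb R_+=(0,\infty)$, $Q_T=\Omega\times(0,T)$ and $D=\max_{x\in\partial\Omega}|x|$. Let $a,c,b_i,m_i,f,d\in C^2(\overline\Omega\times[0,\infty))$, $h\in C^2(\overline\Omega\times[0,\infty)\times\mathbb R\times\mathbb R^n)$, $g\in C^3(\overline\Omega\times[0,\infty)\times\mathbb R)$, $\psi\in C^2(\overline\Omega\times[0,\infty)\times\mathbb R)$, $w^0\in C^2(\overline\Omega)$, and put $\mathbf b=(b_1,\dots,b_n)$, $\mathbf m=(m_1,\dots,m_n)$. Consider $$w_t-\operatorname{div}(a\nabla w)+\mathbf b\cdot\nabla w+cw+h(x,t,w,\nabla w)+\mathbf m\cdot\nabla\big(g(x,t,w)\big)=f\ \text{ in }\Omega\times\mathbb R_+,$$ $$\psi(x,t,w)=d\ \text{ on }\partial\Omega\times\mathbb R_+,\qquad w(x,0)=w^0(x)\ \text{ in }\Omega. \tag{S}$$ For $T>0$, a classical solution on $Q_T$ is a function $w\in C^{2,1}(Q_T)\cap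 C(\overline{Q_T})$ satisfying these relations pointwise for $0<t<T$, together with the initial condition. **Assumption 1.** (a) $\underline a\le a\le\overline a$ on $\overline\Omega\times[0,\infty)$ with constants $\underline a,\overline a>0$. (b) $|h|+|h_t|+|h_s|+(1+|\eta|)\sum_i|h_{\eta_i}|\le\mu_1(|s|)(1+|\eta|^2)$ for all $(x,t,s,\eta)\in\overline\Omega\times[0,\infty)\times\mathbb R\times\mathbb R^n$, with $\mu_1:[0,\infty)\to[0,\infty)$ continuous and nondecreasing. (c) $\sum_i|g_{x_i}|+|g_s|+|g_{ss}|\le\mu_2(|s|)$ on $\overline\Omega\times[0,\infty)\times\mathbb R$, with $\mu_2:[0,\infty)\to(0,\infty)$ continuous, nondecreasing, $\int_0^\infty ds/\mu_2(s)=\infty$. (d) $-\psi(x,t,s)s\le\mu_3(x,t)(s^2+1)$ on $\partial\Omega\times[0,\infty)\times\mathbb R$ with $\mu_3$ continuous. **Assumption 2.** (a) $-h(x,t,s,\eta)s\le\mu(x,t)s^2$ on $\Omega\times\mathbb R_+\times\mathbb R\times\mathbb R^n$ with $\mu\in C(\overline\Omega\times[0,\infty))$. (b) There are $s_0>0$ and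 $g_0\in C(\overline\Omega\times[0,\infty))$ with $|g(x,t,s)|\le|g_0(x,t)||s|$ on $\Omega\times\mathbb R_+\times[-s_0,s_0]$. (c) There is a constant $\underline c\ge0$ with $\underline c\le c-\operatorname{div}\mathbf b-\mu$ on $\Omega\times\mathbb R_+$. **Assumption 3'.** (a) $p\in C^2(\Omega)\cap C^1(\overline\Omega)$ and the constant $p_0\ge0$ satisfy $\operatorname{div}(a\nabla p)+\mathbf b\cdot\nabla p\le-p_0$ in $\Omega\times\mathbb R_+$ and $p=0$ on $\partial\Omega$, and $g(x,t,s)\,s\,\operatorname{div}(p\,\mathbf m)\le0$ on $\overline\Omega\times[0,\infty)\times\mathbb R$. (b) $\psi(x,t,s)=\psi_1(x,t)\psi_2(s)$ on $\partial\Omega\times[0,\infty)\times\mathbb R$, where $\psi_1\ge\underline{\psi_1}$ for some constant $\underline{\psi_1}>0$ and $\psi_2:\mathbb R\to\mathbb R$ is continuous and strictly increasing; $\psi_2^{-1}$ is its inverse, defined on the range of $\psi_2$. **Assumption 4.** $\psi(x,0,w^0(x))=d(x,0)$ for $x\in\partial\Omega$. **ISS.** $\mathcal K$ is the class of continuous strictly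 increasing $\gamma:[0,\infty)\to[0,\infty)$ with $\gamma(0)=0$; $\mathcal{KL}$ is the class of continuous $\beta:[0,\infty)^2\to[0,\infty)$ such that $\beta(\cdot,t)\in\mathcal K$ for every $t\ge 0$, and $\beta(r,\cdot)$ is strictly decreasing with limit $0$ at infinity for every $r>0$. With $a,\mathbf b,c,h,\mathbf m,g,\psi$ fixed, (S) is *$L^q$-ISS in weighted $L^1$-norm* (with weight $p$) w.r.t. $d$ and $f$ if there are $\beta_0\in\mathcal{KL}$, $\gamma_0,\gamma_1\in\mathcal K$ such that, for all $f,d,w^0$ of the above smoothness satisfying Assumption 4, all $T>0$ and all classical solutions $w$ on $Q_T$, $$\|pw(\cdot,T)\|_{L^1(\Omega)}\le\beta_0\big(\|pw^0\|_{L^1(\Omega)},T\big)+\gamma_0\big(\|d\|_{L^q((0,T);L^1(\partial\Omega))}\big)+\gamma_1\big(\|f\|_{L^q((0,T);L^1(\Omega))}\big).$$ **Theorem.** Suppose that Assumptions 1, 2, 3' and 4 hold, let $q\in[1,+\infty]$, $\frac1q+\frac1{q'}=1$, and read $\big(\frac1{\lambda q'}\big)^{1/q'}$ as $1$ when $q=1$.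 The estimates below hold for every $T>0$ and every classical solution $w$ of (S) on $Q_T$. (i) One has $$\|pw(\cdot,T)\|_{L^1(\Omega)}\le e^{-\underline cT}\|pw^0\|_{L^1(\Omega)}+\Big\|a\,\psi_2^{-1}\Big(\frac d{\psi_1}\Big)|\nabla p|\Big\|_{L^1((0,T);L^1(\partial\Omega))}+\|pf\|_{L^1((0,T);L^1(\Omega))}.$$ If $\underline c>0$, then $$\|pw(\cdot,T)\|_{L^1(\Omega)}\le e^{-\underline cT}\|pw^0\|_{L^1(\Omega)}+\Big(\frac1{\underline cq'}\Big)^{\frac1{q'}}\Big\|a\,\psi_2^{-1}\Big(\frac d{\psi_1}\Big)|\nabla p|\Big\|_{L^q((0,T);L^1(\partial\Omega))}+\Big(\frac1{\underline cq'}\Big)^{\frac1{q'}}\|pf\|_{L^q((0,T);L^1(\Omega))}.$$ If $\underline c>0$ and, for some $C>0$, $|\psi_2^{-1}(s)|\le C|s|$ for all $s$ in the domain of $\psi_2^{-1}$, then (S) is $L^q$-ISS in weighted $L^1$-norm w.r.t. $d$ and $f$. (ii) Suppose that $\underline c=0$ and $p_0>0$, and that there are $j\in\{1,\dots,n\}$,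 $\underline b\in\mathbb R$ and $\overline m\ge0$ such that $\underline b\le\frac{b_j+a_{x_j}}a$ on $\Omega\times\mathbb R_+$ and at least one of the following holds: (A) $-p\,m_j\,g(x,t,s)\,s\le0$ on $\Omega\times\mathbb R_+\times\mathbb R$; (B) $\operatorname{div}(p\mathbf m)\ne0$ and $\Big|\frac{p\,m_j}{\operatorname{div}(p\mathbf m)}\Big|\le\overline m$ on $\Omega\times\mathbb R_+$. Let $l>\max\{0,-\underline b\}$ and $$k>\max\Big\{\frac{2le^{lD}}{l+\underline b},\ \frac{2\overline a\,l\,e^{lD}}{p_0}\max_{\overline\Omega}|p_{x_j}|\Big\}\ \text{ in case (A)},\qquad k>\max\Big\{\frac{2le^{lD}}{l+\underline b},\ 2le^{lD}\overline m,\ \frac{2\overline a\,l\,e^{lD}}{p_0}\max_{\overline\Omega}|p_{x_j}|\Big\}\ \text{ in case (B)},$$ and put $$\widehat{\underline c}=\frac{\underline a\,l\,e^{-lD}}{k+e^{lD}}\Big(l+\underline b-\frac2k\,l\,e^{lD}\Big),\qquad C_{k,l}=\frac{k+e^{lD}}{k+e^{-lD}}.$$ Then $\widehat{\underline c}>0$,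 $C_{k,l}>0$ and $$\|pw(\cdot,T)\|_{L^1(\Omega)}\le C_{k,l}e^{-\widehat{\underline c}T}\|pw^0\|_{L^1(\Omega)}+C_{k,l}\Big(\frac1{\widehat{\underline c}q'}\Big)^{\frac1{q'}}\Big\|a\,\psi_2^{-1}\Big(\frac d{\psi_1}\Big)|\nabla p|\Big\|_{L^q((0,T);L^1(\partial\Omega))}+C_{k,l}\Big(\frac1{\widehat{\underline c}q'}\Big)^{\frac1{q'}}\|pf\|_{L^q((0,T);L^1(\Omega))}.$$ If moreover, for some $C>0$, $|\psi_2^{-1}(s)|\le C|s|$ for all $s$ in the domain of $\psi_2^{-1}$, then (S) is $L^q$-ISS in weighted $L^1$-norm w.r.t. $d$ and $f$. -/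

import Mathlib

open MeasureTheory Set Filter Topology
open scoped ENNReal NNReal

noncomputable section

namespace ParabolicISS

/-! ### Domains -/

/-- A bounded domain (nonempty, open, connected) of `ℝⁿ` with boundary of class `C²`: near each
boundary point the domain is the sublevel set of a `C²` function with nonzero differential. -/
structure IsC2Domain {n : ℕ} (Ω : Set (EuclideanSpace ℝ (Fin n))) : Prop where
  isOpen : IsOpen Ω
  isConnected : IsConnected Ω
  isBounded : Bornology.IsBounded Ω
  boundary : ∀ x₀ ∈ frontier Ω, ∃ (U : Set (EuclideanSpace ℝ (Fin n)))
    (φ : EuclideanSpace ℝ (Fin n) → ℝ), IsOpen U ∧ x₀ ∈ U ∧ ContDiffOn ℝ 2 φ U ∧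
      φ x₀ = 0 ∧ fderiv ℝ φ x₀ ≠ 0 ∧ Ω ∩ U = {x ∈ U | φ x < 0}

/-- The surface measure on `∂Ω`: the `(n-1)`-dimensional Hausdorff measure (normalised to agree
with Lebesgue measure on hyperplanes), restricted to the boundary. -/
def surfaceMeasure {n : ℕ} (Ω : Set (EuclideanSpace ℝ (Fin n))) :
    Measure (EuclideanSpace ℝ (Fin n)) :=
  (Measure.euclideanHausdorffMeasure (n - 1)).restrict (frontier Ω)

/-- Divergence of a vector field at an interior point. -/
def divg {n : ℕ} (F : EuclideanSpace ℝ (Fin n) → EuclideanSpace ℝ (Fin n))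
    (x : EuclideanSpace ℝ (Fin n)) : ℝ :=
  ∑ i, (fderiv ℝ F x (EuclideanSpace.single i 1)) i

/-- Divergence of a vector field relative to a set; used on `closure Ω`, where it is the
continuous extension of the interior divergence up to the boundary. -/
def divgWithin {n : ℕ} (F : EuclideanSpace ℝ (Fin n) → EuclideanSpace ℝ (Fin n))
    (s : Set (EuclideanSpace ℝ (Fin n))) (x : EuclideanSpace ℝ (Fin n)) : ℝ :=
  ∑ i, (fderivWithin ℝ F s x (EuclideanSpace.single i 1)) i

/-! ### Norms -/

/-- The norm of `L¹(Ω)`. -/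
def L1norm {n : ℕ} (Ω : Set (EuclideanSpace ℝ (Fin n))) (u : EuclideanSpace ℝ (Fin n) → ℝ) :
    ℝ≥0∞ :=
  ∫⁻ x in Ω, ‖u x‖ₑ

/-- The norm of `L^q((0,T); L¹(σ))`. -/
def mixedNorm {n : ℕ} (q : ℝ≥0∞) (T : ℝ) (σ : Measure (EuclideanSpace ℝ (Fin n)))
    (u : EuclideanSpace ℝ (Fin n) → ℝ → ℝ) : ℝ≥0∞ :=
  eLpNorm (fun t : ℝ => ∫⁻ x, ‖u x t‖ₑ ∂σ) q (volume.restrict (Ioo 0 T))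

/-- The constant `(1/(c q'))^{1/q'}`; it equals `1` for `q' = ∞` (when `c > 0`). -/
def holderConst (c : ℝ) (q' : ℝ≥0∞) : ℝ≥0∞ :=
  ((ENNReal.ofReal c * q')⁻¹) ^ (q'⁻¹).toReal

/-! ### The system -/

/-- Coefficients of the equation
`w_t - div (a ∇w) + b ⬝ ∇w + c w + h(x,t,w,∇w) + m ⬝ ∇(g(x,t,w)) = f` with the boundary
condition `ψ(x,t,w) = d`. -/
structure Coefficients (n : ℕ) where
  a : EuclideanSpace ℝ (Fin n) → ℝ → ℝ
  b : EuclideanSpace ℝ (Fin n) → ℝ → EuclideanSpace ℝ (Fin n)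
  c : EuclideanSpace ℝ (Fin n) → ℝ → ℝ
  h : EuclideanSpace ℝ (Fin n) → ℝ → ℝ → EuclideanSpace ℝ (Fin n) → ℝ
  m : EuclideanSpace ℝ (Fin n) → ℝ → EuclideanSpace ℝ (Fin n)
  g : EuclideanSpace ℝ (Fin n) → ℝ → ℝ → ℝ
  ψ : EuclideanSpace ℝ (Fin n) → ℝ → ℝ → ℝ

/-- In-domain disturbance `f`, boundary disturbance `d` and initial datum `w₀`. -/
structure Inputs (n : ℕ) where
  f : EuclideanSpace ℝ (Fin n) → ℝ → ℝ
  d : EuclideanSpace ℝ (Fin n) → ℝ → ℝ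
  w₀ : EuclideanSpace ℝ (Fin n) → ℝ

/-- `f`, `d` are `C²` on `closure Ω × [0,∞)` and `w₀` is `C²` on `closure Ω`. -/
structure Inputs.Regular {n : ℕ} (I : Inputs n) (Ω : Set (EuclideanSpace ℝ (Fin n))) : Prop where
  f : ContDiffOn ℝ 2 (fun z : EuclideanSpace ℝ (Fin n) × ℝ => I.f z.1 z.2)
    (closure Ω ×ˢ Ici (0 : ℝ))
  d : ContDiffOn ℝ 2 (fun z : EuclideanSpace ℝ (Fin n) × ℝ => I.d z.1 z.2)
    (closure Ω ×ˢ Ici (0 : ℝ))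
  w₀ : ContDiffOn ℝ 2 I.w₀ (closure Ω)

namespace Coefficients

variable {n : ℕ} (S : Coefficients n) (Ω : Set (EuclideanSpace ℝ (Fin n)))

/-- The standing smoothness of the coefficients. -/
structure Regular : Prop where
  a : ContDiffOn ℝ 2 (fun z : EuclideanSpace ℝ (Fin n) × ℝ => S.a z.1 z.2)
    (closure Ω ×ˢ Ici (0 : ℝ))
  b : ContDiffOn ℝ 2 (fun z : EuclideanSpace ℝ (Fin n) × ℝ => S.b z.1 z.2)
    (closure Ω ×ˢ Ici (0 : ℝ))
  c : ContDiffOn ℝ 2 (fun z : EuclideanSpace ℝ (Fin n) × ℝ => S.c z.1 z.2)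
    (closure Ω ×ˢ Ici (0 : ℝ))
  m : ContDiffOn ℝ 2 (fun z : EuclideanSpace ℝ (Fin n) × ℝ => S.m z.1 z.2)
    (closure Ω ×ˢ Ici (0 : ℝ))
  h : ContDiffOn ℝ 2
    (fun z : EuclideanSpace ℝ (Fin n) × ℝ × ℝ × EuclideanSpace ℝ (Fin n) =>
      S.h z.1 z.2.1 z.2.2.1 z.2.2.2)
    (closure Ω ×ˢ Ici (0 : ℝ) ×ˢ (univ : Set ℝ) ×ˢ (univ : Set (EuclideanSpace ℝ (Fin n))))
  g : ContDiffOn ℝ 3 (fun z : EuclideanSpace ℝ (Fin n) × ℝ × ℝ => S.g z.1 z.2.1 z.2.2)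
    (closure Ω ×ˢ Ici (0 : ℝ) ×ˢ (univ : Set ℝ))
  ψ : ContDiffOn ℝ 2 (fun z : EuclideanSpace ℝ (Fin n) × ℝ × ℝ => S.ψ z.1 z.2.1 z.2.2)
    (closure Ω ×ˢ Ici (0 : ℝ) ×ˢ (univ : Set ℝ))

/-- Uniform ellipticity and the growth conditions on `h`, `g`, `ψ`;
`alo` and `ahi` are the lower and upper bounds of `a`. -/
structure Assumption1 (alo ahi : ℝ) : Prop where
  alo_pos : 0 < alo
  ahi_pos : 0 < ahi
  a_bounds : ∀ x ∈ closure Ω, ∀ t, 0 ≤ t → alo ≤ S.a x t ∧ S.a x t ≤ ahi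
  h_growth : ∃ μ₁ : ℝ → ℝ, ContinuousOn μ₁ (Ici 0) ∧ MonotoneOn μ₁ (Ici 0) ∧
    (∀ r, 0 ≤ r → 0 ≤ μ₁ r) ∧
    ∀ x ∈ closure Ω, ∀ t, 0 ≤ t → ∀ (s : ℝ) (η : EuclideanSpace ℝ (Fin n)),
      |S.h x t s η| + |derivWithin (fun r => S.h x r s η) (Ici 0) t|
        + |deriv (fun r => S.h x t r η) s|
        + (1 + ‖η‖) *
          ∑ i, |fderiv ℝ (fun ξ => S.h x t s ξ) η (EuclideanSpace.single i 1)|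
        ≤ μ₁ |s| * (1 + ‖η‖ ^ 2)
  g_growth : ∃ μ₂ : ℝ → ℝ, ContinuousOn μ₂ (Ici 0) ∧ MonotoneOn μ₂ (Ici 0) ∧
    (∀ r, 0 ≤ r → 0 < μ₂ r) ∧
    (∫⁻ r in Ioi (0 : ℝ), ENNReal.ofReal (1 / μ₂ r)) = ∞ ∧
    ∀ x ∈ closure Ω, ∀ t, 0 ≤ t → ∀ s : ℝ,
      (∑ i, |fderivWithin ℝ (fun y => S.g y t s) (closure Ω) x (EuclideanSpace.single i 1)|)
        + |deriv (fun r => S.g x t r) s| + |iteratedDeriv 2 (fun r => S.g x t r) s|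
        ≤ μ₂ |s|
  ψ_growth : ∃ μ₃ : EuclideanSpace ℝ (Fin n) → ℝ → ℝ,
    ContinuousOn (fun z : EuclideanSpace ℝ (Fin n) × ℝ => μ₃ z.1 z.2)
      (frontier Ω ×ˢ Ici (0 : ℝ)) ∧
    ∀ x ∈ frontier Ω, ∀ t, 0 ≤ t → ∀ s : ℝ, -S.ψ x t s * s ≤ μ₃ x t * (s ^ 2 + 1)

/-- Structural conditions: sign condition on `h` with function `μ`, linear bound on `g` near
`s = 0`, and `clo ≤ c - div b - μ`. -/
structure Assumption2 (μ : EuclideanSpace ℝ (Fin n) → ℝ → ℝ) (clo : ℝ) : Prop where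
  μ_cont : ContinuousOn (fun z : EuclideanSpace ℝ (Fin n) × ℝ => μ z.1 z.2)
    (closure Ω ×ˢ Ici (0 : ℝ))
  h_sign : ∀ x ∈ Ω, ∀ t, 0 < t → ∀ (s : ℝ) (η : EuclideanSpace ℝ (Fin n)),
    -S.h x t s η * s ≤ μ x t * s ^ 2
  g_bound : ∃ (s₀ : ℝ) (g₀ : EuclideanSpace ℝ (Fin n) → ℝ → ℝ), 0 < s₀ ∧
    ContinuousOn (fun z : EuclideanSpace ℝ (Fin n) × ℝ => g₀ z.1 z.2)
      (closure Ω ×ˢ Ici (0 : ℝ)) ∧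
    ∀ x ∈ Ω, ∀ t, 0 < t → ∀ s ∈ Icc (-s₀) s₀, |S.g x t s| ≤ |g₀ x t| * |s|
  clo_nonneg : 0 ≤ clo
  clo_le : ∀ x ∈ Ω, ∀ t, 0 < t → clo ≤ S.c x t - divg (fun y => S.b y t) x - μ x t

/-- Conditions for the Dirichlet problem: the weight `p`, the constant `p₀`, and the product
form `ψ = ψ₁ ψ₂` of the boundary nonlinearity. -/
structure Assumption3' (p : EuclideanSpace ℝ (Fin n) → ℝ) (p₀ : ℝ)
    (ψ₁ : EuclideanSpace ℝ (Fin n) → ℝ → ℝ) (ψ₂ : ℝ → ℝ) : Prop where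
  p_C2 : ContDiffOn ℝ 2 p Ω
  p_C1 : ContDiffOn ℝ 1 p (closure Ω)
  p₀_nonneg : 0 ≤ p₀
  p_super : ∀ x ∈ Ω, ∀ t, 0 < t →
    divg (fun y => S.a y t • gradient p y) x + inner ℝ (S.b x t) (gradient p x) ≤ -p₀
  p_boundary : ∀ x ∈ frontier Ω, p x = 0
  g_sign : ∀ x ∈ closure Ω, ∀ t, 0 ≤ t → ∀ s : ℝ,
    S.g x t s * s * divgWithin (fun y => p y • S.m y t) (closure Ω) x ≤ 0
  ψ_eq : ∀ x ∈ frontier Ω, ∀ t, 0 ≤ t → ∀ s : ℝ, S.ψ x t s = ψ₁ x t * ψ₂ s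
  ψ₁_lower : ∃ ψlo : ℝ, 0 < ψlo ∧ ∀ x ∈ frontier Ω, ∀ t, 0 ≤ t → ψlo ≤ ψ₁ x t
  ψ₂_strictMono : StrictMono ψ₂
  ψ₂_cont : Continuous ψ₂

/-- The compatibility condition between the initial datum and the boundary disturbance. -/
def Assumption4 (I : Inputs n) : Prop :=
  ∀ x ∈ frontier Ω, S.ψ x 0 (I.w₀ x) = I.d x 0

/-- `w` is a classical solution on `Q_T = Ω × (0,T)` of the initial-boundary value problem with
Dirichlet boundary condition: `w ∈ C^{2,1}(Q_T) ∩ C(closure Q_T)`, and `w` satisfies the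
equation, the boundary condition and the initial condition pointwise. -/
structure IsClassicalSolution (I : Inputs n) (T : ℝ)
    (w : EuclideanSpace ℝ (Fin n) → ℝ → ℝ) : Prop where
  cont : ContinuousOn (fun z : EuclideanSpace ℝ (Fin n) × ℝ => w z.1 z.2)
    (closure Ω ×ˢ Icc 0 T)
  diff_time : ∀ x ∈ Ω, ∀ t ∈ Ioo 0 T, DifferentiableAt ℝ (fun r => w x r) t
  diff_space : ∀ t ∈ Ioo 0 T, ContDiffOn ℝ 2 (fun y => w y t) Ω
  cont_time : ContinuousOn
    (fun z : EuclideanSpace ℝ (Fin n) × ℝ => deriv (fun r => w z.1 r) z.2) (Ω ×ˢ Ioo 0 T)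
  cont_space : ContinuousOn
    (fun z : EuclideanSpace ℝ (Fin n) × ℝ => fderiv ℝ (fun y => w y z.2) z.1) (Ω ×ˢ Ioo 0 T)
  cont_space2 : ContinuousOn
    (fun z : EuclideanSpace ℝ (Fin n) × ℝ => fderiv ℝ (fderiv ℝ (fun y => w y z.2)) z.1)
    (Ω ×ˢ Ioo 0 T)
  equation : ∀ x ∈ Ω, ∀ t ∈ Ioo 0 T,
    deriv (fun r => w x r) t
      - divg (fun y => S.a y t • gradient (fun y' => w y' t) y) x
      + inner ℝ (S.b x t) (gradient (fun y => w y t) x)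
      + S.c x t * w x t
      + (S.h x t (w x t) (gradient (fun y => w y t) x)
        + inner ℝ (S.m x t) (gradient (fun y => S.g y t (w y t)) x))
      = I.f x t
  boundary : ∀ x ∈ frontier Ω, ∀ t ∈ Ioo 0 T, S.ψ x t (w x t) = I.d x t
  initial : ∀ x ∈ Ω, w x 0 = I.w₀ x

end Coefficients

/-! ### Input-to-state stability -/

/-- Comparison functions of class `𝒦`. -/
structure IsClassK (γ : ℝ≥0 → ℝ≥0) : Prop where
  continuous : Continuous γ
  strictMono : StrictMono γ
  zero : γ 0 = 0

/-- Comparison functions of class `ℒ`. -/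
structure IsClassL (γ : ℝ≥0 → ℝ≥0) : Prop where
  continuous : Continuous γ
  strictAnti : StrictAnti γ
  tendsto_zero : Tendsto γ atTop (𝓝 0)

/-- Comparison functions of class `𝒦ℒ`. -/
structure IsClassKL (β : ℝ≥0 → ℝ≥0 → ℝ≥0) : Prop where
  continuous : Continuous (fun z : ℝ≥0 × ℝ≥0 => β z.1 z.2)
  classK : ∀ t, IsClassK (fun r => β r t)
  classL : ∀ r, 0 < r → IsClassL (β r)

/-- The Dirichlet system is `L^q`-ISS in the `p`-weighted `L¹`-norm with respect to boundary
and in-domain disturbances `d ∈ L^q_loc(ℝ₊; L¹(∂Ω))` and `f ∈ L^q_loc(ℝ₊; L¹(Ω))`: the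
comparison functions are uniform over all admissible (smooth, compatible) inputs, all times and
all classical solutions. -/
def IsLqISSWeightedL1 {n : ℕ} (S : Coefficients n) (Ω : Set (EuclideanSpace ℝ (Fin n)))
    (p : EuclideanSpace ℝ (Fin n) → ℝ) (q : ℝ≥0∞) : Prop :=
  ∃ (β₀ : ℝ≥0 → ℝ≥0 → ℝ≥0) (γ₀ γ₁ : ℝ≥0 → ℝ≥0),
    IsClassKL β₀ ∧ IsClassK γ₀ ∧ IsClassK γ₁ ∧
    ∀ I : Inputs n, I.Regular Ω → S.Assumption4 Ω I →
      ∀ T : ℝ, 0 < T → ∀ w, S.IsClassicalSolution Ω I T w →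
        L1norm Ω (fun x => p x * w x T) ≤
          ((β₀ (L1norm Ω fun x => p x * I.w₀ x).toNNReal T.toNNReal
            + γ₀ (mixedNorm q T (surfaceMeasure Ω) I.d).toNNReal
            + γ₁ (mixedNorm q T (volume.restrict Ω) I.f).toNNReal : ℝ≥0) : ℝ≥0∞)

/-! ### Quantities in the estimates -/

/-- `max_{x ∈ ∂Ω} |x|`. -/
def maxDist {n : ℕ} (Ω : Set (EuclideanSpace ℝ (Fin n))) : ℝ :=
  sSup ((fun x => ‖x‖) '' frontier Ω)

/-- `max_{closure Ω} |∂p/∂x_j|`. -/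
def maxPartial {n : ℕ} (Ω : Set (EuclideanSpace ℝ (Fin n)))
    (p : EuclideanSpace ℝ (Fin n) → ℝ) (j : Fin n) : ℝ :=
  sSup ((fun x => |(gradientWithin p (closure Ω) x) j|) '' closure Ω)

/-- The function `a ψ₂⁻¹(d/ψ₁) |∇p|` on `∂Ω × (0,T)`. As `ψ₂` is injective, `Function.invFun ψ₂`
is its inverse on the range of `ψ₂`. -/
def boundaryTerm {n : ℕ} (S : Coefficients n) (Ω : Set (EuclideanSpace ℝ (Fin n)))
    (p : EuclideanSpace ℝ (Fin n) → ℝ) (ψ₁ : EuclideanSpace ℝ (Fin n) → ℝ → ℝ) (ψ₂ : ℝ → ℝ)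
    (I : Inputs n) (x : EuclideanSpace ℝ (Fin n)) (t : ℝ) : ℝ :=
  S.a x t * Function.invFun ψ₂ (I.d x t / ψ₁ x t) * ‖gradientWithin p (closure Ω) x‖

/-- `b̲ ≤ (b_j + ∂a/∂x_j) / a` on `Ω × (0,∞)`. -/
def DriftLowerBound {n : ℕ} (S : Coefficients n) (Ω : Set (EuclideanSpace ℝ (Fin n)))
    (j : Fin n) (blo : ℝ) : Prop :=
  ∀ x ∈ Ω, ∀ t, 0 < t →
    blo ≤ ((S.b x t) j + fderiv ℝ (fun y => S.a y t) x (EuclideanSpace.single j 1)) / S.a x t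

/-- `-p m_j g(x,t,s) s ≤ 0` on `Ω × (0,∞) × ℝ`. -/
def SignCondition {n : ℕ} (S : Coefficients n) (Ω : Set (EuclideanSpace ℝ (Fin n)))
    (p : EuclideanSpace ℝ (Fin n) → ℝ) (j : Fin n) : Prop :=
  ∀ x ∈ Ω, ∀ t, 0 < t → ∀ s : ℝ, -(p x) * (S.m x t) j * S.g x t s * s ≤ 0

/-- `div (p m) ≠ 0` and `|p m_j / div (p m)| ≤ mbar` on `Ω × (0,∞)`. -/
def DivergenceCondition {n : ℕ} (S : Coefficients n) (Ω : Set (EuclideanSpace ℝ (Fin n)))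
    (p : EuclideanSpace ℝ (Fin n) → ℝ) (j : Fin n) (mbar : ℝ) : Prop :=
  ∀ x ∈ Ω, ∀ t, 0 < t → divg (fun y => p y • S.m y t) x ≠ 0 ∧
    |p x * (S.m x t) j / divg (fun y => p y • S.m y t) x| ≤ mbar

/-- `|ψ₂⁻¹(s)| ≤ C |s|` for some `C > 0` and all `s` in the domain of `ψ₂⁻¹`. -/
def InverseLinearBound (ψ₂ : ℝ → ℝ) : Prop :=
  ∃ C : ℝ, 0 < C ∧ ∀ s ∈ Set.range ψ₂, |Function.invFun ψ₂ s| ≤ C * |s|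

/-- The decay rate `a̲ l e^{-lD} / (k + e^{lD}) * (l + b̲ - (2/k) l e^{lD})`. -/
def hatc (alo blo D l k : ℝ) : ℝ :=
  alo * l * Real.exp (-(l * D)) / (k + Real.exp (l * D)) *
    (l + blo - 2 / k * l * Real.exp (l * D))

/-- The constant `C_{k,l} = (k + e^{lD}) / (k + e^{-lD})`. -/
def Ckl (D l k : ℝ) : ℝ :=
  (k + Real.exp (l * D)) / (k + Real.exp (-(l * D)))

end ParabolicISS

end

open ParabolicISS

/-! Formally, the equation is multiplied by `P sign w`, with a weight `P ≥ 0` vanishing on `∂Ω`, and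
integrated. All derivatives of `w` move onto `P`. The integral of `P |w|` decays at rate `lam` once
`div (a ∇P) + b·∇P + P (div b - c + μ) ≤ -lam P`, and the flux `g` has a good sign when `g s div (P
m) ≤ 0`. Since `P = 0` on `∂Ω`, the only boundary term left is the integral of `a |w| |∇P|`, where
the boundary condition gives `w = ψ₂⁻¹(d/ψ₁)`. These requirements form `IsEnergyWeight`. Hölder's
inequality in time against `e^{lam t}` then produces the constants `(1/(lam q'))^{1/q'}`.

In part (i), `P = p` and `lam = clo`. In part (ii), `P = p / (k + e^{l x_j})`: derivatives of the
new factor in `x_j` create the decay rate `hatc`, the cross term with `∂_j p` is absorbed by `p₀`,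
and comparing `P` with `p` costs the factor `Ckl`. That `p ≥ 0` is not assumed; it follows from the
weak maximum principle.

Two difficulties make this formal computation nontrivial. First, `sign` is not smooth. It is
replaced by the derivative of `√(s² + ε²)`; the extra term from `g` contains the second derivative
of this function and is absorbed by the diffusion up to `O(ε)`, because `g` is at most linear near
`s = 0`.

Second, `w` is merely continuous up to the boundary, so `∇w` has no trace and no divergence theorem
on `Ω` can be applied. The weight is therefore truncated to `trunc δ (P)`, which has compact support
in `Ω`; every divergence then integrates to zero, and the boundary term appears as the integral of
`a |w|` against the layer `truncD' (P) |∇P|² dx`, which involves only the values of `w`. The crux is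
`IsWeight.eventually_integral_layer_le`: as `δ → 0` these layers are asymptotically at most `|∇P|
dS`. The weight inequality bounds `ΔP` from above by `M (P + |∇P|)`. With this bound
`integral_layer_le` compares the layer of `P` with a cutoff built from a local defining function `φ`
of the domain. The mass of the `φ`-cutoff is estimated by slicing along a nearly normal direction,
where it is the total variation of a monotone function, and by projecting along that direction,
which does not increase Hausdorff measure (`limsup_lintegral_mul_mass_le`). Only this upper bound is
needed: neither the area formula nor positivity of `P` inside `Ω` enters. -/

namespace ParabolicISS

/-! ### Divergence and gradient calculus -/

section Calculus

variable {n : ℕ}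

theorem inner_gradient_apply {u : EuclideanSpace ℝ (Fin n) → ℝ} (x v : EuclideanSpace ℝ (Fin n)) :
    inner ℝ (gradient u x) v = fderiv ℝ u x v := by
  simp [gradient]

theorem gradient_coord (u : EuclideanSpace ℝ (Fin n) → ℝ) (x : EuclideanSpace ℝ (Fin n))
    (i : Fin n) : (gradient u x) i = fderiv ℝ u x (EuclideanSpace.single i 1) := by
  rw [← inner_gradient_apply]
  rw [EuclideanSpace.inner_single_right]
  simp

theorem sum_smul_single (v : EuclideanSpace ℝ (Fin n)) :
    ∑ i, v i • EuclideanSpace.single i (1 : ℝ) = v := by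
  ext j
  simp [Finset.sum_apply, Pi.single_apply]

theorem divg_smul {u : EuclideanSpace ℝ (Fin n) → ℝ}
    {X : EuclideanSpace ℝ (Fin n) → EuclideanSpace ℝ (Fin n)} {x : EuclideanSpace ℝ (Fin n)}
    (hu : DifferentiableAt ℝ u x) (hX : DifferentiableAt ℝ X x) :
    divg (fun y => u y • X y) x = u x * divg X x + inner ℝ (gradient u x) (X x) := by
  rw [inner_gradient_apply]
  conv_rhs => rw [← sum_smul_single (X x)]
  unfold divg
  rw [map_sum, Finset.mul_sum, ← Finset.sum_add_distrib]
  refine Finset.sum_congr rfl fun i _ => ?_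
  rw [fderiv_fun_smul hu hX]
  simp
  ring

theorem divg_sub {X Y : EuclideanSpace ℝ (Fin n) → EuclideanSpace ℝ (Fin n)}
    {x : EuclideanSpace ℝ (Fin n)}
    (hX : DifferentiableAt ℝ X x) (hY : DifferentiableAt ℝ Y x) :
    divg (fun y => X y - Y y) x = divg X x - divg Y x := by
  unfold divg
  rw [← Finset.sum_sub_distrib, fderiv_fun_sub hX hY]
  simp

theorem divg_congr {X Y : EuclideanSpace ℝ (Fin n) → EuclideanSpace ℝ (Fin n)}
    {x : EuclideanSpace ℝ (Fin n)} (h : X =ᶠ[𝓝 x] Y) : divg X x = divg Y x := by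
  unfold divg
  rw [h.fderiv_eq]

theorem abs_divg_le (X : EuclideanSpace ℝ (Fin n) → EuclideanSpace ℝ (Fin n))
    (x : EuclideanSpace ℝ (Fin n)) : |divg X x| ≤ n * ‖fderiv ℝ X x‖ := by
  unfold divg
  refine (Finset.abs_sum_le_sum_abs _ _).trans ?_
  have : ∀ i ∈ (Finset.univ : Finset (Fin n)),
      |(fderiv ℝ X x (EuclideanSpace.single i 1)) i| ≤ ‖fderiv ℝ X x‖ := by
    intro i _
    have h1 := PiLp.norm_apply_le (fderiv ℝ X x (EuclideanSpace.single i 1)) i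
    have h2 := (fderiv ℝ X x).le_opNorm (EuclideanSpace.single i 1)
    rw [PiLp.norm_single, norm_one, mul_one] at h2
    rw [← Real.norm_eq_abs]
    exact h1.trans h2
  simpa using Finset.sum_le_sum this

theorem hasGradientAt_comp {φ : ℝ → ℝ} {φ' : ℝ} {u : EuclideanSpace ℝ (Fin n) → ℝ}
    {g x : EuclideanSpace ℝ (Fin n)} (hφ : HasDerivAt φ φ' (u x)) (hu : HasGradientAt u g x) :
    HasGradientAt (fun y => φ (u y)) (φ' • g) x := by
  rw [hasGradientAt_iff_hasFDerivAt] at *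
  have h := hφ.comp_hasFDerivAt x hu
  rw [map_smul]
  exact h

theorem hasGradientAt_mul {u v : EuclideanSpace ℝ (Fin n) → ℝ}
    {gu gv x : EuclideanSpace ℝ (Fin n)} (hu : HasGradientAt u gu x) (hv : HasGradientAt v gv x) :
    HasGradientAt (fun y => u y * v y) (u x • gv + v x • gu) x := by
  rw [hasGradientAt_iff_hasFDerivAt] at *
  have h := hu.mul hv
  rw [map_add, map_smul, map_smul]
  exact h

/-- The integral of the divergence of a compactly supported `C¹` field vanishes. -/
theorem integral_divg_eq_zero {Ω K : Set (EuclideanSpace ℝ (Fin n))} (hΩ : IsOpen Ω)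
    (hK : IsCompact K) (hKΩ : K ⊆ Ω) {X : EuclideanSpace ℝ (Fin n) → EuclideanSpace ℝ (Fin n)}
    (hX : ContDiffOn ℝ 1 X Ω) (hX0 : ∀ x ∈ Ω, x ∉ K → X x = 0) :
    ∫ x in Ω, divg X x = 0 := by
  -- Extension by zero is `C¹` everywhere: a point outside `Ω` has the complement of `K` as a
  -- neighbourhood, and `Z` vanishes there.
  set Z := Ω.indicator X with hZ
  have hZ0 : ∀ x, x ∉ K → Z x = 0 := by
    intro x hx
    by_cases h : x ∈ Ω
    · simp [hZ, h, hX0 x h hx]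
    · simp [hZ, h]
  have hZe : ∀ x ∈ Ω, Z =ᶠ[𝓝 x] X := fun x hx => by
    filter_upwards [hΩ.mem_nhds hx] with y hy
    simp [hZ, hy]
  have hZc : ContDiff ℝ 1 Z := by
    rw [contDiff_iff_contDiffAt]
    intro x
    by_cases h : x ∈ Ω
    · exact ((hX x h).contDiffAt (hΩ.mem_nhds h)).congr_of_eventuallyEq (hZe x h)
    · have : Z =ᶠ[𝓝 x] fun _ => 0 := by
        filter_upwards [hK.isClosed.isOpen_compl.mem_nhds (fun hx => h (hKΩ hx))] with y hy
        exact hZ0 y hy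
      exact contDiffAt_const.congr_of_eventuallyEq this
  have hcs : HasCompactSupport Z := HasCompactSupport.intro hK hZ0
  have hcs' : HasCompactSupport (fderiv ℝ Z) := hcs.fderiv ℝ
  have hcont : Continuous (fderiv ℝ Z) := hZc.continuous_fderiv (by norm_num)
  have hdiff : Differentiable ℝ Z := hZc.differentiable (by norm_num)
  have h1 : ∀ i : Fin n, ∫ x, (fderiv ℝ Z x (EuclideanSpace.single i 1)) i = 0 := by
    intro i
    have hd : Differentiable ℝ (fun x => Z x i) := by fun_prop
    have hfd : ∀ x, fderiv ℝ (fun x => Z x i) x (EuclideanSpace.single i 1)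
        = (fderiv ℝ Z x (EuclideanSpace.single i 1)) i := by
      intro x
      have := ((EuclideanSpace.proj (𝕜 := ℝ) i).hasFDerivAt.comp x (hdiff x).hasFDerivAt).fderiv
      have h2 : (EuclideanSpace.proj (𝕜 := ℝ) i ∘ Z) = fun x => Z x i := rfl
      rw [h2] at this
      rw [this]; rfl
    have hint : Integrable (fun x => (fderiv ℝ Z x (EuclideanSpace.single i 1)) i) := by
      refine Continuous.integrable_of_hasCompactSupport (by fun_prop) ?_
      refine hcs'.mono' ?_
      intro x hx
      refine subset_tsupport _ fun h => hx ?_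
      simp [h]
    have hint0 : Integrable (fun x => Z x i) := by
      refine Continuous.integrable_of_hasCompactSupport (by fun_prop) ?_
      refine hcs.mono' ?_
      intro x hx
      refine subset_tsupport _ fun h => hx ?_
      simp [h]
    -- Integration by parts against the constant `1`, one component at a time.
    have := integral_mul_fderiv_eq_neg_fderiv_mul_of_integrable (μ := volume)
      (f := fun _ : EuclideanSpace ℝ (Fin n) => (1 : ℝ)) (g := fun x => Z x i)
      (v := EuclideanSpace.single i 1) (by simp) (by simpa [hfd] using hint)
      (by simpa using hint0) (by simp) (fun x _ => hd x)
    simpa [hfd] using this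
  have h2 : ∫ x, divg Z x = 0 := by
    unfold divg
    rw [integral_finsetSum]
    · exact Finset.sum_eq_zero fun i _ => h1 i
    · intro i _
      refine Continuous.integrable_of_hasCompactSupport (by fun_prop) ?_
      refine hcs'.mono' ?_
      intro x hx
      refine subset_tsupport _ fun h => hx ?_
      simp [h]
  rw [← h2, ← setIntegral_eq_integral_of_forall_compl_eq_zero (s := Ω) (f := divg Z)]
  · exact setIntegral_congr_fun hΩ.measurableSet fun x hx => (divg_congr (hZe x hx)).symm
  · intro x hx
    have : Z =ᶠ[𝓝 x] fun _ => 0 := by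
      filter_upwards [hK.isClosed.isOpen_compl.mem_nhds (fun hx' => hx (hKΩ hx'))] with y hy
      exact hZ0 y hy
    rw [divg_congr this]
    simp [divg]

/-- A continuous function vanishing off a compact subset of an open set is integrable there. -/
theorem integrableOn_of_compact {Ω K : Set (EuclideanSpace ℝ (Fin n))} (hΩ : IsOpen Ω)
    (hK : IsCompact K) (hKΩ : K ⊆ Ω) {f : EuclideanSpace ℝ (Fin n) → ℝ}
    (hf : ContinuousOn f Ω) (hf0 : ∀ x ∈ Ω, x ∉ K → f x = 0) : IntegrableOn f Ω := by
  have h1 : IntegrableOn f K := (hf.mono hKΩ).integrableOn_compact hK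
  refine h1.of_forall_sdiff_eq_zero hΩ.measurableSet fun x hx => hf0 x hx.1 hx.2

theorem integrableOn_of_closure {Ω : Set (EuclideanSpace ℝ (Fin n))} (hb : Bornology.IsBounded Ω)
    {f : EuclideanSpace ℝ (Fin n) → ℝ} (hf : ContinuousOn f (closure Ω)) : IntegrableOn f Ω :=
  (hf.integrableOn_compact hb.isCompact_closure).mono_set subset_closure

end Calculus

/-! ### Geometry of `C²` domains -/

namespace IsC2Domain

variable {n : ℕ} {Ω : Set (EuclideanSpace ℝ (Fin n))}

/-- At a boundary point, `φ` becomes negative along every ray whose direction `v` satisfies `dφ(v) <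
0`. The tangent cone thus contains a nonempty open half-space, which spans. -/
theorem uniqueDiffOn_closure (hΩ : IsC2Domain Ω) : UniqueDiffOn ℝ (closure Ω) := by
  intro x hx
  by_cases hxΩ : x ∈ Ω
  · exact (hΩ.isOpen.uniqueDiffWithinAt hxΩ).mono subset_closure
  have hfr : x ∈ frontier Ω := by rw [hΩ.isOpen.frontier_eq]; exact ⟨hx, hxΩ⟩
  obtain ⟨U, φ, hU, hxU, hφ, hφ0, hφ', hΩU⟩ := hΩ.boundary x hfr
  set L := fderiv ℝ φ x
  have hL : HasFDerivAt φ L x :=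
    ((hφ.contDiffAt (hU.mem_nhds hxU)).differentiableAt (by norm_num)).hasFDerivAt
  have key : {v | L v < 0} ⊆ tangentConeAt ℝ (closure Ω) x := by
    intro v hv
    have hline : HasDerivAt (fun t : ℝ => φ (x + t • v)) (L v) 0 := by
      have h1 : HasDerivAt (fun t : ℝ => x + t • v) v 0 := by
        simpa using ((hasDerivAt_id (0 : ℝ)).smul_const v).const_add x
      have h2 : HasFDerivAt φ L (x + (0 : ℝ) • v) := by simpa using hL
      exact h2.comp_hasDerivAt (0 : ℝ) h1
    have hslope := (hasDerivAt_iff_tendsto_slope.1 hline)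
    have hneg : ∀ᶠ t in 𝓝[>] (0 : ℝ), φ (x + t • v) < 0 := by
      have h1 := (hslope.mono_left (nhdsWithin_mono 0 (fun t (ht : 0 < t) => ht.ne'))).eventually
        (gt_mem_nhds hv)
      filter_upwards [h1, self_mem_nhdsWithin] with t ht ht0
      rw [slope_def_field] at ht
      simp [hφ0] at ht
      have ht0' : (0 : ℝ) < t := ht0
      by_contra! hc
      exact absurd ht (not_lt.2 (div_nonneg hc ht0'.le))
    have hUe : ∀ᶠ t in 𝓝[>] (0 : ℝ), x + t • v ∈ U := by
      have : Tendsto (fun t : ℝ => x + t • v) (𝓝[>] 0) (𝓝 x) := by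
        have h : Continuous (fun t : ℝ => x + t • v) := by fun_prop
        have := h.tendsto 0
        simp at this
        exact this.mono_left nhdsWithin_le_nhds
      exact this (hU.mem_nhds hxU)
    refine mem_tangentConeAt_of_add_smul_mem (l := 𝓝[>] (0 : ℝ)) (c := fun t => t)
      ?_ ?_
    · exact tendsto_nhdsWithin_mono_right (fun t (ht : 0 < t) => ht.ne') tendsto_id
    · filter_upwards [hneg, hUe] with t h1 h2
      have : x + t • v ∈ Ω ∩ U := by rw [hΩU]; exact ⟨h2, h1⟩
      exact subset_closure this.1
  refine ⟨?_, subset_closure hx⟩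
  have hopen : IsOpen {v | L v < 0} := isOpen_lt L.continuous continuous_const
  have hne : {v | L v < 0}.Nonempty := by
    obtain ⟨v, hv⟩ : ∃ v, L v ≠ 0 := by
      by_contra! h
      exact hφ' (ContinuousLinearMap.ext h)
    rcases lt_or_gt_of_ne hv with h | h
    · exact ⟨v, h⟩
    · exact ⟨-v, by simpa using h⟩
  have hspan : Submodule.span ℝ {v | L v < 0} = ⊤ :=
    Submodule.eq_top_of_nonempty_interior' _
      (Set.Nonempty.mono (interior_mono Submodule.subset_span) (by
        rw [hopen.interior_eq]; exact hne))
  have : Submodule.span ℝ (tangentConeAt ℝ (closure Ω) x) = ⊤ :=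
    top_le_iff.1 (hspan ▸ Submodule.span_mono key)
  rw [this]
  exact dense_univ

theorem isCompact_closure (hΩ : IsC2Domain Ω) : IsCompact (closure Ω) :=
  hΩ.isBounded.isCompact_closure

theorem isCompact_frontier (hΩ : IsC2Domain Ω) : IsCompact (frontier Ω) :=
  hΩ.isCompact_closure.of_isClosed_subset isClosed_frontier frontier_subset_closure

theorem closure_mem_nhds (hΩ : IsC2Domain Ω) {x : EuclideanSpace ℝ (Fin n)} (hx : x ∈ Ω) :
    closure Ω ∈ 𝓝 x :=
  mem_of_superset (hΩ.isOpen.mem_nhds hx) subset_closure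

theorem mem_frontier_of (hΩ : IsC2Domain Ω) {x : EuclideanSpace ℝ (Fin n)} (hx : x ∈ closure Ω)
    (hx' : x ∉ Ω) : x ∈ frontier Ω := by
  rw [hΩ.isOpen.frontier_eq]; exact ⟨hx, hx'⟩

theorem gradientWithin_eq (hΩ : IsC2Domain Ω) (p : EuclideanSpace ℝ (Fin n) → ℝ)
    {x : EuclideanSpace ℝ (Fin n)} (hx : x ∈ Ω) :
    gradientWithin p (closure Ω) x = gradient p x := by
  unfold gradientWithin gradient
  rw [fderivWithin_of_mem_nhds (hΩ.closure_mem_nhds hx)]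

theorem continuousOn_gradientWithin (hΩ : IsC2Domain Ω) {p : EuclideanSpace ℝ (Fin n) → ℝ}
    (hp : ContDiffOn ℝ 1 p (closure Ω)) :
    ContinuousOn (gradientWithin p (closure Ω)) (closure Ω) := by
  have := hp.continuousOn_fderivWithin hΩ.uniqueDiffOn_closure (by norm_num)
  exact (LinearIsometryEquiv.continuous _).comp_continuousOn this

theorem divgWithin_eq (hΩ : IsC2Domain Ω)
    (F : EuclideanSpace ℝ (Fin n) → EuclideanSpace ℝ (Fin n))
    {x : EuclideanSpace ℝ (Fin n)} (hx : x ∈ Ω) :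
    divgWithin F (closure Ω) x = divg F x := by
  unfold divgWithin divg
  rw [fderivWithin_of_mem_nhds (hΩ.closure_mem_nhds hx)]

/-- A function continuous on `closure Ω × [0,∞)` is bounded on `closure Ω × [0,T]`. -/
theorem exists_bound (hΩ : IsC2Domain Ω) {F : Type*} [NormedAddCommGroup F]
    {f : EuclideanSpace ℝ (Fin n) → ℝ → F} {T : ℝ}
    (hf : ContinuousOn (fun z : EuclideanSpace ℝ (Fin n) × ℝ => f z.1 z.2)
      (closure Ω ×ˢ Icc 0 T)) :
    ∃ C, 0 ≤ C ∧ ∀ x ∈ closure Ω, ∀ t ∈ Icc 0 T, ‖f x t‖ ≤ C := by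
  obtain ⟨C, hC⟩ := (hΩ.isCompact_closure.prod isCompact_Icc).exists_bound_of_continuousOn hf
  exact ⟨max C 0, le_max_right _ _, fun x hx t ht => (hC (x, t) ⟨hx, ht⟩).trans (le_max_left _ _)⟩

/-- The derivative within `closure Ω × [0,∞)` is continuous, hence bounded on compact time
intervals. For `x ∈ Ω` and `t > 0` it is the full derivative, and the spatial derivative is its
restriction to the first factor; this is why `t = 0` is excluded. -/
theorem exists_bound_fderiv (hΩ : IsC2Domain Ω) {F : Type*} [NormedAddCommGroup F]
    [NormedSpace ℝ F] {f : EuclideanSpace ℝ (Fin n) → ℝ → F}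
    (hf : ContDiffOn ℝ 2 (fun z : EuclideanSpace ℝ (Fin n) × ℝ => f z.1 z.2)
      (closure Ω ×ˢ Ici (0 : ℝ))) (T : ℝ) :
    ∃ C, 0 ≤ C ∧ ∀ x ∈ Ω, ∀ t ∈ Ioc 0 T, ‖fderiv ℝ (fun y => f y t) x‖ ≤ C := by
  have hu : UniqueDiffOn ℝ (closure Ω ×ˢ Ici (0 : ℝ)) :=
    hΩ.uniqueDiffOn_closure.prod (uniqueDiffOn_Ici 0)
  have hc := hf.continuousOn_fderivWithin hu (by norm_num)
  obtain ⟨C, hC0, hC⟩ := hΩ.exists_bound (T := T)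
    (f := fun x t => fderivWithin ℝ (fun z : EuclideanSpace ℝ (Fin n) × ℝ => f z.1 z.2)
      (closure Ω ×ˢ Ici (0 : ℝ)) (x, t))
    (hc.mono (prod_mono_right Icc_subset_Ici_self))
  refine ⟨C, hC0, fun x hx t ht => ?_⟩
  have hnh : closure Ω ×ˢ Ici (0 : ℝ) ∈ 𝓝 (x, t) :=
    prod_mem_nhds (hΩ.closure_mem_nhds hx) (Ici_mem_nhds ht.1)
  have hd : DifferentiableAt ℝ (fun z : EuclideanSpace ℝ (Fin n) × ℝ => f z.1 z.2) (x, t) :=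
    (hf.contDiffAt hnh).differentiableAt (by norm_num)
  have h1 := hC x (subset_closure hx) t ⟨ht.1.le, ht.2⟩
  rw [fderivWithin_of_mem_nhds hnh] at h1
  have h2 : HasFDerivAt (fun y => f y t)
      ((fderiv ℝ (fun z : EuclideanSpace ℝ (Fin n) × ℝ => f z.1 z.2) (x, t)).comp
        (ContinuousLinearMap.inl ℝ (EuclideanSpace ℝ (Fin n)) ℝ)) x := by
    have := HasFDerivAt.comp (g := fun z : EuclideanSpace ℝ (Fin n) × ℝ => f z.1 z.2)
      (f := fun e => (e, t)) x hd.hasFDerivAt (hasFDerivAt_prodMk_left x t)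
    exact this
  rw [h2.fderiv]
  refine (ContinuousLinearMap.opNorm_comp_le _ _).trans ?_
  calc _ ≤ C * 1 := by
        gcongr
        exact ContinuousLinearMap.norm_inl_le_one ℝ _ _
    _ = C := mul_one C

theorem volume_lt_top (hΩ : IsC2Domain Ω) : volume Ω < ∞ := hΩ.isBounded.measure_lt_top

end IsC2Domain

end ParabolicISS

namespace ParabolicISS

/-! ### A smooth convex truncation -/

section Truncation

/-- The derivative of `trunc δ`: a smooth monotone function, `0` on `(-∞, δ]`, `1` on `[2δ, ∞)`. -/
noncomputable def truncD (δ r : ℝ) : ℝ := Real.smoothTransition (r / δ - 1)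

/-- A smooth convex approximation of the identity of `[0,∞)`, vanishing on `(-∞, δ]`. -/
noncomputable def trunc (δ r : ℝ) : ℝ := ∫ s in (0 : ℝ)..r, truncD δ s

variable {δ r : ℝ}

theorem contDiff_truncD (δ : ℝ) : ContDiff ℝ 2 (truncD δ) :=
  (Real.smoothTransition.contDiff (n := 2)).comp (by fun_prop)

theorem continuous_truncD (δ : ℝ) : Continuous (truncD δ) := (contDiff_truncD δ).continuous

theorem hasDerivAt_trunc (δ r : ℝ) : HasDerivAt (trunc δ) (truncD δ r) r :=
  intervalIntegral.integral_hasDerivAt_right ((continuous_truncD δ).intervalIntegrable _ _)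
    (continuous_truncD δ).aestronglyMeasurable.stronglyMeasurableAtFilter
    (continuous_truncD δ).continuousAt

theorem hasDerivAt_truncD (δ r : ℝ) : HasDerivAt (truncD δ) (deriv (truncD δ) r) r :=
  (((contDiff_truncD δ).differentiable (by norm_num)) r).hasDerivAt

theorem contDiff_trunc (δ : ℝ) : ContDiff ℝ 2 (trunc δ) := by
  have h : deriv (trunc δ) = truncD δ := funext fun r => (hasDerivAt_trunc δ r).deriv
  have := (contDiff_succ_iff_deriv (n := 1) (𝕜 := ℝ) (f := trunc δ)).2
    ⟨fun r => (hasDerivAt_trunc δ r).differentiableAt, by simp, by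
      rw [h]; exact (contDiff_truncD δ).of_le (by norm_num)⟩
  exact_mod_cast this

theorem continuous_deriv_truncD (δ : ℝ) : Continuous (deriv (truncD δ)) :=
  (contDiff_truncD δ).continuous_deriv (by norm_num)

theorem truncD_nonneg (δ r : ℝ) : 0 ≤ truncD δ r := Real.smoothTransition.nonneg _

theorem truncD_le_one (δ r : ℝ) : truncD δ r ≤ 1 := Real.smoothTransition.le_one _

theorem truncD_eq_zero (hδ : 0 < δ) (h : r ≤ δ) : truncD δ r = 0 :=
  Real.smoothTransition.zero_of_nonpos (by rw [sub_nonpos, div_le_one hδ]; exact h)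

theorem truncD_eq_one (hδ : 0 < δ) (h : 2 * δ ≤ r) : truncD δ r = 1 :=
  Real.smoothTransition.one_of_one_le (by
    rw [le_sub_iff_add_le, le_div_iff₀ hδ]; linarith)

theorem truncD_monotone (hδ : 0 < δ) : Monotone (truncD δ) := fun r s h =>
  Real.smoothTransition.monotone (by gcongr)

theorem deriv_truncD_nonneg (hδ : 0 < δ) (r : ℝ) : 0 ≤ deriv (truncD δ) r :=
  (truncD_monotone hδ).deriv_nonneg

theorem deriv_truncD_eq_zero (hδ : 0 < δ) (h : r < δ) : deriv (truncD δ) r = 0 := by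
  have : truncD δ =ᶠ[𝓝 r] fun _ => 0 := by
    filter_upwards [gt_mem_nhds h] with s hs using truncD_eq_zero hδ (le_of_lt hs)
  rw [this.deriv_eq, deriv_const]

theorem trunc_eq_zero (hδ : 0 < δ) (h : r ≤ δ) : trunc δ r = 0 := by
  unfold trunc
  refine intervalIntegral.integral_zero_ae (Eventually.of_forall fun s hs => ?_)
  refine truncD_eq_zero hδ ?_
  rcases mem_uIoc.1 hs with h1 | h1
  · exact h1.2.trans h
  · exact h1.2.trans hδ.le

theorem trunc_nonneg (δ : ℝ) (hr : 0 ≤ r) : 0 ≤ trunc δ r :=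
  intervalIntegral.integral_nonneg hr fun s _ => truncD_nonneg δ s

theorem trunc_le (δ : ℝ) (hr : 0 ≤ r) : trunc δ r ≤ r := by
  have := intervalIntegral.integral_mono_on hr ((continuous_truncD δ).intervalIntegrable 0 r)
    ((continuous_const (y := (1 : ℝ))).intervalIntegrable (μ := volume) 0 r)
    (fun s _ => truncD_le_one δ s)
  rw [intervalIntegral.integral_const, sub_zero, smul_eq_mul, mul_one] at this
  exact this

theorem sub_le_trunc (hδ : 0 < δ) (hr : 0 ≤ r) : r - 2 * δ ≤ trunc δ r := by
  rcases le_total r (2 * δ) with h | h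
  · exact (sub_nonpos.2 h).trans (trunc_nonneg δ hr)
  have h1 : trunc δ r = trunc δ (2 * δ) + ∫ s in (2 * δ)..r, truncD δ s :=
    (intervalIntegral.integral_add_adjacent_intervals
      ((continuous_truncD δ).intervalIntegrable _ _)
      ((continuous_truncD δ).intervalIntegrable _ _)).symm
  have h2 : ∫ s in (2 * δ)..r, truncD δ s = ∫ s in (2 * δ)..r, (1 : ℝ) :=
    intervalIntegral.integral_congr fun s hs => truncD_eq_one hδ (by
      rw [uIcc_of_le h] at hs; exact hs.1)
  have h3 := trunc_nonneg δ (r := 2 * δ) (by positivity)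
  rw [h1, h2, intervalIntegral.integral_const]
  simp only [smul_eq_mul, mul_one]
  linarith

/-- The elliptic inequality for the weight comes multiplied by `truncD`, while the energy carries
`trunc`; this estimate passes from `P * truncD` to `trunc` with error `O(δ)`. Below `2δ` both
quantities lie in `[0, 2δ]`; above it `truncD = 1` and `trunc` is within `2δ` of the identity. -/
theorem abs_mul_truncD_sub_trunc_le (hδ : 0 < δ) (hr : 0 ≤ r) :
    |r * truncD δ r - trunc δ r| ≤ 2 * δ := by
  have h1 := trunc_nonneg δ hr
  have h2 := trunc_le δ hr
  have h3 := sub_le_trunc hδ hr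
  rw [abs_le]
  rcases le_total r (2 * δ) with h | h
  · have h4 := mul_nonneg hr (truncD_nonneg δ r)
    have h5 := mul_le_of_le_one_right hr (truncD_le_one δ r)
    constructor <;> linarith
  · rw [truncD_eq_one hδ h]
    constructor <;> linarith

end Truncation

/-! ### Slicing along a direction -/

section Slicing

variable {m : ℕ}

/-- Orthogonal decomposition along a unit vector: the projection onto the complement and the
slicing formula for the Lebesgue integral. -/
theorem exists_slicing (e : EuclideanSpace ℝ (Fin (m + 1))) (he : ‖e‖ = 1) :
    ∃ (π : EuclideanSpace ℝ (Fin (m + 1)) →L[ℝ] EuclideanSpace ℝ (Fin m))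
      (ι : EuclideanSpace ℝ (Fin m) →L[ℝ] EuclideanSpace ℝ (Fin (m + 1))),
      LipschitzWith 1 π ∧ (∀ (s : ℝ) y, π (s • e + ι y) = y) ∧
      (∀ x, ‖x‖ ^ 2 = (inner ℝ e x) ^ 2 + ‖π x‖ ^ 2) ∧
      ∀ f : EuclideanSpace ℝ (Fin (m + 1)) → ℝ≥0∞, Measurable f →
        ∫⁻ x, f x = ∫⁻ y, ∫⁻ s : ℝ, f (s • e + ι y) := by
  have hv : Orthonormal ℝ (({0} : Set (Fin (m + 1))).domRestrict (fun _ => e)) := by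
    rw [orthonormal_iff_ite]
    rintro ⟨i, hi⟩ ⟨j, hj⟩
    have h1 : i = 0 := hi
    have h2 : j = 0 := hj
    subst h1 h2
    simp [domRestrict_apply, he]
  -- An orthonormal basis whose zeroth vector is `e`; `π` keeps the other coordinates and `ι`
  -- inserts a zero in position `0`.
  obtain ⟨b, hb⟩ := hv.exists_orthonormalBasis_extension_of_card_eq (by simp)
  have hb0 : b 0 = e := hb 0 rfl
  set R := b.repr
  let tail : EuclideanSpace ℝ (Fin (m + 1)) →L[ℝ] EuclideanSpace ℝ (Fin m) :=
    LinearMap.toContinuousLinearMap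
      { toFun := fun x => WithLp.toLp 2 fun i => x i.succ
        map_add' := fun x y => by ext i; simp
        map_smul' := fun c x => by ext i; simp }
  let cons0 : EuclideanSpace ℝ (Fin m) →L[ℝ] EuclideanSpace ℝ (Fin (m + 1)) :=
    LinearMap.toContinuousLinearMap
      { toFun := fun y => WithLp.toLp 2 (Fin.cons 0 fun i => y i)
        map_add' := fun x y => by ext i; refine Fin.cases ?_ (fun j => ?_) i <;> simp
        map_smul' := fun c x => by ext i; refine Fin.cases ?_ (fun j => ?_) i <;> simp }
  have htail : ∀ x i, tail x i = x i.succ := fun x i => rfl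
  have hcons0 : ∀ y, cons0 y 0 = 0 := fun y => rfl
  have hcons1 : ∀ y i, cons0 y (Fin.succ i) = y i := fun y i => rfl
  have hnorm : ∀ x : EuclideanSpace ℝ (Fin (m + 1)), ‖x‖ ^ 2 = (x 0) ^ 2 + ‖tail x‖ ^ 2 := by
    intro x
    rw [EuclideanSpace.norm_sq_eq, EuclideanSpace.norm_sq_eq, Fin.sum_univ_succ]
    simp [htail]
  have hR0 : ∀ x, R x 0 = inner ℝ e x := fun x => by
    rw [← hb0]; exact b.repr_apply_apply x 0
  have hRe : R e = EuclideanSpace.single 0 1 := by rw [← hb0]; exact b.repr_self 0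
  let π : EuclideanSpace ℝ (Fin (m + 1)) →L[ℝ] EuclideanSpace ℝ (Fin m) :=
    tail.comp (R.toContinuousLinearEquiv : EuclideanSpace ℝ (Fin (m + 1)) →L[ℝ] _)
  let ι : EuclideanSpace ℝ (Fin m) →L[ℝ] EuclideanSpace ℝ (Fin (m + 1)) :=
    (R.symm.toContinuousLinearEquiv : _ →L[ℝ] EuclideanSpace ℝ (Fin (m + 1))).comp cons0
  have hπ : ∀ x, π x = tail (R x) := fun x => rfl
  have hι : ∀ y, ι y = R.symm (cons0 y) := fun y => rfl
  have hpyth : ∀ x, ‖x‖ ^ 2 = (inner ℝ e x) ^ 2 + ‖π x‖ ^ 2 := by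
    intro x
    rw [← R.norm_map x, hnorm, hR0, hπ]
  refine ⟨π, ι, ?_, ?_, hpyth, ?_⟩
  · refine π.lipschitz.weaken ?_
    rw [← NNReal.coe_le_coe]
    simp only [coe_nnnorm, NNReal.coe_one]
    refine π.opNorm_le_bound zero_le_one fun x => ?_
    rw [one_mul]
    refine abs_le_of_sq_le_sq' ?_ (norm_nonneg _) |>.2
    rw [hpyth x]
    nlinarith [sq_nonneg (inner ℝ e x : ℝ)]
  · intro s y
    rw [hπ, hι, map_add, map_smul, hRe, LinearIsometryEquiv.apply_symm_apply]
    ext i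
    simp [htail, hcons1]
  · intro f hf
    have h1 : ∫⁻ x, f x = ∫⁻ z, f (R.symm z) :=
      ((b.measurePreserving_repr.symm b.measurableEquiv).lintegral_comp hf).symm
    have h2 : ∫⁻ z, f (R.symm z) = ∫⁻ z : Fin (m + 1) → ℝ, f (R.symm (WithLp.toLp 2 z)) :=
      ((PiLp.volume_preserving_toLp (Fin (m + 1))).lintegral_comp
        (hf.comp R.symm.continuous.measurable)).symm
    have h3 := ((volume_preserving_piFinSuccAbove (fun _ : Fin (m + 1) => ℝ) 0).symm).lintegral_comp
      (f := fun z : Fin (m + 1) → ℝ => f (R.symm (WithLp.toLp 2 z)))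
      ((hf.comp R.symm.continuous.measurable).comp (by fun_prop))
    -- Tonelli in the coordinates of this basis, with coordinate `0` running along `e` as the inner
    -- variable.
    rw [h1, h2, ← h3, Measure.volume_eq_prod, lintegral_prod_symm']
    · rw [← (PiLp.volume_preserving_ofLp (Fin m)).lintegral_comp]
      · refine lintegral_congr fun y => lintegral_congr fun s => ?_
        congr 1
        rw [hι]
        apply R.injective
        rw [LinearIsometryEquiv.apply_symm_apply, map_add, map_smul, hRe,
          LinearIsometryEquiv.apply_symm_apply]
        ext i
        refine Fin.cases ?_ (fun j => ?_) i
        · simp [hcons0]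
        · simp [hcons1]
      · exact Measurable.lintegral_prod_left' (f := fun z : ℝ × (Fin m → ℝ) =>
          f (R.symm (WithLp.toLp 2 ((MeasurableEquiv.piFinSuccAbove (fun _ => ℝ) 0).symm z))))
          (((hf.comp R.symm.continuous.measurable).comp (by fun_prop)).comp
            (MeasurableEquiv.measurable _))
    · exact ((hf.comp R.symm.continuous.measurable).comp (by fun_prop)).comp
          (MeasurableEquiv.measurable _)

end Slicing

end ParabolicISS

namespace ParabolicISS

theorem deriv_truncD_eq_zero_of_lt {δ r : ℝ} (hδ : 0 < δ) (h : 2 * δ < r) :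
    deriv (truncD δ) r = 0 := by
  have : truncD δ =ᶠ[𝓝 r] fun _ => 1 := by
    filter_upwards [lt_mem_nhds h] with s hs using truncD_eq_one hδ (le_of_lt hs)
  rw [this.deriv_eq, deriv_const]

/-- For a monotone function the integral of the derivative is the measure of the image, and the
image lies in `[0,1]`. No integrability has to be known beforehand. -/
theorem lintegral_deriv_le_of_monotone {I : Set ℝ} (hI : IsOpen I) (hI' : I.OrdConnected)
    {H H' : ℝ → ℝ} (hd : ∀ s ∈ I, HasDerivAt H (H' s) s) (h0 : ∀ s ∈ I, 0 ≤ H' s)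
    (hH0 : ∀ s, 0 ≤ H s) (hH1 : ∀ s, H s ≤ 1) :
    ∫⁻ s in I, ENNReal.ofReal (H' s) ≤ 1 := by
  have hmono : MonotoneOn H I := by
    refine monotoneOn_of_deriv_nonneg hI'.convex
      (fun s hs => (hd s hs).continuousAt.continuousWithinAt) ?_ ?_
    · rw [hI.interior_eq]
      exact fun s hs => (hd s hs).differentiableAt.differentiableWithinAt
    · rw [hI.interior_eq]
      intro s hs
      rw [(hd s hs).deriv]
      exact h0 s hs
  rw [lintegral_deriv_eq_volume_image_of_monotoneOn hI.measurableSet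
    (fun s hs => (hd s hs).hasDerivWithinAt) hmono]
  calc volume (H '' I) ≤ volume (Icc (0 : ℝ) 1) := by
        refine measure_mono ?_
        rintro _ ⟨s, _, rfl⟩
        exact ⟨hH0 s, hH1 s⟩
    _ = 1 := by simp

/-! ### Boundary charts -/

/-- In the ball `B(x₀, r)` the domain is the sublevel set of `φ`, whose gradient is within a
factor `1 + ε` of being parallel to the fixed direction `-e`. -/
structure IsBoundaryChart {n : ℕ} (Ω : Set (EuclideanSpace ℝ (Fin n)))
    (x₀ : EuclideanSpace ℝ (Fin n)) (r : ℝ) (φ : EuclideanSpace ℝ (Fin n) → ℝ)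
    (e : EuclideanSpace ℝ (Fin n)) (ε : ℝ) : Prop where
  pos : 0 < r
  norm_e : ‖e‖ = 1
  contDiffOn : ContDiffOn ℝ 2 φ (Metric.ball x₀ r)
  inter : Ω ∩ Metric.ball x₀ r = {x ∈ Metric.ball x₀ r | φ x < 0}
  fderiv_neg : ∀ x ∈ Metric.ball x₀ r, fderiv ℝ φ x e < 0
  norm_gradient_le : ∀ x ∈ Metric.ball x₀ r, ‖gradient φ x‖ ≤ (1 + ε) * -(fderiv ℝ φ x e)
  flat : ∀ x ∈ Metric.ball x₀ r, ∀ y ∈ Metric.ball x₀ r, φ x = 0 → φ y = 0 →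
    |(inner ℝ e (x - y) : ℝ)| ≤ 1 / 2 * ‖x - y‖

/-- By continuity of `dφ`, a small ball keeps `dφ` within `ε/4 * ‖∇φ(x₀)‖` of its value at the
centre. The direction `e = -∇φ(x₀)/‖∇φ(x₀)‖` is the inner normal at `x₀`, and all the chart
inequalities are perturbations of the case of affine `φ`. -/
theorem IsC2Domain.exists_chart {n : ℕ} {Ω : Set (EuclideanSpace ℝ (Fin n))}
    (hΩ : IsC2Domain Ω) {x₀ : EuclideanSpace ℝ (Fin n)} (hx₀ : x₀ ∈ frontier Ω) {ε : ℝ}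
    (hε : 0 < ε) (hε1 : ε ≤ 1) {W : Set (EuclideanSpace ℝ (Fin n))} (hW : W ∈ 𝓝 x₀) :
    ∃ r φ e, Metric.ball x₀ r ⊆ W ∧ IsBoundaryChart Ω x₀ r φ e ε := by
  obtain ⟨U, φ, hU, hxU, hφ, hφ0, hφ', hΩU⟩ := hΩ.boundary x₀ hx₀
  set G := gradient φ x₀ with hG
  have hGne : G ≠ 0 := fun h => hφ' (by
    have := toDual_gradient (𝕜 := ℝ) (f := φ) (x := x₀)
    rw [← this, ← hG, h, map_zero])
  set κ := ‖G‖
  have hκ : 0 < κ := norm_pos_iff.2 hGne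
  set e : EuclideanSpace ℝ (Fin n) := -(κ⁻¹ • G) with he
  have hne : ‖e‖ = 1 := by
    rw [he, norm_neg, norm_smul, norm_inv, Real.norm_of_nonneg hκ.le, inv_mul_cancel₀ hκ.ne']
  have hGe : G = -(κ • e) := by
    rw [he, smul_neg, neg_neg, smul_smul, mul_inv_cancel₀ hκ.ne', one_smul]
  have hcont : ContinuousAt (fderiv ℝ φ) x₀ :=
    (hφ.contDiffAt (hU.mem_nhds hxU)).continuousAt_fderiv (by norm_num)
  have hnear : ∀ᶠ x in 𝓝 x₀, ‖fderiv ℝ φ x - fderiv ℝ φ x₀‖ < ε / 4 * κ := by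
    have h1 : Tendsto (fun x => ‖fderiv ℝ φ x - fderiv ℝ φ x₀‖) (𝓝 x₀) (𝓝 0) := by
      simpa using (hcont.sub (continuousAt_const (y := fderiv ℝ φ x₀))).norm.tendsto
    exact h1.eventually (gt_mem_nhds (by positivity))
  obtain ⟨r, hr, hball⟩ := Metric.mem_nhds_iff.1
    (inter_mem (inter_mem hW (hU.mem_nhds hxU)) hnear)
  have hL : ∀ v, fderiv ℝ φ x₀ v = -(κ * inner ℝ e v) := by
    intro v
    rw [← inner_gradient_apply, ← hG, hGe, inner_neg_left, real_inner_smul_left]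
  have hclose : ∀ x ∈ Metric.ball x₀ r, ‖fderiv ℝ φ x - fderiv ℝ φ x₀‖ ≤ ε / 4 * κ :=
    fun x hx => le_of_lt (hball hx).2
  have hlow : ∀ x ∈ Metric.ball x₀ r, (1 - ε / 4) * κ ≤ -(fderiv ℝ φ x e) := by
    intro x hx
    have h1 := (fderiv ℝ φ x - fderiv ℝ φ x₀).le_opNorm e
    rw [hne, mul_one, sub_apply, hL e, real_inner_self_eq_norm_sq, hne,
      Real.norm_eq_abs] at h1
    have := (abs_le.1 (h1.trans (hclose x hx))).2
    linarith
  refine ⟨r, φ, e, fun x hx => (hball hx).1.1, hr, hne,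
    hφ.mono fun x hx => (hball hx).1.2, ?_, ?_, ?_, ?_⟩
  · ext x
    constructor
    · rintro ⟨h1, h2⟩
      have : x ∈ Ω ∩ U := ⟨h1, (hball h2).1.2⟩
      rw [hΩU] at this
      exact ⟨h2, this.2⟩
    · rintro ⟨h1, h2⟩
      have : x ∈ Ω ∩ U := by rw [hΩU]; exact ⟨(hball h1).1.2, h2⟩
      exact ⟨this.1, h1⟩
  · intro x hx
    have := hlow x hx
    nlinarith
  · intro x hx
    have h1 : ‖gradient φ x‖ = ‖fderiv ℝ φ x‖ := by
      unfold gradient; exact LinearIsometryEquiv.norm_map _ _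
    have h2 : κ = ‖fderiv ℝ φ x₀‖ := by
      change ‖gradient φ x₀‖ = _
      unfold gradient; exact LinearIsometryEquiv.norm_map _ _
    have h3 : ‖fderiv ℝ φ x‖ ≤ ‖fderiv ℝ φ x - fderiv ℝ φ x₀‖ + ‖fderiv ℝ φ x₀‖ := by
      simpa using norm_add_le (fderiv ℝ φ x - fderiv ℝ φ x₀) (fderiv ℝ φ x₀)
    rw [h1]
    have h4 := hclose x hx
    have h5 := hlow x hx
    rw [← h2] at h3
    -- The gradient has norm at most `(1 + ε/4) κ`, and `1 + ε/4 ≤ (1 + ε)(1 - ε/4)` because `ε ≤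
    -- 1`.
    have h6 : (1 + ε) * ((1 - ε / 4) * κ) ≤ (1 + ε) * -(fderiv ℝ φ x e) := by gcongr
    nlinarith [mul_pos hε hκ, mul_nonneg (mul_pos hε hκ).le (sub_nonneg.2 hε1)]
  · intro x hx y hy hx0 hy0
    -- Mean value inequality for `φ - dφ(x₀)` between two zeros of `φ`; only `κ ⟨e, x - y⟩` survives
    -- on the left.
    have h1 := (convex_ball x₀ r).norm_image_sub_le_of_norm_hasFDerivWithin_le'
      (f := φ) (f' := fderiv ℝ φ) (φ := fderiv ℝ φ x₀) (C := ε / 4 * κ)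
      (fun z hz => (((hφ.contDiffAt (hU.mem_nhds (hball hz).1.2)).differentiableAt
        (by norm_num)).hasFDerivAt).hasFDerivWithinAt) hclose hy hx
    rw [hx0, hy0, hL, sub_zero, zero_sub, neg_neg, norm_mul, Real.norm_of_nonneg hκ.le,
      Real.norm_eq_abs] at h1
    have h2 : κ * |(inner ℝ e (x - y) : ℝ)| ≤ κ * (1 / 2 * ‖x - y‖) := by
      refine h1.trans ?_
      nlinarith [mul_nonneg hκ.le (norm_nonneg (x - y))]
    exact le_of_mul_le_mul_left h2 hκ

namespace IsBoundaryChart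

section

variable {n : ℕ} {Ω : Set (EuclideanSpace ℝ (Fin n))} {x₀ e : EuclideanSpace ℝ (Fin n)}
  {r ε : ℝ} {φ : EuclideanSpace ℝ (Fin n) → ℝ}

theorem hasFDerivAt (h : IsBoundaryChart Ω x₀ r φ e ε) {x : EuclideanSpace ℝ (Fin n)}
    (hx : x ∈ Metric.ball x₀ r) : HasFDerivAt φ (fderiv ℝ φ x) x :=
  ((h.contDiffOn.contDiffAt (Metric.isOpen_ball.mem_nhds hx)).differentiableAt
    (by norm_num)).hasFDerivAt

theorem continuousOn_gradient (h : IsBoundaryChart Ω x₀ r φ e ε) :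
    ContinuousOn (gradient φ) (Metric.ball x₀ r) :=
  (LinearIsometryEquiv.continuous _).comp_continuousOn
    (h.contDiffOn.continuousOn_fderiv_of_isOpen Metric.isOpen_ball (by norm_num))

theorem mem_frontier (h : IsBoundaryChart Ω x₀ r φ e ε) (hΩ : IsOpen Ω)
    {x : EuclideanSpace ℝ (Fin n)}
    (hx : x ∈ Metric.ball x₀ r) (hcl : x ∈ closure Ω) (h0 : φ x = 0) : x ∈ frontier Ω := by
  rw [hΩ.frontier_eq]
  refine ⟨hcl, fun hxΩ => ?_⟩
  have : x ∈ Ω ∩ Metric.ball x₀ r := ⟨hxΩ, hx⟩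
  rw [h.inter] at this
  exact this.2.ne h0

theorem nonpos_of_mem_closure (h : IsBoundaryChart Ω x₀ r φ e ε)
    {x : EuclideanSpace ℝ (Fin n)} (hx : x ∈ Metric.ball x₀ r) (hcl : x ∈ closure Ω) :
    φ x ≤ 0 := by
  by_contra! hpos
  have h1 : ∀ᶠ y in 𝓝 x, 0 < φ y ∧ y ∈ Metric.ball x₀ r :=
    ((h.hasFDerivAt hx).continuousAt.eventually (lt_mem_nhds hpos)).and
      (Metric.isOpen_ball.mem_nhds hx)
  obtain ⟨y, hy, hyΩ⟩ := mem_closure_iff_nhds.1 hcl _ h1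
  have : y ∈ Ω ∩ Metric.ball x₀ r := ⟨hyΩ, hy.2⟩
  rw [h.inter] at this
  exact absurd this.2 (not_lt.2 hy.1.le)

theorem eq_zero_of_mem_frontier (h : IsBoundaryChart Ω x₀ r φ e ε) (hΩ : IsOpen Ω)
    {x : EuclideanSpace ℝ (Fin n)} (hx : x ∈ Metric.ball x₀ r) (hfr : x ∈ frontier Ω) :
    φ x = 0 := by
  refine le_antisymm (h.nonpos_of_mem_closure hx (frontier_subset_closure hfr)) ?_
  by_contra! hneg
  have : x ∈ Ω ∩ Metric.ball x₀ r := by rw [h.inter]; exact ⟨hx, hneg⟩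
  rw [hΩ.frontier_eq] at hfr
  exact hfr.2 this.1

end

section

variable {m : ℕ} {Ω : Set (EuclideanSpace ℝ (Fin (m + 1)))}
  {x₀ e : EuclideanSpace ℝ (Fin (m + 1))}
  {r ε : ℝ} {φ : EuclideanSpace ℝ (Fin (m + 1)) → ℝ}

/-- The gradient mass of the cutoff `truncD δ (-φ)`. -/
noncomputable def mass (φ : EuclideanSpace ℝ (Fin (m + 1)) → ℝ) (δ : ℝ)
    (x : EuclideanSpace ℝ (Fin (m + 1))) : ℝ :=
  ‖gradient φ x‖ * deriv (truncD δ) (-φ x)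

theorem continuousOn_mass (h : IsBoundaryChart Ω x₀ r φ e ε) (δ : ℝ) :
    ContinuousOn (mass φ δ) (Metric.ball x₀ r) :=
  h.continuousOn_gradient.norm.mul
    ((continuous_deriv_truncD δ).comp_continuousOn h.contDiffOn.continuousOn.neg)

/-- Up to the factor `1 + ε`, the mass density is the derivative of `truncD δ (-φ)` in the direction
`e`. This function increases from at least `0` to at most `1` along each line parallel to `e`, so a
line contributes at most `1 + ε`, and nothing unless it meets the shell `δ ≤ -φ ≤ 2δ` inside `K`.
Integrating over the lines gives the measure of the projected shell. -/
theorem lintegral_mass_le (h : IsBoundaryChart Ω x₀ r φ e ε) (hε : 0 < ε)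
    {π : EuclideanSpace ℝ (Fin (m + 1)) →L[ℝ] EuclideanSpace ℝ (Fin m)}
    {ι : EuclideanSpace ℝ (Fin m) →L[ℝ] EuclideanSpace ℝ (Fin (m + 1))}
    (hπι : ∀ (s : ℝ) y, π (s • e + ι y) = y)
    (hint : ∀ f : EuclideanSpace ℝ (Fin (m + 1)) → ℝ≥0∞, Measurable f →
        ∫⁻ x, f x = ∫⁻ y, ∫⁻ s : ℝ, f (s • e + ι y))
    {K : Set (EuclideanSpace ℝ (Fin (m + 1)))} (hK : IsCompact K) (hKV : K ⊆ Metric.ball x₀ r)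
    {δ : ℝ} (hδ : 0 < δ) :
    ∫⁻ x in K, ENNReal.ofReal (mass φ δ x) ≤
      ENNReal.ofReal (1 + ε) * volume (π '' (K ∩ {x | -φ x ∈ Icc δ (2 * δ)})) := by
  classical
  set Kδ := K ∩ {x | -φ x ∈ Icc δ (2 * δ)} with hKδ
  have hKδc : IsCompact Kδ := by
    have : IsClosed (K ∩ (fun x => -φ x) ⁻¹' (Icc δ (2 * δ))) :=
      (h.contDiffOn.continuousOn.mono hKV).neg.preimage_isClosed_of_isClosed hK.isClosed isClosed_Icc
    exact hK.of_isClosed_subset this inter_subset_left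
  have hmeasf : Measurable (K.indicator fun x => ENNReal.ofReal (mass φ δ x)) := by
    rw [← piecewise_eq_indicator]
    exact ContinuousOn.measurable_piecewise
      (ENNReal.continuous_ofReal.comp_continuousOn ((h.continuousOn_mass δ).mono hKV))
      continuousOn_const hK.measurableSet
  rw [← lintegral_indicator hK.measurableSet, hint _ hmeasf]
  have key : ∀ y, ∫⁻ s : ℝ, K.indicator (fun x => ENNReal.ofReal (mass φ δ x)) (s • e + ι y) ≤
      (π '' Kδ).indicator (fun _ => ENNReal.ofReal (1 + ε)) y := by
    intro y
    by_cases hy : y ∈ π '' Kδ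
    · rw [indicator_of_mem hy]
      set I : Set ℝ := {s | s • e + ι y ∈ Metric.ball x₀ r} with hI
      have hcl : Continuous fun s : ℝ => s • e + ι y := by fun_prop
      have hIo : IsOpen I := Metric.isOpen_ball.preimage hcl
      have hIc : I.OrdConnected := by
        have : Convex ℝ I := by
          intro a ha b hb p q hp hq hpq
          have h1 := convex_ball x₀ r ha hb hp hq hpq
          have h2 : p • (a • e + ι y) + q • (b • e + ι y) = (p • a + q • b) • e + ι y := by
            rw [← eq_sub_iff_add_eq'] at hpq
            subst hpq
            simp only [smul_eq_mul]
            module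
          rw [h2] at h1
          exact h1
        exact this.ordConnected
      set H' : ℝ → ℝ := fun s =>
        deriv (truncD δ) (-φ (s • e + ι y)) * -(fderiv ℝ φ (s • e + ι y) e) with hH'
      have hd : ∀ s ∈ I, HasDerivAt (fun s : ℝ => truncD δ (-φ (s • e + ι y))) (H' s) s := by
        intro s hs
        have h1 : HasDerivAt (fun s : ℝ => s • e + ι y) e s := by
          simpa using ((hasDerivAt_id s).smul_const e).add_const (ι y)
        have h2 := ((h.hasFDerivAt hs).comp_hasDerivAt s h1).neg
        exact (hasDerivAt_truncD δ _).comp s h2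
      have h0 : ∀ s ∈ I, 0 ≤ H' s := fun s hs =>
        mul_nonneg (deriv_truncD_nonneg hδ _) (neg_nonneg.2 (h.fderiv_neg _ hs).le)
      have hle := lintegral_deriv_le_of_monotone hIo hIc hd h0
        (fun s => truncD_nonneg δ _) (fun s => truncD_le_one δ _)
      calc ∫⁻ s : ℝ, K.indicator (fun x => ENNReal.ofReal (mass φ δ x)) (s • e + ι y)
          ≤ ∫⁻ s : ℝ, I.indicator (fun s => ENNReal.ofReal (1 + ε) * ENNReal.ofReal (H' s)) s := by
            refine lintegral_mono fun s => ?_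
            by_cases hs : s • e + ι y ∈ K
            · have hsI : s ∈ I := hKV hs
              rw [indicator_of_mem hs, indicator_of_mem hsI,
                ← ENNReal.ofReal_mul (by positivity)]
              refine ENNReal.ofReal_le_ofReal ?_
              have := mul_le_mul_of_nonneg_right (h.norm_gradient_le _ hsI)
                (deriv_truncD_nonneg hδ (-φ (s • e + ι y)))
              simp only [mass, hH']
              linarith
            · rw [indicator_of_notMem hs]; exact zero_le
        _ = ENNReal.ofReal (1 + ε) * ∫⁻ s in I, ENNReal.ofReal (H' s) := by
            rw [lintegral_indicator hIo.measurableSet, lintegral_const_mul' _ _ ENNReal.ofReal_ne_top]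
        _ ≤ ENNReal.ofReal (1 + ε) * 1 := by gcongr
        _ = ENNReal.ofReal (1 + ε) := mul_one _
    · rw [indicator_of_notMem hy, nonpos_iff_eq_zero]
      have : ∀ s : ℝ, K.indicator (fun x => ENNReal.ofReal (mass φ δ x)) (s • e + ι y) = 0 := by
        intro s
        by_cases hs : s • e + ι y ∈ K
        · rw [indicator_of_mem hs]
          have hn : -φ (s • e + ι y) ∉ Icc δ (2 * δ) := fun hc =>
            hy ⟨s • e + ι y, ⟨hs, hc⟩, hπι s y⟩
          have hz : deriv (truncD δ) (-φ (s • e + ι y)) = 0 := by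
            rcases lt_or_ge (-φ (s • e + ι y)) δ with h1 | h1
            · exact deriv_truncD_eq_zero hδ h1
            · refine deriv_truncD_eq_zero_of_lt hδ ?_
              by_contra! h2
              exact hn ⟨h1, h2⟩
          simp [mass, hz]
        · exact indicator_of_notMem hs _
      simp [this]
  refine (lintegral_mono key).trans ?_
  rw [lintegral_indicator (hKδc.image π.continuous).measurableSet, lintegral_const,
    Measure.restrict_apply_univ]

/-- Outer regularity encloses the projection of the zero set in an open set `O` of measure below
`c`. On the compact set `K \ π⁻¹ O` the function `|φ|` has a positive minimum, so thin shells
project into `O`. -/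
theorem eventually_volume_image_le (h : IsBoundaryChart Ω x₀ r φ e ε)
    (π : EuclideanSpace ℝ (Fin (m + 1)) →L[ℝ] EuclideanSpace ℝ (Fin m))
    {K : Set (EuclideanSpace ℝ (Fin (m + 1)))} (hK : IsCompact K) (hKV : K ⊆ Metric.ball x₀ r)
    {c : ℝ≥0∞} (hc : volume (π '' (K ∩ {x | φ x = 0})) < c) :
    ∀ᶠ δ in 𝓝[>] (0 : ℝ), volume (π '' (K ∩ {x | -φ x ∈ Icc δ (2 * δ)})) ≤ c := by
  obtain ⟨O, hO, hOo, hOc⟩ := (π '' (K ∩ {x | φ x = 0})).exists_isOpen_lt_of_lt c hc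
  have hpre : IsOpen (π ⁻¹' O) := hOo.preimage π.continuous
  have hK2 : IsCompact (K \ π ⁻¹' O) := hK.diff hpre
  have hne : ∀ x ∈ K \ π ⁻¹' O, 0 < |φ x| := by
    intro x hx
    rw [abs_pos]
    intro h0
    exact hx.2 (hO ⟨x, ⟨hx.1, h0⟩, rfl⟩)
  have hcont : ContinuousOn (fun x => |φ x|) (K \ π ⁻¹' O) :=
    (h.contDiffOn.continuousOn.mono (sdiff_subset.trans hKV)).abs
  obtain ⟨a, ha, hle⟩ : ∃ a > 0, ∀ x ∈ K \ π ⁻¹' O, a ≤ |φ x| := by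
    rcases (K \ π ⁻¹' O).eq_empty_or_nonempty with hem | hnem
    · exact ⟨1, one_pos, by simp [hem]⟩
    · obtain ⟨x, hx, hmin⟩ := hK2.exists_isMinOn hnem hcont
      exact ⟨|φ x|, hne x hx, fun y hy => hmin hy⟩
  have : ∀ᶠ δ in 𝓝[>] (0 : ℝ), δ < a / 2 := nhdsWithin_le_nhds (gt_mem_nhds (by positivity))
  filter_upwards [this, self_mem_nhdsWithin] with δ hδ hδ0
  have hδ0' : 0 < δ := hδ0
  refine (measure_mono ?_).trans hOc.le
  rintro _ ⟨x, ⟨hxK, hx⟩, rfl⟩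
  by_contra hxO
  have h1 := hle x ⟨hxK, hxO⟩
  have h2 : |φ x| ≤ 2 * δ := by
    rw [← abs_neg, abs_of_nonneg (hδ0'.le.trans hx.1)]
    exact hx.2
  linarith

/-- Zeros of `φ` in `closure Ω` are boundary points, the `1`-Lipschitz map `π` does not increase
`m`-dimensional Hausdorff measure, and in `ℝᵐ` the normalised Hausdorff measure is Lebesgue measure.
-/
theorem volume_image_le_surfaceMeasure (h : IsBoundaryChart Ω x₀ r φ e ε) (hΩ : IsOpen Ω)
    {π : EuclideanSpace ℝ (Fin (m + 1)) →L[ℝ] EuclideanSpace ℝ (Fin m)} (hπ : LipschitzWith 1 π)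
    {K : Set (EuclideanSpace ℝ (Fin (m + 1)))} (hK : IsCompact K)
    (hKV : K ⊆ Metric.ball x₀ r) (hKΩ : K ⊆ closure Ω) :
    volume (π '' (K ∩ {x | φ x = 0})) ≤ surfaceMeasure Ω K := by
  rw [← EuclideanSpace.euclideanHausdorffMeasure_eq_volume]
  have h1 : K ∩ {x | φ x = 0} ⊆ K ∩ frontier Ω := fun x hx =>
    ⟨hx.1, h.mem_frontier hΩ (hKV hx.1) (hKΩ hx.1) hx.2⟩
  unfold surfaceMeasure
  rw [Measure.restrict_apply hK.measurableSet]
  refine le_trans ?_ (measure_mono h1)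
  have := (hπ.lipschitzOnWith (s := K ∩ {x | φ x = 0})).hausdorffMeasure_image_le
    (d := m) (by positivity)
  simp only [ENNReal.coe_one, ENNReal.one_rpow, one_mul] at this
  rw [Measure.euclideanHausdorffMeasure_def, Measure.euclideanHausdorffMeasure_def]
  simp only [Measure.smul_apply, Nat.add_sub_cancel]
  gcongr

end

end IsBoundaryChart

end ParabolicISS

namespace ParabolicISS

/-! ### Surface measure and the concentration of cutoff masses on the boundary -/

variable {m : ℕ} {Ω : Set (EuclideanSpace ℝ (Fin (m + 1)))}

/-- The boundary of a bounded `C²` domain has finite surface measure. -/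
theorem IsC2Domain.isFiniteMeasure_surfaceMeasure (hΩ : IsC2Domain Ω) :
    IsFiniteMeasure (surfaceMeasure Ω) := by
  have hloc : ∀ x ∈ frontier Ω, ∃ t ∈ 𝓝[frontier Ω] x, surfaceMeasure Ω t < ∞ := by
    intro x hx
    obtain ⟨r, φ, e, -, h⟩ := hΩ.exists_chart hx one_pos le_rfl univ_mem
    obtain ⟨π, ι, hπ, -, hpy, -⟩ := exists_slicing e h.norm_e
    set A := Metric.ball x r ∩ frontier Ω with hA
    refine ⟨A, inter_mem (mem_nhdsWithin_of_mem_nhds (Metric.ball_mem_nhds x h.pos))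
      self_mem_nhdsWithin, ?_⟩
    -- On the boundary piece the component along `e` is at most half the distance, so Pythagoras
    -- gives `‖π(a - b)‖² ≥ (3/4) ‖a - b‖²`. The Hausdorff measure of the piece is then at most
    -- `2^m` times that of a bounded subset of `ℝᵐ`.
    have hanti : AntilipschitzWith 2 (A.domRestrict π) := by
      refine AntilipschitzWith.of_le_mul_dist fun a b => ?_
      have h1 := h.flat a a.2.1 b b.2.1 (h.eq_zero_of_mem_frontier hΩ.isOpen a.2.1 a.2.2)
        (h.eq_zero_of_mem_frontier hΩ.isOpen b.2.1 b.2.2)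
      have h2 := hpy (a.1 - b.1)
      rw [Subtype.dist_eq, dist_eq_norm, domRestrict_apply, domRestrict_apply, dist_eq_norm,
        ← map_sub]
      have h3 : (inner ℝ e (a.1 - b.1) : ℝ) ^ 2 ≤ (1 / 2 * ‖a.1 - b.1‖) ^ 2 := by
        rw [← sq_abs]
        exact pow_le_pow_left₀ (abs_nonneg _) h1 2
      refine le_of_sq_le_sq ?_ (by positivity)
      simp only [NNReal.coe_ofNat]
      nlinarith [sq_nonneg ‖π (a.1 - b.1)‖]
    have h1 := hanti.le_hausdorffMeasure_image (d := m) (by positivity) univ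
    have h2 : (A.domRestrict π) '' univ ⊆ π '' (Metric.ball x r) := by
      rintro _ ⟨a, -, rfl⟩
      exact ⟨a, a.2.1, rfl⟩
    have h3 : Measure.euclideanHausdorffMeasure m (π '' (Metric.ball x r)) < ∞ := by
      rw [EuclideanSpace.euclideanHausdorffMeasure_eq_volume]
      refine lt_of_le_of_lt (measure_mono (image_mono Metric.ball_subset_closedBall)) ?_
      exact ((isCompact_closedBall x r).image π.continuous).measure_lt_top
    have h4 : Measure.euclideanHausdorffMeasure m A ≤
        2 ^ (m : ℝ) * Measure.euclideanHausdorffMeasure m (π '' (Metric.ball x r)) := by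
      have hiso : Isometry (Subtype.val : A → EuclideanSpace ℝ (Fin (m + 1))) :=
        isometry_subtype_coe
      have h5 := hiso.hausdorffMeasure_image (d := m) (Or.inl (by positivity)) univ
      rw [image_univ, Subtype.range_coe] at h5
      rw [Measure.euclideanHausdorffMeasure_def, Measure.euclideanHausdorffMeasure_def]
      simp only [Measure.smul_apply, h5]
      simp only [ENNReal.smul_def, smul_eq_mul]
      rw [mul_left_comm]
      gcongr
      refine h1.trans ?_
      simp only [ENNReal.coe_ofNat]
      gcongr
    unfold surfaceMeasure
    refine lt_of_le_of_lt (Measure.restrict_apply_le _ _) ?_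
    exact lt_of_le_of_lt h4 (ENNReal.mul_lt_top (by simp) h3)
  have := hΩ.isCompact_frontier.measure_lt_top_of_nhdsWithin (μ := surfaceMeasure Ω)
    (fun x hx => by
      obtain ⟨t, ht, ht'⟩ := hloc x hx
      exact ⟨t, ht, ht'⟩)
  constructor
  unfold surfaceMeasure at this ⊢
  rw [Measure.restrict_apply_self] at this
  rwa [Measure.restrict_apply_univ]

namespace IsBoundaryChart

variable {x₀ e : EuclideanSpace ℝ (Fin (m + 1))} {r ε : ℝ}
  {φ : EuclideanSpace ℝ (Fin (m + 1)) → ℝ}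

/-- The three preceding estimates chained: line by line bound, shrinking of the projected shells,
and comparison of the projection with surface measure. -/
theorem limsup_lintegral_mass_le (h : IsBoundaryChart Ω x₀ r φ e ε) (hε : 0 < ε)
    (hΩ : IsOpen Ω) {K : Set (EuclideanSpace ℝ (Fin (m + 1)))} (hK : IsCompact K)
    (hKV : K ⊆ Metric.ball x₀ r) (hKΩ : K ⊆ closure Ω)
    {δ : ℕ → ℝ} (hδ : Tendsto δ atTop (𝓝[>] 0)) :
    limsup (fun k => ∫⁻ x in K, ENNReal.ofReal (mass φ (δ k) x)) atTop ≤
      ENNReal.ofReal (1 + ε) * surfaceMeasure Ω K := by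
  obtain ⟨π, ι, hπ, hπι, -, hint⟩ := exists_slicing e h.norm_e
  have hpos : ∀ᶠ k in atTop, 0 < δ k := hδ.eventually self_mem_nhdsWithin
  have h1ε : ENNReal.ofReal (1 + ε) ≠ 0 := by
    rw [Ne, ENNReal.ofReal_eq_zero, not_le]; positivity
  refine le_trans ?_ (mul_le_mul_right (h.volume_image_le_surfaceMeasure hΩ hπ hK hKV hKΩ) _)
  refine ENNReal.le_of_forall_pos_le_add fun η hη _ => ?_
  have hfin : volume (π '' (K ∩ {x | φ x = 0})) < ∞ :=
    lt_of_le_of_lt (measure_mono (image_mono inter_subset_left))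
      (hK.image π.continuous).measure_lt_top
  -- Chosen so that the excess becomes exactly `η` after multiplication by `1 + ε`.
  set η' : ℝ≥0∞ := η / ENNReal.ofReal (1 + ε) with hη'
  have hη'0 : η' ≠ 0 := by
    rw [hη']
    exact (ENNReal.div_pos (by exact_mod_cast hη.ne') ENNReal.ofReal_ne_top).ne'
  have hev := hδ.eventually (h.eventually_volume_image_le π hK hKV
    (c := volume (π '' (K ∩ {x | φ x = 0})) + η') (ENNReal.lt_add_right hfin.ne hη'0))
  have hle : ∀ᶠ k in atTop, ∫⁻ x in K, ENNReal.ofReal (mass φ (δ k) x) ≤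
      ENNReal.ofReal (1 + ε) * (volume (π '' (K ∩ {x | φ x = 0})) + η') := by
    filter_upwards [hev, hpos] with k hk hk0
    exact (h.lintegral_mass_le hε hπι hint hK hKV hk0).trans (mul_le_mul_right hk _)
  refine (limsup_le_of_le (by isBoundedDefault) hle).trans ?_
  rw [mul_add, hη', ENNReal.mul_div_cancel h1ε ENNReal.ofReal_ne_top]

/-- The gradient masses of the cutoffs of a chart concentrate on the boundary. -/
theorem limsup_lintegral_mul_mass_le (h : IsBoundaryChart Ω x₀ r φ e ε) (hε : 0 < ε)
    (hΩ : IsOpen Ω) {K : Set (EuclideanSpace ℝ (Fin (m + 1)))} (hK : IsCompact K)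
    (hKV : K ⊆ Metric.ball x₀ r) (hKΩ : K ⊆ closure Ω)
    {G : EuclideanSpace ℝ (Fin (m + 1)) → ℝ} (hG : ContinuousOn G K) (hG0 : ∀ x ∈ K, 0 ≤ G x)
    {δ : ℕ → ℝ} (hδ0 : ∀ k, 0 < δ k) (hδ : Tendsto δ atTop (𝓝[>] 0)) :
    limsup (fun k => ∫⁻ x in K, ENNReal.ofReal (G x * mass φ (δ k) x)) atTop ≤
      ENNReal.ofReal (1 + ε) * ∫⁻ x in K, ENNReal.ofReal (G x) ∂(surfaceMeasure Ω) := by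
  classical
  obtain ⟨π, ι, hπ, hπι, -, hint⟩ := exists_slicing e h.norm_e
  set Gi := K.indicator G with hGi
  have hGm : Measurable Gi := by
    rw [hGi, ← piecewise_eq_indicator]
    exact ContinuousOn.measurable_piecewise hG continuousOn_const hK.measurableSet
  have hGi0 : ∀ x, 0 ≤ Gi x := fun x => indicator_nonneg hG0 x
  have hGiK : ∀ x ∈ K, Gi x = G x := fun x hx => indicator_of_mem hx G
  set d : ℕ → EuclideanSpace ℝ (Fin (m + 1)) → ℝ≥0∞ :=
    fun k => K.indicator fun x => ENNReal.ofReal (mass φ (δ k) x) with hd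
  have hdm : ∀ k, Measurable (d k) := by
    intro k
    simp only [hd]
    rw [← piecewise_eq_indicator]
    exact ContinuousOn.measurable_piecewise
      (ENNReal.continuous_ofReal.comp_continuousOn ((h.continuousOn_mass _).mono hKV))
      continuousOn_const hK.measurableSet
  have hlevel : ∀ s : ℝ, 0 < s → IsCompact {x | s ≤ Gi x} ∧ {x | s ≤ Gi x} ⊆ K := by
    intro s hs
    have hsub : {x | s ≤ Gi x} ⊆ K := by
      intro x hx
      by_contra hxK
      have : s ≤ Gi x := hx
      rw [hGi, indicator_of_notMem hxK] at this
      linarith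
    refine ⟨?_, hsub⟩
    have : {x | s ≤ Gi x} = K ∩ G ⁻¹' (Ici s) := by
      ext x
      constructor
      · intro hx
        exact ⟨hsub hx, by rw [mem_preimage, ← hGiK x (hsub hx)]; exact hx⟩
      · rintro ⟨hx, hx'⟩
        change s ≤ Gi x
        rw [hGiK x hx]; exact hx'
    rw [this]
    exact hK.of_isClosed_subset (hG.preimage_isClosed_of_isClosed hK.isClosed isClosed_Ici)
      inter_subset_left
  -- Layer cake formula: the weight `G` is removed by passing to its superlevel sets, which for
  -- positive levels are compact subsets of `K`.
  have hcake : ∀ k, ∫⁻ x in K, ENNReal.ofReal (G x * mass φ (δ k) x) =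
      ∫⁻ s in Ioi (0 : ℝ), (volume.withDensity (d k)) {x | s ≤ Gi x} := by
    intro k
    rw [← lintegral_eq_lintegral_meas_le _ (Eventually.of_forall hGi0) hGm.aemeasurable,
      lintegral_withDensity_eq_lintegral_mul (g := fun x => ENNReal.ofReal (Gi x)) _ (hdm k)
        (ENNReal.measurable_ofReal.comp hGm),
      ← lintegral_indicator hK.measurableSet]
    refine lintegral_congr fun x => ?_
    by_cases hx : x ∈ K
    · simp only [indicator_of_mem hx, hd, Pi.mul_apply, hGiK x hx]
      rw [ENNReal.ofReal_mul (hG0 x hx), mul_comm]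
    · simp only [indicator_of_notMem hx, hd, Pi.mul_apply, zero_mul]
  have hmass : ∀ k, ∀ s : ℝ, 0 < s → (volume.withDensity (d k)) {x | s ≤ Gi x} =
      ∫⁻ x in {x | s ≤ Gi x}, ENNReal.ofReal (mass φ (δ k) x) := by
    intro k s hs
    obtain ⟨hc, hsub⟩ := hlevel s hs
    rw [withDensity_apply _ hc.measurableSet]
    refine setLIntegral_congr_fun hc.measurableSet fun x hx => ?_
    simp only [hd, indicator_of_mem (hsub hx)]
  obtain ⟨B, hB⟩ := hK.exists_bound_of_continuousOn hG
  simp_rw [hcake]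
  -- Reverse Fatou in the level `s`. The level-set masses are dominated by a constant for `s ≤ B`
  -- and vanish for `s > B`, since `G ≤ B` on `K`.
  have hrev := limsup_lintegral_le (μ := volume.restrict (Ioi (0 : ℝ)))
    (f := fun k s => (volume.withDensity (d k)) {x | s ≤ Gi x})
    (g := (Ioc 0 B).indicator fun _ => ENNReal.ofReal (1 + ε) * volume (π '' K))
    (fun k => by
      refine Antitone.measurable ?_
      intro s t hst
      exact measure_mono fun x (hx : t ≤ Gi x) => hst.trans hx)
    (fun k => by
      filter_upwards [ae_restrict_mem measurableSet_Ioi] with s hs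
      have hs' : 0 < s := hs
      by_cases hsB : s ≤ B
      · rw [indicator_of_mem (show s ∈ Ioc 0 B from ⟨hs', hsB⟩), hmass k s hs']
        obtain ⟨hc, hsub⟩ := hlevel s hs'
        refine (h.lintegral_mass_le hε hπι hint hc (hsub.trans hKV) (hδ0 k)).trans ?_
        gcongr
        exact inter_subset_left.trans hsub
      · have : {x | s ≤ Gi x} = ∅ := by
          rw [eq_empty_iff_forall_notMem]
          intro x hx
          have hxK := (hlevel s hs').2 hx
          have h1 : s ≤ Gi x := hx
          rw [hGiK x hxK] at h1
          have h2 := hB x hxK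
          rw [Real.norm_eq_abs] at h2
          exact hsB (h1.trans ((le_abs_self _).trans h2))
        rw [this, measure_empty]
        exact zero_le)
    (by
      have hfin : volume (π '' K) < ∞ := (hK.image π.continuous).measure_lt_top
      rw [lintegral_indicator measurableSet_Ioc, lintegral_const]
      refine (ENNReal.mul_lt_top (ENNReal.mul_lt_top ENNReal.ofReal_lt_top hfin) ?_).ne
      rw [Measure.restrict_apply_univ]
      refine lt_of_le_of_lt (Measure.restrict_apply_le _ _) ?_
      simp)
  refine hrev.trans ?_
  have hσ : ∫⁻ x in K, ENNReal.ofReal (G x) ∂(surfaceMeasure Ω) =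
      ∫⁻ s in Ioi (0 : ℝ), (surfaceMeasure Ω).restrict K {x | s ≤ Gi x} := by
    rw [← lintegral_eq_lintegral_meas_le _ (Eventually.of_forall hGi0) hGm.aemeasurable]
    exact setLIntegral_congr_fun hK.measurableSet fun x hx => by simp only [hGiK x hx]
  rw [hσ, ← lintegral_const_mul' _ _ ENNReal.ofReal_ne_top]
  refine setLIntegral_mono' measurableSet_Ioi fun s hs => ?_
  obtain ⟨hc, hsub⟩ := hlevel s hs
  simp_rw [fun k => hmass k s hs]
  refine (h.limsup_lintegral_mass_le hε hΩ hc (hsub.trans hKV) (hsub.trans hKΩ) hδ).trans ?_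
  rw [Measure.restrict_apply hc.measurableSet, inter_eq_left.2 hsub]

end IsBoundaryChart

end ParabolicISS

namespace ParabolicISS

/-! ### Boundary layers of superlevel truncations -/

section Layer

variable {n : ℕ} {Ω : Set (EuclideanSpace ℝ (Fin n))} {P : EuclideanSpace ℝ (Fin n) → ℝ}

theorem contDiffOn_gradient {k : WithTop ℕ∞} (hΩ : IsOpen Ω) {u : EuclideanSpace ℝ (Fin n) → ℝ}
    (hu : ContDiffOn ℝ (k + 1) u Ω) : ContDiffOn ℝ k (gradient u) Ω :=
  (InnerProductSpace.toDual ℝ (EuclideanSpace ℝ (Fin n))).symm.contDiff.comp_contDiffOn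
    (hu.fderiv_of_isOpen hΩ le_rfl)

theorem continuousOn_divg (hΩ : IsOpen Ω)
    {X : EuclideanSpace ℝ (Fin n) → EuclideanSpace ℝ (Fin n)} (hX : ContDiffOn ℝ 1 X Ω) :
    ContinuousOn (divg X) Ω := by
  have h := hX.continuousOn_fderiv_of_isOpen hΩ (by norm_num)
  unfold divg
  refine continuousOn_finsetSum _ fun i _ => ?_
  exact (EuclideanSpace.proj (𝕜 := ℝ) i).continuous.comp_continuousOn
    (h.clm_apply continuousOn_const)

/-- A nonnegative function vanishing on the boundary: truncations are compactly supported. -/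
structure IsWeight (Ω : Set (EuclideanSpace ℝ (Fin n))) (P : EuclideanSpace ℝ (Fin n) → ℝ) :
    Prop where
  contDiffOn : ContDiffOn ℝ 2 P Ω
  contDiffOn_closure : ContDiffOn ℝ 1 P (closure Ω)
  nonneg : ∀ x ∈ Ω, 0 ≤ P x
  frontier : ∀ x ∈ frontier Ω, P x = 0

namespace IsWeight

theorem continuousOn (hP : IsWeight Ω P) : ContinuousOn P (closure Ω) :=
  hP.contDiffOn_closure.continuousOn

theorem hasGradientAt (hP : IsWeight Ω P) (hΩ : IsOpen Ω) {x : EuclideanSpace ℝ (Fin n)}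
    (hx : x ∈ Ω) : HasGradientAt P (gradient P x) x :=
  ((hP.contDiffOn.contDiffAt (hΩ.mem_nhds hx)).differentiableAt (by norm_num)).hasGradientAt

theorem contDiffOn_gradient (hP : IsWeight Ω P) (hΩ : IsOpen Ω) :
    ContDiffOn ℝ 1 (gradient P) Ω :=
  ParabolicISS.contDiffOn_gradient hΩ (by
    have := hP.contDiffOn
    norm_num
    exact this)

/-- An interior zero of a nonnegative function is a minimum. Thanks to this, `P` may vanish inside
`Ω` and no strong maximum principle is required. -/
theorem gradient_eq_zero (hP : IsWeight Ω P) (hΩ : IsOpen Ω) {x : EuclideanSpace ℝ (Fin n)}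
    (hx : x ∈ Ω) (h0 : P x = 0) : gradient P x = 0 := by
  have : IsLocalMin P x := by
    filter_upwards [hΩ.mem_nhds hx] with y hy
    rw [h0]; exact hP.nonneg y hy
  unfold gradient
  rw [this.fderiv_eq_zero, map_zero]

theorem isCompact_superlevel (hP : IsWeight Ω P) (hΩ : IsC2Domain Ω) (δ : ℝ) :
    IsCompact (closure Ω ∩ {x | δ ≤ P x}) :=
  hΩ.isCompact_closure.of_isClosed_subset
    (hP.continuousOn.preimage_isClosed_of_isClosed isClosed_closure isClosed_Ici)
    inter_subset_left

theorem superlevel_subset (hP : IsWeight Ω P) (hΩ : IsC2Domain Ω) {δ : ℝ} (hδ : 0 < δ) :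
    closure Ω ∩ {x | δ ≤ P x} ⊆ Ω := by
  rintro x ⟨hx, hxδ⟩
  by_contra hxΩ
  have h1 := hP.frontier x (hΩ.mem_frontier_of hx hxΩ)
  have h2 : δ ≤ P x := hxδ
  linarith

theorem lt_of_notMem {x : EuclideanSpace ℝ (Fin n)} {δ : ℝ} (hx : x ∈ Ω)
    (hx' : x ∉ closure Ω ∩ {x | δ ≤ P x}) : P x < δ := by
  by_contra! h
  exact hx' ⟨subset_closure hx, h⟩

/-- Comparison of the layer `truncD' (P) |∇P|²` with any cutoff `θ ≤ ζ` agreeing with `ζ` on the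
superlevel set. -/
theorem integral_layer_le (hP : IsWeight Ω P) (hΩ : IsC2Domain Ω) {M : ℝ}
    (hsup : ∀ x ∈ Ω, divg (gradient P) x ≤ M * (P x + ‖gradient P x‖))
    {δ : ℝ} (hδ : 0 < δ) {ζ θ : EuclideanSpace ℝ (Fin n) → ℝ} (hζ : ContDiffOn ℝ 1 ζ Ω)
    (hθ : ContDiffOn ℝ 1 θ Ω) (hθ0 : ∀ x ∈ Ω, 0 ≤ θ x)
    {K : Set (EuclideanSpace ℝ (Fin n))} (hK : IsCompact K) (hKΩ : K ⊆ Ω)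
    (hθK : ∀ x ∈ Ω, x ∉ K → θ x = 0) (hθζ : ∀ x ∈ Ω, δ ≤ P x → θ x = ζ x) :
    ∫ x in Ω, ζ x * (deriv (truncD δ) (P x) * ‖gradient P x‖ ^ 2) ≤
      ∫ x in Ω, ((θ x - truncD δ (P x) * ζ x) * (M * (P x + ‖gradient P x‖)) +
        (inner ℝ (gradient θ x) (gradient P x) -
          truncD δ (P x) * inner ℝ (gradient ζ x) (gradient P x))) := by
  have hΩo := hΩ.isOpen
  have hgP := hP.contDiffOn_gradient hΩo
  have hgPd : ∀ x ∈ Ω, DifferentiableAt ℝ (gradient P) x := fun x hx =>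
    (hgP.contDiffAt (hΩo.mem_nhds hx)).differentiableAt (by norm_num)
  have hζd : ∀ x ∈ Ω, DifferentiableAt ℝ ζ x := fun x hx =>
    (hζ.contDiffAt (hΩo.mem_nhds hx)).differentiableAt (by norm_num)
  have hθd : ∀ x ∈ Ω, DifferentiableAt ℝ θ x := fun x hx =>
    (hθ.contDiffAt (hΩo.mem_nhds hx)).differentiableAt (by norm_num)
  have hgζ : ContinuousOn (gradient ζ) Ω := (ParabolicISS.contDiffOn_gradient (k := 0) hΩo
    (by simpa using hζ)).continuousOn
  have hgθ : ContinuousOn (gradient θ) Ω := (ParabolicISS.contDiffOn_gradient (k := 0) hΩo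
    (by simpa using hθ)).continuousOn
  have hPc : ContinuousOn P Ω := hP.contDiffOn.continuousOn
  have hgPc := hgP.continuousOn
  have hT : ContDiffOn ℝ 1 (fun x => truncD δ (P x)) Ω :=
    ((contDiff_truncD δ).of_le (by norm_num)).comp_contDiffOn (hP.contDiffOn.of_le (by norm_num))
  have hTc := hT.continuousOn
  have hT' : ContinuousOn (fun x => deriv (truncD δ) (P x)) Ω :=
    (continuous_deriv_truncD δ).comp_continuousOn hPc
  have hdc := continuousOn_divg hΩo hgP
  set L := closure Ω ∩ {x | δ ≤ P x} with hL
  have hLc : IsCompact L := hP.isCompact_superlevel hΩ δ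
  have hLΩ : L ⊆ Ω := hP.superlevel_subset hΩ hδ
  have hTL : ∀ x ∈ Ω, x ∉ L → truncD δ (P x) = 0 := fun x hx hxL =>
    truncD_eq_zero hδ (lt_of_notMem hx hxL).le
  have hT'L : ∀ x ∈ Ω, x ∉ L → deriv (truncD δ) (P x) = 0 := fun x hx hxL =>
    deriv_truncD_eq_zero hδ (lt_of_notMem hx hxL)
  have hgθK : ∀ x ∈ Ω, x ∉ K → gradient θ x = 0 := by
    intro x hx hxK
    have : θ =ᶠ[𝓝 x] fun _ => 0 := by
      filter_upwards [hΩo.mem_nhds hx, hK.isClosed.isOpen_compl.mem_nhds hxK] with y hy hyK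
      exact hθK y hy hyK
    rw [this.gradient_eq, gradient_fun_const]
  -- first integration by parts
  have hdiv1 : ∀ x ∈ Ω, divg (fun y => (truncD δ (P y) * ζ y) • gradient P y) x =
      truncD δ (P x) * ζ x * divg (gradient P) x +
        (ζ x * (deriv (truncD δ) (P x) * ‖gradient P x‖ ^ 2) +
          truncD δ (P x) * inner ℝ (gradient ζ x) (gradient P x)) := by
    intro x hx
    have h1 := hasGradientAt_mul (hasGradientAt_comp (hasDerivAt_truncD δ (P x))
      (hP.hasGradientAt hΩo hx)) (hζd x hx).hasGradientAt
    rw [divg_smul h1.differentiableAt (hgPd x hx), h1.gradient]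
    simp only [inner_add_left, real_inner_smul_left, real_inner_self_eq_norm_sq]
    ring
  have hint1 := integral_divg_eq_zero hΩo hLc hLΩ
    (X := fun y => (truncD δ (P y) * ζ y) • gradient P y) ((hT.mul hζ).smul hgP)
    (fun x hx hxL => by simp [hTL x hx hxL])
  rw [setIntegral_congr_fun hΩo.measurableSet hdiv1] at hint1
  have i1 : IntegrableOn (fun x => truncD δ (P x) * ζ x * divg (gradient P) x) Ω :=
    integrableOn_of_compact hΩo hLc hLΩ ((hTc.mul hζ.continuousOn).mul hdc)
      (fun x hx hxL => by simp [hTL x hx hxL])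
  have i2 : IntegrableOn (fun x => ζ x * (deriv (truncD δ) (P x) * ‖gradient P x‖ ^ 2)) Ω :=
    integrableOn_of_compact hΩo hLc hLΩ (hζ.continuousOn.mul (hT'.mul (hgPc.norm.pow 2)))
      (fun x hx hxL => by simp [hT'L x hx hxL])
  have i3 : IntegrableOn (fun x => truncD δ (P x) * inner ℝ (gradient ζ x) (gradient P x)) Ω :=
    integrableOn_of_compact hΩo hLc hLΩ (hTc.mul (hgζ.inner hgPc))
      (fun x hx hxL => by simp [hTL x hx hxL])
  have i23 : IntegrableOn (fun x => ζ x * (deriv (truncD δ) (P x) * ‖gradient P x‖ ^ 2) +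
      truncD δ (P x) * inner ℝ (gradient ζ x) (gradient P x)) Ω := i2.add i3
  rw [integral_add i1 i23, integral_add i2 i3] at hint1
  -- second integration by parts
  have hdiv2 : ∀ x ∈ Ω, divg (fun y => θ y • gradient P y) x =
      θ x * divg (gradient P) x + inner ℝ (gradient θ x) (gradient P x) := fun x hx =>
    divg_smul (hθd x hx) (hgPd x hx)
  have hint2 := integral_divg_eq_zero hΩo hK hKΩ (X := fun y => θ y • gradient P y)
    (hθ.smul hgP) (fun x hx hxK => by simp [hθK x hx hxK])
  rw [setIntegral_congr_fun hΩo.measurableSet hdiv2] at hint2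
  have i4 : IntegrableOn (fun x => θ x * divg (gradient P) x) Ω :=
    integrableOn_of_compact hΩo hK hKΩ (hθ.continuousOn.mul hdc)
      (fun x hx hxK => by simp [hθK x hx hxK])
  have i5 : IntegrableOn (fun x => (inner ℝ (gradient θ x) (gradient P x) : ℝ)) Ω :=
    integrableOn_of_compact hΩo hK hKΩ (hgθ.inner hgPc)
      (fun x hx hxK => by simp [hgθK x hx hxK])
  rw [integral_add i4 i5] at hint2
  have hPN : ContinuousOn (fun x => M * (P x + ‖gradient P x‖)) Ω :=
    continuousOn_const.mul (hPc.add hgPc.norm)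
  have i6 : IntegrableOn (fun x => θ x * (M * (P x + ‖gradient P x‖))) Ω :=
    integrableOn_of_compact hΩo hK hKΩ (hθ.continuousOn.mul hPN)
      (fun x hx hxK => by simp [hθK x hx hxK])
  have i7 : IntegrableOn (fun x => truncD δ (P x) * ζ x * (M * (P x + ‖gradient P x‖))) Ω :=
    integrableOn_of_compact hΩo hLc hLΩ ((hTc.mul hζ.continuousOn).mul hPN)
      (fun x hx hxL => by simp [hTL x hx hxL])
  -- The two identities combine into the layer integral with `ΔP` multiplied by `θ - truncD δ (P)
  -- ζ`. This factor is nonnegative, so the upper bound on `ΔP` is enough.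
  have hmono : ∫ x in Ω, (truncD δ (P x) * ζ x * (M * (P x + ‖gradient P x‖)) -
        truncD δ (P x) * ζ x * divg (gradient P) x) ≤
      ∫ x in Ω, (θ x * (M * (P x + ‖gradient P x‖)) - θ x * divg (gradient P) x) := by
    refine setIntegral_mono_on (i7.sub i1) (i6.sub i4) hΩo.measurableSet fun x hx => ?_
    have hν : 0 ≤ M * (P x + ‖gradient P x‖) - divg (gradient P) x := sub_nonneg.2 (hsup x hx)
    have hle : truncD δ (P x) * ζ x ≤ θ x := by
      by_cases hxL : x ∈ L
      · rw [← hθζ x hx hxL.2]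
        exact mul_le_of_le_one_left (hθ0 x hx) (truncD_le_one _ _)
      · rw [hTL x hx hxL, zero_mul]; exact hθ0 x hx
    have := mul_le_mul_of_nonneg_right hle hν
    linarith
  rw [integral_sub i7 i1, integral_sub i6 i4] at hmono
  have i8 : IntegrableOn (fun x => (θ x - truncD δ (P x) * ζ x) *
      (M * (P x + ‖gradient P x‖))) Ω := by
    refine (i6.sub i7).congr_fun (fun x _ => ?_) hΩo.measurableSet
    simp only [Pi.sub_apply]; ring
  have e8 : ∫ x in Ω, (θ x - truncD δ (P x) * ζ x) * (M * (P x + ‖gradient P x‖)) =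
      (∫ x in Ω, θ x * (M * (P x + ‖gradient P x‖))) -
        ∫ x in Ω, truncD δ (P x) * ζ x * (M * (P x + ‖gradient P x‖)) := by
    rw [← integral_sub i6 i7]
    refine integral_congr_ae (Eventually.of_forall fun x => ?_)
    simp only; ring
  have i53 : IntegrableOn (fun x => (inner ℝ (gradient θ x) (gradient P x) : ℝ) -
      truncD δ (P x) * inner ℝ (gradient ζ x) (gradient P x)) Ω := i5.sub i3
  rw [integral_add i8 i53, e8, integral_sub i5 i3]
  linarith

/-- The mass of the region where the truncation is active tends to zero. -/
theorem tendsto_integral_one_sub (hP : IsWeight Ω P) (hΩ : IsC2Domain Ω) :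
    Tendsto (fun δ => ∫ x in Ω, (1 - truncD δ (P x)) * (P x + ‖gradient P x‖)) (𝓝[>] 0) (𝓝 0) := by
  have hΩo := hΩ.isOpen
  have hPc : ContinuousOn P Ω := hP.contDiffOn.continuousOn
  have hgPc := (hP.contDiffOn_gradient hΩo).continuousOn
  have hint : IntegrableOn (fun x => P x + ‖gradient P x‖) Ω := by
    have h1 := integrableOn_of_closure hΩ.isBounded (f := fun x => P x +
      ‖gradientWithin P (closure Ω) x‖) (hP.continuousOn.add
        (hΩ.continuousOn_gradientWithin hP.contDiffOn_closure).norm)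
    refine h1.congr_fun (fun x hx => ?_) hΩo.measurableSet
    simp only [hΩ.gradientWithin_eq P hx]
  suffices h : Tendsto (fun δ => ∫ x in Ω, (1 - truncD δ (P x)) * (P x + ‖gradient P x‖))
      (𝓝[>] 0) (𝓝 (∫ x in Ω, (0 : ℝ))) by simpa using h
  refine tendsto_integral_filter_of_dominated_convergence (fun x => P x + ‖gradient P x‖) ?_ ?_
    hint ?_
  · refine Eventually.of_forall fun δ => ?_
    refine ContinuousOn.aestronglyMeasurable ?_ hΩo.measurableSet
    exact (continuousOn_const.sub ((continuous_truncD δ).comp_continuousOn hPc)).mul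
      (hPc.add hgPc.norm)
  · refine Eventually.of_forall fun δ => ?_
    filter_upwards [ae_restrict_mem hΩo.measurableSet] with x hx
    have h1 := truncD_nonneg δ (P x)
    have h2 := truncD_le_one δ (P x)
    have h3 : 0 ≤ P x + ‖gradient P x‖ := add_nonneg (hP.nonneg x hx) (norm_nonneg _)
    rw [Real.norm_of_nonneg (mul_nonneg (by linarith) h3)]
    exact mul_le_of_le_one_left h3 (by linarith)
  · filter_upwards [ae_restrict_mem hΩo.measurableSet] with x hx
    -- Where `P = 0` the gradient vanishes too, so the integrand is zero; where `P > 0` it is zero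
    -- as soon as `2δ ≤ P x`.
    rcases (hP.nonneg x hx).eq_or_lt with h | h
    · simp [← h, hP.gradient_eq_zero hΩo hx h.symm]
    · refine tendsto_const_nhds.congr' ?_
      have : ∀ᶠ δ in 𝓝[>] (0 : ℝ), δ < P x / 2 :=
        nhdsWithin_le_nhds (gt_mem_nhds (by positivity))
      filter_upwards [this, self_mem_nhdsWithin] with δ h1 h2
      rw [truncD_eq_one h2 (by linarith)]
      simp

end IsWeight

end Layer

end ParabolicISS

namespace ParabolicISS

/-! ### Local estimates of the layer, in the interior and in boundary charts -/

section BoundaryLayer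

variable {m : ℕ} {Ω : Set (EuclideanSpace ℝ (Fin (m + 1)))}
  {P N : EuclideanSpace ℝ (Fin (m + 1)) → ℝ}

theorem IsC2Domain.integrable_surfaceMeasure (hΩ : IsC2Domain Ω)
    {F : EuclideanSpace ℝ (Fin (m + 1)) → ℝ} (hF : ContinuousOn F (closure Ω)) :
    Integrable F (surfaceMeasure Ω) := by
  have := hΩ.isFiniteMeasure_surfaceMeasure
  have h1 : IntegrableOn F (frontier Ω) (surfaceMeasure Ω) :=
    (hF.mono frontier_subset_closure).integrableOn_compact hΩ.isCompact_frontier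
  unfold IntegrableOn at h1
  unfold surfaceMeasure at h1 ⊢
  rwa [Measure.restrict_restrict isClosed_frontier.measurableSet, inter_self] at h1

theorem ae_mem_frontier (Ω : Set (EuclideanSpace ℝ (Fin (m + 1)))) :
    ∀ᵐ x ∂(surfaceMeasure Ω), x ∈ frontier Ω := by
  unfold surfaceMeasure
  exact ae_restrict_mem isClosed_frontier.measurableSet

/-- The weight of the error terms in the localised layer estimate. -/
noncomputable def layerError (Ω : Set (EuclideanSpace ℝ (Fin (m + 1))))
    (P : EuclideanSpace ℝ (Fin (m + 1)) → ℝ) (δ : ℝ) : ℝ :=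
  ∫ x in Ω, (1 - truncD δ (P x)) * (P x + ‖gradient P x‖)

/-- The density of the layer measure. -/
noncomputable def layer (P : EuclideanSpace ℝ (Fin (m + 1)) → ℝ) (δ : ℝ)
    (x : EuclideanSpace ℝ (Fin (m + 1))) : ℝ :=
  deriv (truncD δ) (P x) * ‖gradient P x‖ ^ 2

namespace IsWeight

theorem integrableOn_layerError (hP : IsWeight Ω P) (hΩ : IsC2Domain Ω) (δ : ℝ) :
    IntegrableOn (fun x => (1 - truncD δ (P x)) * (P x + ‖gradient P x‖)) Ω := by
  have h1 := integrableOn_of_closure hΩ.isBounded (f := fun x => (1 - truncD δ (P x)) * (P x +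
      ‖gradientWithin P (closure Ω) x‖))
      ((continuousOn_const.sub ((continuous_truncD δ).comp_continuousOn hP.continuousOn)).mul
        (hP.continuousOn.add (hΩ.continuousOn_gradientWithin hP.contDiffOn_closure).norm))
  refine h1.congr_fun (fun x hx => ?_) hΩ.isOpen.measurableSet
  simp only [hΩ.gradientWithin_eq P hx]

theorem exists_bound_of_hasCompactSupport {ζ : EuclideanSpace ℝ (Fin (m + 1)) → ℝ}
    (hζ : ContDiff ℝ 1 ζ) (hc : HasCompactSupport ζ) :
    ∃ B, 0 ≤ B ∧ (∀ x, |ζ x| ≤ B) ∧ ∀ x, ‖gradient ζ x‖ ≤ B := by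
  obtain ⟨B1, h1⟩ := hc.exists_bound_of_continuous hζ.continuous
  obtain ⟨B2, h2⟩ := (hc.fderiv ℝ).exists_bound_of_continuous
    (hζ.continuous_fderiv (by norm_num))
  refine ⟨max (max B1 B2) 0, le_max_right _ _, fun x => ?_, fun x => ?_⟩
  · exact (h1 x).trans ((le_max_left _ _).trans (le_max_left _ _))
  · have : ‖gradient ζ x‖ = ‖fderiv ℝ ζ x‖ := by
      unfold gradient; exact LinearIsometryEquiv.norm_map _ _
    rw [this]
    exact (h2 x).trans ((le_max_right _ _).trans (le_max_left _ _))

/-- Away from the boundary `θ = ζ` is itself an admissible cutoff. Everything then carries the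
factor `1 - truncD δ (P)`, so only the layer error remains. -/
theorem layer_le_interior (hP : IsWeight Ω P) (hΩ : IsC2Domain Ω) {M : ℝ} (hM : 0 ≤ M)
    (hsup : ∀ x ∈ Ω, divg (gradient P) x ≤ M * (P x + ‖gradient P x‖))
    {ζ : EuclideanSpace ℝ (Fin (m + 1)) → ℝ} (hζ : ContDiff ℝ 1 ζ) (hζ0 : ∀ x, 0 ≤ ζ x)
    (hc : HasCompactSupport ζ) (hsub : tsupport ζ ⊆ Ω) :
    ∃ C, 0 ≤ C ∧ ∀ δ, 0 < δ → ∫ x in Ω, ζ x * layer P δ x ≤ C * layerError Ω P δ := by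
  obtain ⟨B, hB0, hB1, hB2⟩ := exists_bound_of_hasCompactSupport hζ hc
  refine ⟨B * M + B, by positivity, fun δ hδ => ?_⟩
  have hΩo := hΩ.isOpen
  have h1 := hP.integral_layer_le hΩ hsup hδ (ζ := ζ) (θ := ζ) hζ.contDiffOn hζ.contDiffOn
    (fun x _ => hζ0 x) hc hsub (fun x _ hx => image_eq_zero_of_notMem_tsupport hx)
    (fun x _ _ => rfl)
  refine h1.trans ?_
  unfold layerError
  rw [← integral_const_mul]
  have hgζ : ContinuousOn (gradient ζ) Ω := (ParabolicISS.contDiffOn_gradient (k := 0) hΩo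
    (by simpa using hζ.contDiffOn)).continuousOn
  have hgP := (hP.contDiffOn_gradient hΩo).continuousOn
  have hPc : ContinuousOn P Ω := hP.contDiffOn.continuousOn
  have hTc : ContinuousOn (fun x => truncD δ (P x)) Ω :=
    (continuous_truncD δ).comp_continuousOn hPc
  refine setIntegral_mono_on ?_ ((hP.integrableOn_layerError hΩ δ).const_mul _)
    hΩo.measurableSet fun x hx => ?_
  · refine integrableOn_of_compact hΩo hc hsub ?_ fun x hx hxK => ?_
    · exact ((hζ.continuous.continuousOn.sub (hTc.mul hζ.continuous.continuousOn)).mul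
        (continuousOn_const.mul (hPc.add hgP.norm))).add
        ((hgζ.inner hgP).sub (hTc.mul (hgζ.inner hgP)))
    · have h2 : ζ x = 0 := image_eq_zero_of_notMem_tsupport hxK
      have h3 : gradient ζ x = 0 := by
        have : fderiv ℝ ζ x = 0 := image_eq_zero_of_notMem_tsupport
          (fun h => hxK (tsupport_fderiv_subset ℝ h))
        rw [gradient, this, map_zero]
      simp [h2, h3]
  · have hT0 := truncD_nonneg δ (P x)
    have hT1 := truncD_le_one δ (P x)
    have hP0 := hP.nonneg x hx
    have hg0 := norm_nonneg (gradient P x)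
    have hin : inner ℝ (gradient ζ x) (gradient P x) ≤ B * ‖gradient P x‖ :=
      (real_inner_le_norm _ _).trans (mul_le_mul_of_nonneg_right (hB2 x) hg0)
    have h2 : ζ x * (M * (P x + ‖gradient P x‖)) ≤ B * (M * (P x + ‖gradient P x‖)) := by
      gcongr
      exact (le_abs_self _).trans (hB1 x)
    have h3 : (ζ x * (M * (P x + ‖gradient P x‖)) + inner ℝ (gradient ζ x) (gradient P x)) ≤
        (B * M + B) * (P x + ‖gradient P x‖) := by nlinarith
    have h4 := mul_le_mul_of_nonneg_left h3 (sub_nonneg.2 hT1)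
    linarith

/-- Near the boundary the cutoff is `θ = ζ truncD d (-φ)`. Its gradient contains a multiple of `∇φ`,
which paired with `∇P` is bounded by `ζ |∇P|` times the mass density of the chart. Letting `d → 0`
with `δ` fixed turns this into `(1 + ε) ζ |∇P| dS`; all other terms go into the layer error. Here
`N` is the continuous extension of `|∇P|` to the closure. -/
theorem layer_le_chart (hP : IsWeight Ω P) (hΩ : IsC2Domain Ω) {M : ℝ} (hM : 0 ≤ M)
    (hsup : ∀ x ∈ Ω, divg (gradient P) x ≤ M * (P x + ‖gradient P x‖))
    (hNc : ContinuousOn N (closure Ω)) (hN : ∀ x ∈ Ω, N x = ‖gradient P x‖)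
    (hN0 : ∀ x ∈ closure Ω, 0 ≤ N x)
    {x₀ e : EuclideanSpace ℝ (Fin (m + 1))} {r ε : ℝ} {φ : EuclideanSpace ℝ (Fin (m + 1)) → ℝ}
    (h : IsBoundaryChart Ω x₀ r φ e ε) (hε : 0 < ε)
    {ζ : EuclideanSpace ℝ (Fin (m + 1)) → ℝ} (hζ : ContDiff ℝ 1 ζ) (hζ0 : ∀ x, 0 ≤ ζ x)
    (hc : HasCompactSupport ζ) (hsub : tsupport ζ ⊆ Metric.ball x₀ r) :
    ∃ C, 0 ≤ C ∧ ∀ δ, 0 < δ → ∫ x in Ω, ζ x * layer P δ x ≤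
      (1 + ε) * ∫ x, ζ x * N x ∂(surfaceMeasure Ω) + C * layerError Ω P δ := by
  obtain ⟨B, hB0, hB1, hB2⟩ := exists_bound_of_hasCompactSupport hζ hc
  refine ⟨B * M + B, by positivity, fun δ hδ => ?_⟩
  have hΩo := hΩ.isOpen
  set K₀ := tsupport ζ ∩ closure Ω with hK₀
  have hK₀c : IsCompact K₀ := hc.isCompact.inter_right isClosed_closure
  have hK₀V : K₀ ⊆ Metric.ball x₀ r := inter_subset_left.trans hsub
  have hζz : ∀ x, x ∉ tsupport ζ → ζ x = 0 := fun x hx => image_eq_zero_of_notMem_tsupport hx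
  have hgζz : ∀ x, x ∉ tsupport ζ → gradient ζ x = 0 := fun x hx => by
    have : fderiv ℝ ζ x = 0 := image_eq_zero_of_notMem_tsupport
      (fun h => hx (tsupport_fderiv_subset ℝ h))
    rw [gradient, this, map_zero]
  have hgP := (hP.contDiffOn_gradient hΩo).continuousOn
  have hPc : ContinuousOn P Ω := hP.contDiffOn.continuousOn
  have hTc : ContinuousOn (fun x => truncD δ (P x)) Ω :=
    (continuous_truncD δ).comp_continuousOn hPc
  have hgζ : ContinuousOn (gradient ζ) Ω := (ParabolicISS.contDiffOn_gradient (k := 0) hΩo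
    (by simpa using hζ.contDiffOn)).continuousOn
  have hφc : ContinuousOn φ (tsupport ζ) := h.contDiffOn.continuousOn.mono hsub
  -- the depth of the superlevel set
  set L := tsupport ζ ∩ (closure Ω ∩ {x | δ ≤ P x}) with hL
  have hLc : IsCompact L := hc.isCompact.inter (hP.isCompact_superlevel hΩ δ)
  -- Since `P` vanishes on the boundary, `L` is a compact subset of `Ω`, and `-φ` has a positive
  -- minimum on it. Once `2 d ≤ a`, the cutoff equals `ζ` on `{P ≥ δ}`.
  obtain ⟨a, ha, hLa⟩ : ∃ a > 0, ∀ x ∈ L, a ≤ -φ x := by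
    rcases L.eq_empty_or_nonempty with hem | hne
    · exact ⟨1, one_pos, by simp [hem]⟩
    · obtain ⟨x, hx, hmin⟩ := hLc.exists_isMinOn hne (hφc.neg.mono inter_subset_left)
      refine ⟨-φ x, ?_, fun y hy => hmin hy⟩
      have h1 : x ∈ Ω ∩ Metric.ball x₀ r :=
        ⟨hP.superlevel_subset hΩ hδ hx.2, hsub hx.1⟩
      rw [h.inter] at h1
      exact neg_pos.2 h1.2
  set d : ℕ → ℝ := fun k => 1 / ((k : ℝ) + 1) with hd
  have hd0 : ∀ k, 0 < d k := fun k => by simp only [hd]; positivity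
  have hdt : Tendsto d atTop (𝓝[>] 0) :=
    tendsto_nhdsWithin_iff.2 ⟨tendsto_one_div_add_atTop_nhds_zero_nat,
      Eventually.of_forall hd0⟩
  have hdsmall : ∀ᶠ k in atTop, 2 * d k ≤ a := by
    have : ∀ᶠ s in 𝓝[>] (0 : ℝ), s < a / 2 := nhdsWithin_le_nhds (gt_mem_nhds (by positivity))
    filter_upwards [hdt.eventually this] with k hk
    linarith
  set G : EuclideanSpace ℝ (Fin (m + 1)) → ℝ := fun x => ζ x * N x with hG
  have hGc : ContinuousOn G (closure Ω) := hζ.continuous.continuousOn.mul hNc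
  have hG0 : ∀ x ∈ closure Ω, 0 ≤ G x := fun x hx => mul_nonneg (hζ0 x) (hN0 x hx)
  -- the estimate with a fixed cutoff
  have hkey : ∀ k, 2 * d k ≤ a →
      ENNReal.ofReal ((∫ x in Ω, ζ x * layer P δ x) - (B * M + B) * layerError Ω P δ) ≤
        ∫⁻ x in K₀, ENNReal.ofReal (G x * IsBoundaryChart.mass φ (d k) x) := by
    intro k hk
    set θ : EuclideanSpace ℝ (Fin (m + 1)) → ℝ := fun x => ζ x * truncD (d k) (-φ x) with hθ
    have hθz : ∀ x, x ∉ tsupport ζ → θ =ᶠ[𝓝 x] fun _ => 0 := by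
      intro x hx
      filter_upwards [(isClosed_tsupport ζ).isOpen_compl.mem_nhds hx] with y hy
      simp only [hθ, hζz y hy, zero_mul]
    have hθd : ContDiff ℝ 1 θ := by
      rw [contDiff_iff_contDiffAt]
      intro x
      by_cases hx : x ∈ tsupport ζ
      · have h1 : ContDiffAt ℝ 1 φ x :=
          (h.contDiffOn.contDiffAt (Metric.isOpen_ball.mem_nhds (hsub hx))).of_le (by norm_num)
        have h2 : ContDiff ℝ 1 (truncD (d k)) := (contDiff_truncD _).of_le (by norm_num)
        exact hζ.contDiffAt.mul (h2.contDiffAt.comp x h1.neg)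
      · exact contDiffAt_const.congr_of_eventuallyEq (hθz x hx)
    set K := tsupport ζ ∩ {x | d k ≤ -φ x} with hK
    have hKc : IsCompact K := hc.isCompact.of_isClosed_subset
      (hφc.neg.preimage_isClosed_of_isClosed (isClosed_tsupport ζ) isClosed_Ici) inter_subset_left
    have hKΩ : K ⊆ Ω := by
      rintro x ⟨hx, hx'⟩
      have h1 : d k ≤ -φ x := hx'
      have h2 : x ∈ Ω ∩ Metric.ball x₀ r := by
        rw [h.inter]
        exact ⟨hsub hx, by linarith [hd0 k]⟩
      exact h2.1
    have hθK : ∀ x ∈ Ω, x ∉ K → θ x = 0 := by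
      intro x _ hxK
      by_cases hx : x ∈ tsupport ζ
      · have h1 : -φ x < d k := by
          by_contra! h1
          exact hxK ⟨hx, h1⟩
        simp only [hθ, truncD_eq_zero (hd0 k) h1.le, mul_zero]
      · simp only [hθ, hζz x hx, zero_mul]
    have hχ1 : ∀ x ∈ Ω, x ∈ tsupport ζ → δ ≤ P x → truncD (d k) (-φ x) = 1 := by
      intro x hx hxs hxP
      exact truncD_eq_one (hd0 k) (hk.trans (hLa x ⟨hxs, subset_closure hx, hxP⟩))
    have hθζ : ∀ x ∈ Ω, δ ≤ P x → θ x = ζ x := by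
      intro x hx hxP
      by_cases hxs : x ∈ tsupport ζ
      · simp only [hθ, hχ1 x hx hxs hxP, mul_one]
      · simp only [hθ, hζz x hxs, zero_mul]
    have h1 := hP.integral_layer_le hΩ hsup hδ (ζ := ζ) (θ := θ) hζ.contDiffOn hθd.contDiffOn
      (fun x _ => mul_nonneg (hζ0 x) (truncD_nonneg _ _)) hKc hKΩ hθK hθζ
    have hgθ : ContinuousOn (gradient θ) Ω := (ParabolicISS.contDiffOn_gradient (k := 0) hΩo
      (by simpa using hθd.contDiffOn)).continuousOn
    have hmc : ContinuousOn (fun x => G x * IsBoundaryChart.mass φ (d k) x) K₀ :=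
      (hGc.mono inter_subset_right).mul ((h.continuousOn_mass _).mono hK₀V)
    have hRint : IntegrableOn (fun x => G x * IsBoundaryChart.mass φ (d k) x) Ω := by
      refine (hmc.integrableOn_compact hK₀c).of_forall_sdiff_eq_zero hΩo.measurableSet ?_
      rintro x ⟨hx, hxK⟩
      have : x ∉ tsupport ζ := fun hxs => hxK ⟨hxs, subset_closure hx⟩
      simp only [hG, hζz x this, zero_mul]
    have hmass0 : ∀ x, 0 ≤ IsBoundaryChart.mass φ (d k) x := fun x =>
      mul_nonneg (norm_nonneg _) (deriv_truncD_nonneg (hd0 k) _)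
    have hR0 : ∀ x ∈ closure Ω, 0 ≤ G x * IsBoundaryChart.mass φ (d k) x := fun x hx =>
      mul_nonneg (hG0 x hx) (hmass0 x)
    have herr := (hP.integrableOn_layerError hΩ δ).const_mul (B * M + B)
    have hmono : ∫ x in Ω, ((θ x - truncD δ (P x) * ζ x) * (M * (P x + ‖gradient P x‖)) +
        (inner ℝ (gradient θ x) (gradient P x) -
          truncD δ (P x) * inner ℝ (gradient ζ x) (gradient P x))) ≤
        ∫ x in Ω, (G x * IsBoundaryChart.mass φ (d k) x +
          (B * M + B) * ((1 - truncD δ (P x)) * (P x + ‖gradient P x‖))) := by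
      have hKL : IsCompact (K ∪ (closure Ω ∩ {x | δ ≤ P x})) :=
        hKc.union (hP.isCompact_superlevel hΩ δ)
      refine setIntegral_mono_on ?_ (hRint.add herr) hΩo.measurableSet fun x hx => ?_
      · refine integrableOn_of_compact hΩo hKL
          (union_subset hKΩ (hP.superlevel_subset hΩ hδ)) ?_ fun x hx hxK => ?_
        · exact ((hθd.continuous.continuousOn.sub (hTc.mul hζ.continuous.continuousOn)).mul
            (continuousOn_const.mul (hPc.add hgP.norm))).add
            ((hgθ.inner hgP).sub (hTc.mul (hgζ.inner hgP)))
        · have e1 : truncD δ (P x) = 0 :=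
            truncD_eq_zero hδ (lt_of_notMem hx fun h => hxK (Or.inr h)).le
          have hxK' : x ∉ K := fun h => hxK (Or.inl h)
          have e2 : gradient θ x = 0 := by
            have : θ =ᶠ[𝓝 x] fun _ => 0 := by
              filter_upwards [hΩo.mem_nhds hx, hKc.isClosed.isOpen_compl.mem_nhds hxK']
                with y hy hyK
              exact hθK y hy hyK
            rw [this.gradient_eq, gradient_fun_const]
          simp [e1, e2, hθK x hx hxK']
      · have hT0 := truncD_nonneg δ (P x)
        have hT1 := truncD_le_one δ (P x)
        have hP0 := hP.nonneg x hx
        have hg0 := norm_nonneg (gradient P x)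
        by_cases hxs : x ∈ tsupport ζ
        · set χ := truncD (d k) (-φ x)
          set T := truncD δ (P x)
          have hχ1' : χ ≤ 1 := truncD_le_one _ _
          have hTχ : T ≤ χ := by
            rcases le_total δ (P x) with hPd | hPd
            · have : χ = 1 := hχ1 x hx hxs hPd
              rw [this]; exact hT1
            · have : T = 0 := truncD_eq_zero hδ hPd
              rw [this]; exact truncD_nonneg _ _
          have hgrad : HasGradientAt θ (ζ x • ((-deriv (truncD (d k)) (-φ x)) • gradient φ x) +
              χ • gradient ζ x) x := by
            have g1 : HasGradientAt φ (gradient φ x) x :=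
              (h.hasFDerivAt (hsub hxs)).differentiableAt.hasGradientAt
            have g2 : HasDerivAt (fun s => truncD (d k) (-s)) (-deriv (truncD (d k)) (-φ x))
                (φ x) := by
              have := (hasDerivAt_truncD (d k) (-φ x)).comp (φ x) (hasDerivAt_neg (φ x))
              rw [mul_neg_one] at this
              exact this
            exact hasGradientAt_mul ((hζ.differentiable (by norm_num)) x).hasGradientAt
              (hasGradientAt_comp (φ := fun s => truncD (d k) (-s)) (u := φ) g2 g1)
          rw [hgrad.gradient, inner_add_left, real_inner_smul_left, real_inner_smul_left,
            real_inner_smul_left]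
          have hin : |(inner ℝ (gradient ζ x) (gradient P x) : ℝ)| ≤ B * ‖gradient P x‖ :=
            (abs_real_inner_le_norm _ _).trans (mul_le_mul_of_nonneg_right (hB2 x) hg0)
          have hin' := (abs_le.1 hin).2
          have hin2 : -(inner ℝ (gradient φ x) (gradient P x) : ℝ) ≤
              ‖gradient φ x‖ * ‖gradient P x‖ := by
            have := abs_real_inner_le_norm (gradient φ x) (gradient P x)
            linarith [(abs_le.1 this).1]
          have hD := deriv_truncD_nonneg (hd0 k) (-φ x)
          -- The only contribution that survives as `d k → 0`; Cauchy–Schwarz suffices because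
          -- `|∇φ|` is part of the mass density.
          have h3 : ζ x * (-deriv (truncD (d k)) (-φ x) *
              inner ℝ (gradient φ x) (gradient P x)) ≤
              G x * IsBoundaryChart.mass φ (d k) x := by
            simp only [hG, IsBoundaryChart.mass, hN x hx]
            have := mul_le_mul_of_nonneg_left hin2 (mul_nonneg (hζ0 x) hD)
            linarith
          have hζB : ζ x ≤ B := (le_abs_self _).trans (hB1 x)
          -- As `0 ≤ χ - T ≤ 1 - T`, the remaining terms are bounded by the layer error with a
          -- constant independent of `d k` and `δ`.
          have h4 : (χ - T) * (ζ x * (M * (P x + ‖gradient P x‖)) +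
              inner ℝ (gradient ζ x) (gradient P x)) ≤
              (1 - T) * ((B * M + B) * (P x + ‖gradient P x‖)) := by
            have h5 : ζ x * (M * (P x + ‖gradient P x‖)) ≤ B * (M * (P x + ‖gradient P x‖)) := by
              gcongr
            have h6 : ζ x * (M * (P x + ‖gradient P x‖)) + inner ℝ (gradient ζ x) (gradient P x)
                ≤ (B * M + B) * (P x + ‖gradient P x‖) := by nlinarith
            have h7 : 0 ≤ (B * M + B) * (P x + ‖gradient P x‖) := by positivity
            exact (mul_le_mul_of_nonneg_left h6 (sub_nonneg.2 hTχ)).trans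
              (mul_le_mul_of_nonneg_right (by linarith) h7)
          have e3 : θ x = ζ x * χ := rfl
          rw [e3]
          linarith
        · have e2 : gradient θ x = 0 := by
            rw [(hθz x hxs).gradient_eq, gradient_fun_const]
          have e3 : θ x = 0 := (hθz x hxs).self_of_nhds
          rw [e2, e3, hζz x hxs, hgζz x hxs]
          simp only [inner_zero_left, mul_zero, sub_zero, zero_mul, add_zero]
          exact add_nonneg (hR0 x (subset_closure hx)) (by
            have := sub_nonneg.2 hT1
            positivity)
    rw [integral_add hRint herr, integral_const_mul] at hmono
    have h2 : (∫ x in Ω, ζ x * layer P δ x) - (B * M + B) * layerError Ω P δ ≤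
        ∫ x in Ω, G x * IsBoundaryChart.mass φ (d k) x := by
      have := h1.trans hmono
      unfold layerError layer
      linarith
    refine (ENNReal.ofReal_le_ofReal h2).trans ?_
    rw [ofReal_integral_eq_lintegral_ofReal hRint
      (by filter_upwards [ae_restrict_mem hΩo.measurableSet] with x hx
            using hR0 x (subset_closure hx))]
    rw [← lintegral_indicator hΩo.measurableSet, ← lintegral_indicator hK₀c.measurableSet]
    refine lintegral_mono fun x => ?_
    by_cases hx : x ∈ Ω
    · by_cases hxs : x ∈ tsupport ζ
      · rw [indicator_of_mem hx, indicator_of_mem (show x ∈ K₀ from ⟨hxs, subset_closure hx⟩)]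
      · rw [indicator_of_mem hx]
        simp [hG, hζz x hxs]
    · rw [indicator_of_notMem hx]; exact zero_le
  -- The left side of `hkey` does not depend on `k`, so it is bounded by the limsup of the chart
  -- masses.
  have hlim := h.limsup_lintegral_mul_mass_le hε hΩo hK₀c hK₀V inter_subset_right
    (hGc.mono inter_subset_right) (fun x hx => hG0 x hx.2) hd0 hdt
  have hfin : ENNReal.ofReal ((∫ x in Ω, ζ x * layer P δ x) - (B * M + B) * layerError Ω P δ) ≤
      ENNReal.ofReal ((1 + ε) * ∫ x, ζ x * N x ∂(surfaceMeasure Ω)) := by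
    refine (le_limsup_of_frequently_le (hdsmall.mono fun k hk => hkey k hk).frequently
      (by isBoundedDefault)).trans (hlim.trans ?_)
    rw [ENNReal.ofReal_mul (by positivity)]
    gcongr
    rw [ofReal_integral_eq_lintegral_ofReal (hΩ.integrable_surfaceMeasure hGc)
      (by filter_upwards [ae_mem_frontier Ω] with x hx using hG0 x (frontier_subset_closure hx))]
    exact setLIntegral_le_lintegral _ _
  have hnn : 0 ≤ (1 + ε) * ∫ x, ζ x * N x ∂(surfaceMeasure Ω) := by
    refine mul_nonneg (by positivity) (integral_nonneg_of_ae ?_)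
    filter_upwards [ae_mem_frontier Ω] with x hx using hG0 x (frontier_subset_closure hx)
  have := (ENNReal.ofReal_le_ofReal_iff hnn).1 hfin
  linarith

end IsWeight

end BoundaryLayer

end ParabolicISS

namespace ParabolicISS

/-! ### Gluing the local layer estimates -/

section BoundaryLayer

variable {m : ℕ} {Ω : Set (EuclideanSpace ℝ (Fin (m + 1)))}
  {P N : EuclideanSpace ℝ (Fin (m + 1)) → ℝ}

namespace IsWeight

theorem continuousOn_layer (hP : IsWeight Ω P) (hΩ : IsC2Domain Ω) (δ : ℝ) :
    ContinuousOn (layer P δ) Ω :=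
  ((continuous_deriv_truncD δ).comp_continuousOn hP.contDiffOn.continuousOn).mul
    ((hP.contDiffOn_gradient hΩ.isOpen).continuousOn.norm.pow 2)

theorem integrableOn_mul_layer (hP : IsWeight Ω P) (hΩ : IsC2Domain Ω) {δ : ℝ} (hδ : 0 < δ)
    {F : EuclideanSpace ℝ (Fin (m + 1)) → ℝ} (hF : ContinuousOn F Ω) :
    IntegrableOn (fun x => F x * layer P δ x) Ω := by
  refine integrableOn_of_compact hΩ.isOpen (hP.isCompact_superlevel hΩ δ)
    (hP.superlevel_subset hΩ hδ) (hF.mul (hP.continuousOn_layer hΩ δ)) fun x hx hxL => ?_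
  simp [layer, deriv_truncD_eq_zero hδ (lt_of_notMem hx hxL)]

theorem layer_nonneg {δ : ℝ} (hδ : 0 < δ) (x : EuclideanSpace ℝ (Fin (m + 1))) :
    0 ≤ layer P δ x :=
  mul_nonneg (deriv_truncD_nonneg hδ _) (by positivity)

/-- As `δ → 0`, the layer measures `truncD' (P) |∇P|² dx` are asymptotically dominated by
`|∇P| dS` on the boundary. -/
theorem eventually_integral_layer_le (hP : IsWeight Ω P) (hΩ : IsC2Domain Ω) {M : ℝ} (hM : 0 ≤ M)
    (hsup : ∀ x ∈ Ω, divg (gradient P) x ≤ M * (P x + ‖gradient P x‖))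
    (hNc : ContinuousOn N (closure Ω)) (hN : ∀ x ∈ Ω, N x = ‖gradient P x‖)
    (hN0 : ∀ x ∈ closure Ω, 0 ≤ N x)
    {F : EuclideanSpace ℝ (Fin (m + 1)) → ℝ} (hF : ContinuousOn F (closure Ω))
    (hF0 : ∀ x ∈ closure Ω, 0 ≤ F x) {η : ℝ} (hη : 0 < η) :
    ∀ᶠ δ in 𝓝[>] (0 : ℝ), ∫ x in Ω, F x * layer P δ x ≤
      ∫ x, F x * N x ∂(surfaceMeasure Ω) + η := by
  have hΩo := hΩ.isOpen
  set J := ∫ x, F x * N x ∂(surfaceMeasure Ω) with hJ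
  set S₀ := ∫ x, N x ∂(surfaceMeasure Ω) with hS₀
  have hJ0 : 0 ≤ J := integral_nonneg_of_ae (by
    filter_upwards [ae_mem_frontier Ω] with x hx
    exact mul_nonneg (hF0 x (frontier_subset_closure hx)) (hN0 x (frontier_subset_closure hx)))
  have hS0 : 0 ≤ S₀ := integral_nonneg_of_ae (by
    filter_upwards [ae_mem_frontier Ω] with x hx using hN0 x (frontier_subset_closure hx))
  -- The number `τ` serves both as chart distortion and as oscillation of `F` on the pieces. The
  -- final bound is `(1 + τ)(J + 2 τ S₀) ≤ J + τ (J + 4 S₀)`, using `τ ≤ 1`; the other `η / 2` is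
  -- kept for the layer error.
  obtain ⟨τ, hτ, hτ1, hτη⟩ : ∃ τ : ℝ, 0 < τ ∧ τ ≤ 1 ∧ τ * (J + 4 * S₀) ≤ η / 2 := by
    refine ⟨min 1 (η / (2 * (J + 4 * S₀ + 1))), lt_min one_pos (by positivity),
      min_le_left _ _, ?_⟩
    calc min 1 (η / (2 * (J + 4 * S₀ + 1))) * (J + 4 * S₀)
        ≤ η / (2 * (J + 4 * S₀ + 1)) * (J + 4 * S₀ + 1) :=
          mul_le_mul (min_le_right _ _) (by linarith) (by positivity) (by positivity)
      _ = η / 2 := by field_simp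
  -- local pieces
  have hloc : ∀ x ∈ closure Ω, ∃ r, 0 < r ∧ (∀ y ∈ Metric.ball x r, y ∈ closure Ω →
      |F y - F x| < τ) ∧ ∀ ζ : EuclideanSpace ℝ (Fin (m + 1)) → ℝ, ContDiff ℝ 1 ζ →
        (∀ y, 0 ≤ ζ y) → tsupport ζ ⊆ Metric.ball x r →
        ∃ C, 0 ≤ C ∧ ∀ δ, 0 < δ → ∫ y in Ω, ζ y * layer P δ y ≤
          (1 + τ) * ∫ y, ζ y * N y ∂(surfaceMeasure Ω) + C * layerError Ω P δ := by
    intro x hx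
    have hnear : {y | y ∈ closure Ω → |F y - F x| < τ} ∈ 𝓝 x := by
      have h1 : Tendsto (fun y => |F y - F x|) (𝓝[closure Ω] x) (𝓝 0) := by
        have := ((hF x hx).sub (continuousWithinAt_const (b := F x))).abs.tendsto
        simpa using this
      have h2 := h1.eventually (gt_mem_nhds hτ)
      rw [eventually_nhdsWithin_iff] at h2
      exact h2
    have hcs : ∀ {r : ℝ} {ζ : EuclideanSpace ℝ (Fin (m + 1)) → ℝ},
        tsupport ζ ⊆ Metric.ball x r → HasCompactSupport ζ := fun {r} {ζ} h =>
      (isCompact_closedBall x r).of_isClosed_subset (isClosed_tsupport ζ)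
        (h.trans Metric.ball_subset_closedBall)
    by_cases hxΩ : x ∈ Ω
    · obtain ⟨r, hr, hball⟩ := Metric.mem_nhds_iff.1 (inter_mem hnear (hΩo.mem_nhds hxΩ))
      refine ⟨r, hr, fun y hy => (hball hy).1, fun ζ hζ hζ0 hsub => ?_⟩
      obtain ⟨C, hC0, hC⟩ := hP.layer_le_interior hΩ hM hsup hζ hζ0 (hcs hsub)
        (hsub.trans fun y hy => (hball hy).2)
      refine ⟨C, hC0, fun δ hδ => (hC δ hδ).trans (le_add_of_nonneg_left ?_)⟩
      refine mul_nonneg (by positivity) (integral_nonneg_of_ae ?_)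
      filter_upwards [ae_mem_frontier Ω] with y hy
      exact mul_nonneg (hζ0 y) (hN0 y (frontier_subset_closure hy))
    · obtain ⟨r, φ, e, hsubW, h⟩ := hΩ.exists_chart (hΩ.mem_frontier_of hx hxΩ) hτ hτ1 hnear
      refine ⟨r, h.pos, fun y hy => hsubW hy, fun ζ hζ hζ0 hsub => ?_⟩
      exact hP.layer_le_chart hΩ hM hsup hNc hN hN0 h hτ hζ hζ0 (hcs hsub) hsub
  choose! r hr hosc hpiece using hloc
  obtain ⟨t, ht, htcov⟩ := hΩ.isCompact_closure.elim_nhds_subcover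
    (fun x => Metric.ball x (r x)) (fun x hx => Metric.ball_mem_nhds x (hr x hx))
  -- The localised estimates need `C¹` cutoffs, hence a smooth partition of unity on the compact
  -- closure.
  obtain ⟨f, hf⟩ := SmoothPartitionOfUnity.exists_isSubordinate
    (modelWithCornersSelf ℝ (EuclideanSpace ℝ (Fin (m + 1)))) (isClosed_closure (s := Ω))
    (fun i : t => Metric.ball i.1 (r i.1)) (fun i => Metric.isOpen_ball) (by
      intro y hy
      obtain ⟨x, hx, hxy⟩ := mem_iUnion₂.1 (htcov hy)
      exact mem_iUnion.2 ⟨⟨x, hx⟩, hxy⟩)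
  have hfd : ∀ i, ContDiff ℝ 1 (f i) := fun i =>
    ((f i).contMDiff.contDiff).of_le (by exact_mod_cast le_top)
  have hf0 : ∀ i y, 0 ≤ f i y := fun i y => f.nonneg i y
  have hfsum : ∀ y ∈ closure Ω, ∑ i, f i y = 1 := fun y hy => by
    rw [← finsum_eq_sum_of_fintype]; exact f.sum_eq_one hy
  have hfc : ∀ i, Continuous (f i) := fun i => (hfd i).continuous
  have hC : ∀ i : t, ∃ C, 0 ≤ C ∧ ∀ δ, 0 < δ → ∫ y in Ω, f i y * layer P δ y ≤
      (1 + τ) * ∫ y, f i y * N y ∂(surfaceMeasure Ω) + C * layerError Ω P δ := fun i =>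
    hpiece i.1 (ht i.1 i.2) (f i) (hfd i) (hf0 i) (hf i)
  choose C hC0 hCle using hC
  have hz : ∀ i : t, ∀ y, y ∉ Metric.ball i.1 (r i.1) → f i y = 0 := fun i y hy =>
    image_eq_zero_of_notMem_tsupport fun h => hy (hf i h)
  have hFΩ := hF.mono (subset_closure (s := Ω))
  have herr : ∀ᶠ δ in 𝓝[>] (0 : ℝ), (∑ i, (F i.1 + τ) * C i) * layerError Ω P δ < η / 2 := by
    have := (hP.tendsto_integral_one_sub hΩ).const_mul (∑ i : t, (F i.1 + τ) * C i)
    rw [mul_zero] at this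
    exact this.eventually (gt_mem_nhds (by positivity))
  filter_upwards [herr, self_mem_nhdsWithin] with δ hδerr hδ
  have hδ' : 0 < δ := hδ
  -- splitting the integral
  have hsplit : ∫ x in Ω, F x * layer P δ x = ∑ i, ∫ x in Ω, F x * f i x * layer P δ x := by
    rw [← integral_finsetSum]
    · refine setIntegral_congr_fun hΩo.measurableSet fun x hx => ?_
      rw [← Finset.sum_mul, ← Finset.mul_sum, hfsum x (subset_closure hx), mul_one]
    · intro i _
      exact hP.integrableOn_mul_layer hΩ hδ' (hFΩ.mul (hfc i).continuousOn)
  have hpc : ∀ i : t, ∫ x in Ω, F x * f i x * layer P δ x ≤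
      (1 + τ) * ∫ y, (F y + 2 * τ) * (f i y * N y) ∂(surfaceMeasure Ω) +
        (F i.1 + τ) * C i * layerError Ω P δ := by
    intro i
    have hFi : 0 ≤ F i.1 + τ := add_nonneg (hF0 _ (ht i.1 i.2)) hτ.le
    -- `F` is frozen at the centre of the ball, at cost `τ`, to apply the local estimate, and
    -- unfrozen on the boundary in `h3` at cost `τ` again; this is the source of `F y + 2 * τ`.
    have h1 : ∫ x in Ω, F x * f i x * layer P δ x ≤
        ∫ x in Ω, (F i.1 + τ) * (f i x * layer P δ x) := by
      refine setIntegral_mono_on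
        (hP.integrableOn_mul_layer hΩ hδ' (hFΩ.mul (hfc i).continuousOn))
        ((hP.integrableOn_mul_layer hΩ hδ' (hfc i).continuousOn).const_mul _)
        hΩo.measurableSet fun x hx => ?_
      rw [mul_assoc]
      by_cases hxb : x ∈ Metric.ball i.1 (r i.1)
      · have := (abs_lt.1 (hosc i.1 (ht i.1 i.2) x hxb (subset_closure hx))).2
        refine mul_le_mul_of_nonneg_right (by linarith)
          (mul_nonneg (hf0 i x) (layer_nonneg hδ' x))
      · simp [hz i x hxb]
    rw [integral_const_mul] at h1
    have h2 := mul_le_mul_of_nonneg_left (hCle i δ hδ') hFi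
    have h3 : (F i.1 + τ) * ∫ y, f i y * N y ∂(surfaceMeasure Ω) ≤
        ∫ y, (F y + 2 * τ) * (f i y * N y) ∂(surfaceMeasure Ω) := by
      rw [← integral_const_mul]
      have hfN : ContinuousOn (fun y => f i y * N y) (closure Ω) := (hfc i).continuousOn.mul hNc
      refine integral_mono_ae ((hΩ.integrable_surfaceMeasure hfN).const_mul _)
        (hΩ.integrable_surfaceMeasure ((hF.add continuousOn_const).mul hfN)) ?_
      filter_upwards [ae_mem_frontier Ω] with y hy
      have hyc := frontier_subset_closure hy
      by_cases hyb : y ∈ Metric.ball i.1 (r i.1)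
      · have := (abs_lt.1 (hosc i.1 (ht i.1 i.2) y hyb hyc)).1
        refine mul_le_mul_of_nonneg_right (by linarith) (mul_nonneg (hf0 i y) (hN0 y hyc))
      · simp [hz i y hyb]
    have h4 : 0 ≤ 1 + τ := by positivity
    have h5 := mul_le_mul_of_nonneg_left h3 h4
    linarith
  have hsumσ : ∑ i, ∫ y, (F y + 2 * τ) * (f i y * N y) ∂(surfaceMeasure Ω) = J + 2 * τ * S₀ := by
    rw [← integral_finsetSum]
    · have : ∫ y, ∑ i, (F y + 2 * τ) * (f i y * N y) ∂(surfaceMeasure Ω) =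
          ∫ y, (F y * N y + 2 * τ * N y) ∂(surfaceMeasure Ω) := by
        refine integral_congr_ae ?_
        filter_upwards [ae_mem_frontier Ω] with y hy
        rw [← Finset.mul_sum, ← Finset.sum_mul, hfsum y (frontier_subset_closure hy)]
        ring
      have hFN : Integrable (fun y => F y * N y) (surfaceMeasure Ω) :=
        hΩ.integrable_surfaceMeasure (hF.mul hNc)
      rw [this, integral_add hFN ((hΩ.integrable_surfaceMeasure hNc).const_mul _),
        integral_const_mul]
    · intro i _
      exact hΩ.integrable_surfaceMeasure ((hF.add continuousOn_const).mul
        ((hfc i).continuousOn.mul hNc))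
  rw [hsplit]
  refine (Finset.sum_le_sum fun i _ => hpc i).trans ?_
  rw [Finset.sum_add_distrib, ← Finset.mul_sum, hsumσ, ← Finset.sum_mul]
  nlinarith [mul_nonneg hτ.le hS0, mul_nonneg (mul_nonneg hτ.le hτ.le) hS0,
    mul_nonneg (mul_nonneg hτ.le hS0) (sub_nonneg.2 hτ1)]

end IsWeight

end BoundaryLayer

end ParabolicISS

namespace ParabolicISS

/-! ### A regularised absolute value -/

section AbsReg

/-- The regularisation `√(s² + ε²)` of `|s|`. -/
noncomputable def absReg (ε s : ℝ) : ℝ := √(s ^ 2 + ε ^ 2)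

variable {ε : ℝ}

theorem absReg_sq (ε s : ℝ) : absReg ε s ^ 2 = s ^ 2 + ε ^ 2 := Real.sq_sqrt (by positivity)

theorem absReg_nonneg (ε s : ℝ) : 0 ≤ absReg ε s := Real.sqrt_nonneg _

theorem absReg_pos (hε : 0 < ε) (s : ℝ) : 0 < absReg ε s := Real.sqrt_pos.2 (by positivity)

theorem abs_le_absReg (ε s : ℝ) : |s| ≤ absReg ε s := Real.abs_le_sqrt (by nlinarith [sq_nonneg ε])

theorem le_absReg (ε s : ℝ) : ε ≤ absReg ε s :=
  Real.le_sqrt_of_sq_le (by nlinarith [sq_nonneg s])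

theorem absReg_le (hε : 0 < ε) (s : ℝ) : absReg ε s ≤ |s| + ε := by
  refine Real.sqrt_le_iff.2 ⟨by positivity, ?_⟩
  nlinarith [sq_abs s, mul_nonneg (abs_nonneg s) hε.le]

theorem contDiff_absReg (hε : 0 < ε) : ContDiff ℝ 2 (absReg ε) :=
  ContDiff.sqrt (by fun_prop) fun s => by positivity

theorem hasDerivAt_absReg (hε : 0 < ε) (s : ℝ) :
    HasDerivAt (absReg ε) (s / absReg ε s) s := by
  have h1 : HasDerivAt (fun s : ℝ => s ^ 2 + ε ^ 2) (2 * s) s := by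
    simpa using (hasDerivAt_pow 2 s).add_const (ε ^ 2)
  have h2 := h1.sqrt (by positivity)
  rw [mul_div_mul_left _ _ two_ne_zero] at h2
  exact h2

theorem hasDerivAt_absReg_deriv (hε : 0 < ε) (s : ℝ) :
    HasDerivAt (fun s => s / absReg ε s) (ε ^ 2 / absReg ε s ^ 3) s := by
  have hp := absReg_pos hε s
  have h : HasDerivAt (fun s => s / absReg ε s)
      ((1 * absReg ε s - s * (s / absReg ε s)) / absReg ε s ^ 2) s :=
    (hasDerivAt_id s).div (hasDerivAt_absReg hε s) hp.ne'
  refine h.congr_deriv ?_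
  have := absReg_sq ε s
  field_simp
  linarith

theorem contDiff_absReg_deriv (hε : 0 < ε) : ContDiff ℝ 2 (fun s => s / absReg ε s) :=
  contDiff_id.div (contDiff_absReg hε) fun s => (absReg_pos hε s).ne'

theorem abs_div_absReg_le (hε : 0 < ε) (s : ℝ) : |s / absReg ε s| ≤ 1 := by
  rw [abs_div, abs_of_pos (absReg_pos hε s)]
  exact (div_le_one (absReg_pos hε s)).2 (abs_le_absReg ε s)

theorem sq_div_absReg (hε : 0 < ε) (s : ℝ) :
    s ^ 2 / absReg ε s = absReg ε s - ε ^ 2 / absReg ε s := by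
  have hp := absReg_pos hε s
  have := absReg_sq ε s
  field_simp
  linarith

theorem eps_sq_div_absReg_le (hε : 0 < ε) (s : ℝ) : ε ^ 2 / absReg ε s ≤ ε := by
  rw [div_le_iff₀ (absReg_pos hε s)]
  nlinarith [le_absReg ε s]

/-- The second derivative of `absReg` is negligible against squares of functions of linear
growth at `0`. -/
theorem absReg_deriv2_mul_sq_le (hε : 0 < ε) (hε1 : ε ≤ 1) {s G g₀ s₀ B : ℝ} (hs₀ : 0 < s₀)
    (h1 : |s| ≤ s₀ → |G| ≤ |g₀| * |s|) (h2 : |G| ≤ B) :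
    ε ^ 2 / absReg ε s ^ 3 * G ^ 2 ≤ (g₀ ^ 2 + B ^ 2 / s₀ ^ 3) * ε := by
  have hp := absReg_pos hε s
  -- For small `s` the linear bound gives `G² ≤ g₀² ρ²` with `ρ = absReg ε s`, which leaves `ε²/ρ ≤
  -- ε`; for `|s| ≥ s₀` one has `ρ ≥ s₀`, and the factor is `O(ε²)`.
  rcases le_total |s| s₀ with h | h
  · have h3 : G ^ 2 ≤ g₀ ^ 2 * absReg ε s ^ 2 := by
      have := pow_le_pow_left₀ (abs_nonneg G) (h1 h) 2
      rw [mul_pow, sq_abs, sq_abs, sq_abs] at this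
      refine this.trans ?_
      rw [absReg_sq]
      nlinarith [sq_nonneg ε, sq_nonneg g₀, mul_nonneg (sq_nonneg g₀) (sq_nonneg ε)]
    calc ε ^ 2 / absReg ε s ^ 3 * G ^ 2 ≤ ε ^ 2 / absReg ε s ^ 3 * (g₀ ^ 2 * absReg ε s ^ 2) := by
          gcongr
      _ = g₀ ^ 2 * (ε ^ 2 / absReg ε s) := by field_simp
      _ ≤ g₀ ^ 2 * ε := by gcongr; exact eps_sq_div_absReg_le hε s
      _ ≤ _ := by
          have : 0 ≤ B ^ 2 / s₀ ^ 3 * ε := by positivity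
          linarith
  · have h3 : G ^ 2 ≤ B ^ 2 := by
      rw [← sq_abs]; exact pow_le_pow_left₀ (abs_nonneg G) h2 2
    have h4 : s₀ ≤ absReg ε s := h.trans (abs_le_absReg ε s)
    calc ε ^ 2 / absReg ε s ^ 3 * G ^ 2 ≤ ε ^ 2 / s₀ ^ 3 * B ^ 2 := by gcongr
      _ = B ^ 2 / s₀ ^ 3 * (ε * ε) := by ring
      _ ≤ B ^ 2 / s₀ ^ 3 * (ε * 1) := by gcongr
      _ ≤ _ := by
          have : 0 ≤ g₀ ^ 2 * ε := by positivity
          linarith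

end AbsReg

/-! ### The energy identity -/

section Energy

variable {n : ℕ}

/-- The field collects all the fluxes to be integrated by parts, with `Φ` the truncation of the
weight and `ρ` the regularised modulus. The first line of the right-hand side is the part of the
equation containing `div (a ∇W)`, `b·∇W` and `m·∇G`, multiplied by `Φ ρ₁`; the remaining terms are
what multiplying by `Φ ρ₁` costs. -/
theorem divg_energy_field {a P W G : EuclideanSpace ℝ (Fin n) → ℝ}
    {b m : EuclideanSpace ℝ (Fin n) → EuclideanSpace ℝ (Fin n)} {x : EuclideanSpace ℝ (Fin n)}
    {Φ Φ₁ ρ ρ₁ : ℝ → ℝ} {Φ₂ ρ₂ : ℝ}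
    (ha : DifferentiableAt ℝ a x) (hP : DifferentiableAt ℝ P x) (hW : DifferentiableAt ℝ W x)
    (hG : DifferentiableAt ℝ G x) (hb : DifferentiableAt ℝ b x) (hm : DifferentiableAt ℝ m x)
    (hgP : DifferentiableAt ℝ (gradient P) x) (hgW : DifferentiableAt ℝ (gradient W) x)
    (hΦ : HasDerivAt Φ (Φ₁ (P x)) (P x)) (hΦ₁ : HasDerivAt Φ₁ Φ₂ (P x))
    (hρ : HasDerivAt ρ (ρ₁ (W x)) (W x)) (hρ₁ : HasDerivAt ρ₁ ρ₂ (W x)) :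
    divg (fun y => (Φ (P y) * ρ₁ (W y)) • (a y • gradient W y)
        - (ρ (W y) * Φ₁ (P y)) • (a y • gradient P y)
        - (Φ (P y) * ρ (W y)) • b y - (ρ₁ (W y) * G y * Φ (P y)) • m y) x =
      Φ (P x) * ρ₁ (W x) * (divg (fun y => a y • gradient W y) x - inner ℝ (b x) (gradient W x)
          - inner ℝ (m x) (gradient G x))
        + a x * Φ (P x) * ρ₂ * ‖gradient W x‖ ^ 2
        - ρ (W x) * Φ₁ (P x) * (divg (fun y => a y • gradient P y) x
          + inner ℝ (b x) (gradient P x))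
        - a x * ρ (W x) * Φ₂ * ‖gradient P x‖ ^ 2
        - Φ (P x) * ρ (W x) * divg b x
        - ρ₁ (W x) * G x * (Φ (P x) * divg m x + Φ₁ (P x) * inner ℝ (gradient P x) (m x))
        - ρ₂ * G x * Φ (P x) * inner ℝ (gradient W x) (m x) := by
  have gΦ := hasGradientAt_comp hΦ hP.hasGradientAt
  have gΦ₁ := hasGradientAt_comp hΦ₁ hP.hasGradientAt
  have gρ := hasGradientAt_comp hρ hW.hasGradientAt
  have gρ₁ := hasGradientAt_comp hρ₁ hW.hasGradientAt
  have g1 := hasGradientAt_mul gΦ gρ₁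
  have g2 := hasGradientAt_mul gρ gΦ₁
  have g3 := hasGradientAt_mul gΦ gρ
  have g4 := hasGradientAt_mul (hasGradientAt_mul gρ₁ hG.hasGradientAt) gΦ
  have haW := ha.fun_smul hgW
  have haP := ha.fun_smul hgP
  have d1 := g1.differentiableAt.fun_smul haW
  have d2 := g2.differentiableAt.fun_smul haP
  have d3 := g3.differentiableAt.fun_smul hb
  have d4 := g4.differentiableAt.fun_smul hm
  rw [divg_sub ((d1.fun_sub d2).fun_sub d3) d4, divg_sub (d1.fun_sub d2) d3, divg_sub d1 d2,
    divg_smul g1.differentiableAt haW, divg_smul g2.differentiableAt haP,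
    divg_smul g3.differentiableAt hb, divg_smul g4.differentiableAt hm,
    g1.gradient, g2.gradient, g3.gradient, g4.gradient]
  simp only [inner_add_left, real_inner_smul_left, real_inner_smul_right,
    real_inner_self_eq_norm_sq, smul_add, smul_smul]
  rw [real_inner_comm (gradient W x) (b x), real_inner_comm (gradient G x) (m x),
    real_inner_comm (gradient P x) (b x), real_inner_comm (gradient W x) (gradient P x)]
  ring

/-- The pointwise estimate behind the energy inequality, in terms of the values at a point. -/
theorem energy_pointwise {lam p Φ Φ₁ Φ₂ ε δ W a alo c μ f h G divb divm dP mP gP gW mW nm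
    κB Wb cB GB mB Cρ : ℝ}
    (hδ : 0 < δ) (hε : 0 < ε) (hε1 : ε ≤ 1) (hlam : 0 ≤ lam)
    (hΦ0 : 0 ≤ Φ) (hΦp : Φ ≤ p) (hΦ₁0 : 0 ≤ Φ₁) (hΦ₂ : 0 ≤ Φ₂)
    (hΦd : |p * Φ₁ - Φ| ≤ 2 * δ)
    (halo : 0 < alo) (ha : alo ≤ a)
    (hsuper : dP + p * (divb - c + μ) ≤ -(lam * p))
    (hsign : -h * W ≤ μ * W ^ 2)
    (hg : G * W * (p * divm + mP) ≤ 0)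
    (hmW : |mW| ≤ nm * gW)
    (hκ : |divb - c + μ| ≤ κB) (hW : |W| ≤ Wb) (hc : |c - μ| ≤ cB) (hdivm : |divm| ≤ mB)
    (hG : |G| ≤ GB) (hρ : ε ^ 2 / absReg ε W ^ 3 * G ^ 2 ≤ Cρ * ε) :
    Φ * (W / absReg ε W) * (-(c * W) - h + f)
        - a * Φ * (ε ^ 2 / absReg ε W ^ 3) * gW ^ 2
        + absReg ε W * Φ₁ * dP + a * absReg ε W * Φ₂ * gP ^ 2
        + Φ * absReg ε W * divb
        + W / absReg ε W * G * (Φ * divm + Φ₁ * mP)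
        + ε ^ 2 / absReg ε W ^ 3 * G * Φ * mW ≤
      -(lam * (Φ * absReg ε W)) + a * |W| * (Φ₂ * gP ^ 2) + ε * (a * (Φ₂ * gP ^ 2)) + p * |f|
        + (2 * (Wb + 1) * (lam + κB) + 2 * GB * mB) * δ
        + (p * cB + p * (Cρ * nm ^ 2 / (4 * alo))) * ε := by
  set R := absReg ε W with hR
  have hR0 : 0 < R := absReg_pos hε W
  have hRle : R ≤ |W| + ε := absReg_le hε W
  set ρ₂ := ε ^ 2 / R ^ 3 with hρ₂
  have hρ₂0 : 0 ≤ ρ₂ := by positivity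
  have hWb0 : 0 ≤ Wb := (abs_nonneg _).trans hW
  have hcB0 : 0 ≤ cB := (abs_nonneg _).trans hc
  have hκB0 : 0 ≤ κB := (abs_nonneg _).trans hκ
  have hGB0 : 0 ≤ GB := (abs_nonneg _).trans hG
  have hmB0 : 0 ≤ mB := (abs_nonneg _).trans hdivm
  have ha0 : 0 < a := halo.trans_le ha
  -- elliptic part of the weight
  have t1 : R * Φ₁ * dP ≤ -(lam * (Φ * R)) - R * Φ * (divb - c + μ)
      + 2 * (Wb + 1) * (lam + κB) * δ := by
    have e1 : R * Φ₁ * dP ≤ R * Φ₁ * (-(lam * p) - p * (divb - c + μ)) :=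
      mul_le_mul_of_nonneg_left (by linarith) (by positivity)
    -- The weight inequality yields the factor `p Φ₁`, but the decay term and the zeroth order terms
    -- need `Φ`; the exchange costs `O(δ)`.
    have e2 : -((p * Φ₁ - Φ) * (lam + (divb - c + μ))) ≤ 2 * δ * (lam + κB) := by
      have h1 : |lam + (divb - c + μ)| ≤ lam + κB := by
        refine (abs_add_le _ _).trans ?_
        rw [abs_of_nonneg hlam]; linarith
      calc -((p * Φ₁ - Φ) * (lam + (divb - c + μ))) ≤ |(p * Φ₁ - Φ) * (lam + (divb - c + μ))| :=
            neg_le_abs _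
        _ = |p * Φ₁ - Φ| * |lam + (divb - c + μ)| := abs_mul _ _
        _ ≤ 2 * δ * (lam + κB) := mul_le_mul hΦd h1 (abs_nonneg _) (by positivity)
    have e3 : R * (-((p * Φ₁ - Φ) * (lam + (divb - c + μ)))) ≤ (Wb + 1) * (2 * δ * (lam + κB)) := by
      refine (mul_le_mul_of_nonneg_left e2 hR0.le).trans ?_
      exact mul_le_mul_of_nonneg_right (by linarith) (by positivity)
    linarith
  -- zeroth order terms
  have t2 : Φ * (W / R) * (-(c * W) - h) + Φ * R * divb ≤
      R * Φ * (divb - c + μ) + p * cB * ε := by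
    have e1 : Φ * (W / R) * (-h) ≤ Φ * (μ * (W ^ 2 / R)) := by
      have : Φ * (W / R) * (-h) = Φ / R * (-h * W) := by ring
      rw [this]
      have h2 : Φ * (μ * (W ^ 2 / R)) = Φ / R * (μ * W ^ 2) := by ring
      rw [h2]
      exact mul_le_mul_of_nonneg_left hsign (by positivity)
    have e2 : Φ * (W / R) * (-(c * W)) = -(Φ * (c * (W ^ 2 / R))) := by ring
    have e3 : W ^ 2 / R = R - ε ^ 2 / R := sq_div_absReg hε W
    have e4 : Φ * ((c - μ) * (ε ^ 2 / R)) ≤ p * (cB * ε) := by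
      have h1 : (c - μ) * (ε ^ 2 / R) ≤ cB * ε :=
        mul_le_mul ((le_abs_self _).trans hc) (eps_sq_div_absReg_le hε W) (by positivity) hcB0
      exact (mul_le_mul_of_nonneg_left h1 hΦ0).trans
        (mul_le_mul_of_nonneg_right hΦp (by positivity))
    rw [e3] at e1 e2
    linarith
  have hs1 : |W / R| ≤ 1 := abs_div_absReg_le hε W
  have t3 : Φ * (W / R) * f ≤ p * |f| := by
    have h1 : W / R * f ≤ |f| := by
      refine (le_abs_self _).trans ?_
      rw [abs_mul]
      exact mul_le_of_le_one_left (abs_nonneg _) hs1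
    calc Φ * (W / R) * f = Φ * (W / R * f) := by ring
      _ ≤ Φ * |f| := mul_le_mul_of_nonneg_left h1 hΦ0
      _ ≤ p * |f| := mul_le_mul_of_nonneg_right hΦp (abs_nonneg _)
  have t4 : a * R * Φ₂ * gP ^ 2 ≤ a * |W| * (Φ₂ * gP ^ 2) + ε * (a * (Φ₂ * gP ^ 2)) := by
    have := mul_le_mul_of_nonneg_left hRle (show 0 ≤ a * (Φ₂ * gP ^ 2) by positivity)
    linarith
  -- the flux `g`
  have t5 : W / R * G * (Φ * divm + Φ₁ * mP) ≤ 2 * GB * mB * δ := by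
    have e1 : Φ₁ / R * (G * W * (p * divm + mP)) ≤ 0 :=
      mul_nonpos_of_nonneg_of_nonpos (by positivity) hg
    have e2 : -(W / R * G * divm * (p * Φ₁ - Φ)) ≤ GB * mB * (2 * δ) := by
      calc -(W / R * G * divm * (p * Φ₁ - Φ)) ≤ |W / R * G * divm * (p * Φ₁ - Φ)| := neg_le_abs _
        _ = |W / R| * |G| * |divm| * |p * Φ₁ - Φ| := by rw [abs_mul, abs_mul, abs_mul]
        _ ≤ 1 * GB * mB * (2 * δ) := by gcongr
        _ = GB * mB * (2 * δ) := by ring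
    -- Again `Φ` is replaced by `p Φ₁`, so that `div (p m)` appears and the sign condition on the
    -- flux can be used.
    have e3 : W / R * G * (Φ * divm + Φ₁ * mP) =
        Φ₁ / R * (G * W * (p * divm + mP)) + -(W / R * G * divm * (p * Φ₁ - Φ)) := by ring
    rw [e3]; linarith
  -- Young's inequality: the gradient produced by differentiating `ρ₁(W)` in the flux term is
  -- absorbed by the diffusion, which carries the same factor `ρ₂`. What remains is `ρ₂ G²`, of
  -- order `ε`.
  have t6 : ρ₂ * G * Φ * mW - a * Φ * ρ₂ * gW ^ 2 ≤ p * (Cρ * nm ^ 2 / (4 * alo)) * ε := by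
    have e1 : G * mW ≤ |G| * nm * gW := by
      calc G * mW ≤ |G * mW| := le_abs_self _
        _ = |G| * |mW| := abs_mul _ _
        _ ≤ |G| * (nm * gW) := by gcongr
        _ = |G| * nm * gW := by ring
    have e2 : |G| * nm * gW - alo * gW ^ 2 ≤ G ^ 2 * nm ^ 2 / (4 * alo) := by
      rw [le_div_iff₀ (by positivity), ← sq_abs G]
      nlinarith [sq_nonneg (|G| * nm - 2 * alo * gW)]
    have e3 : alo * gW ^ 2 ≤ a * gW ^ 2 := by gcongr
    have e4 : G * mW - a * gW ^ 2 ≤ G ^ 2 * nm ^ 2 / (4 * alo) := by linarith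
    have e5 : Φ * ρ₂ * (G * mW - a * gW ^ 2) ≤ Φ * ρ₂ * (G ^ 2 * nm ^ 2 / (4 * alo)) :=
      mul_le_mul_of_nonneg_left e4 (by positivity)
    have e6 : Φ * ρ₂ * (G ^ 2 * nm ^ 2 / (4 * alo)) = Φ * (nm ^ 2 / (4 * alo) * (ρ₂ * G ^ 2)) := by
      ring
    have e7 : nm ^ 2 / (4 * alo) * (ρ₂ * G ^ 2) ≤ nm ^ 2 / (4 * alo) * (Cρ * ε) :=
      mul_le_mul_of_nonneg_left hρ (by positivity)
    have e8 : 0 ≤ nm ^ 2 / (4 * alo) * (Cρ * ε) := le_trans (by positivity) e7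
    have e9 : Φ * (nm ^ 2 / (4 * alo) * (ρ₂ * G ^ 2)) ≤ p * (nm ^ 2 / (4 * alo) * (Cρ * ε)) :=
      (mul_le_mul_of_nonneg_left e7 hΦ0).trans (mul_le_mul_of_nonneg_right hΦp e8)
    calc ρ₂ * G * Φ * mW - a * Φ * ρ₂ * gW ^ 2 = Φ * ρ₂ * (G * mW - a * gW ^ 2) := by ring
      _ ≤ p * (nm ^ 2 / (4 * alo) * (Cρ * ε)) := e5.trans (e6 ▸ e9)
      _ = _ := by ring
  linarith

end Energy

end ParabolicISS

namespace ParabolicISS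

/-! ### Energy weights and the pointwise energy inequality -/

variable {m : ℕ} {Ω : Set (EuclideanSpace ℝ (Fin (m + 1)))} {S : Coefficients (m + 1)}
  {μ : EuclideanSpace ℝ (Fin (m + 1)) → ℝ → ℝ} {P : EuclideanSpace ℝ (Fin (m + 1)) → ℝ} {lam : ℝ}

/-- A weight `P` for which the weighted `L¹`-norm decays at rate `lam` along solutions. -/
structure IsEnergyWeight (S : Coefficients (m + 1)) (Ω : Set (EuclideanSpace ℝ (Fin (m + 1))))
    (μ : EuclideanSpace ℝ (Fin (m + 1)) → ℝ → ℝ) (P : EuclideanSpace ℝ (Fin (m + 1)) → ℝ)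
    (lam : ℝ) : Prop where
  weight : IsWeight Ω P
  lam_nonneg : 0 ≤ lam
  super : ∀ x ∈ Ω, ∀ t, 0 < t →
    divg (fun y => S.a y t • gradient P y) x + inner ℝ (S.b x t) (gradient P x)
      + P x * (divg (fun y => S.b y t) x - S.c x t + μ x t) ≤ -(lam * P x)
  sign : ∀ x ∈ Ω, ∀ t, 0 < t → ∀ s, S.g x t s * s * divg (fun y => P y • S.m y t) x ≤ 0

/-- Slices of functions regular on `closure Ω × [0,∞)` are regular on `Ω`. -/
theorem contDiffOn_slice {F : Type*} [NormedAddCommGroup F] [NormedSpace ℝ F]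
    {f : EuclideanSpace ℝ (Fin (m + 1)) → ℝ → F}
    (hf : ContDiffOn ℝ 2 (fun z : EuclideanSpace ℝ (Fin (m + 1)) × ℝ => f z.1 z.2)
      (closure Ω ×ˢ Ici (0 : ℝ))) {t : ℝ} (ht : 0 ≤ t) : ContDiffOn ℝ 2 (fun y => f y t) Ω :=
  hf.comp (f := fun y => (y, t)) (by fun_prop) fun _ hy => ⟨subset_closure hy, ht⟩

/-- The energy flux field. -/
noncomputable def energyField (S : Coefficients (m + 1)) (P : EuclideanSpace ℝ (Fin (m + 1)) → ℝ)
    (w : EuclideanSpace ℝ (Fin (m + 1)) → ℝ → ℝ) (δ ε t : ℝ)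
    (y : EuclideanSpace ℝ (Fin (m + 1))) : EuclideanSpace ℝ (Fin (m + 1)) :=
  (trunc δ (P y) * (w y t / absReg ε (w y t))) • (S.a y t • gradient (fun y' => w y' t) y)
    - (absReg ε (w y t) * truncD δ (P y)) • (S.a y t • gradient P y)
    - (trunc δ (P y) * absReg ε (w y t)) • S.b y t
    - (w y t / absReg ε (w y t) * S.g y t (w y t) * trunc δ (P y)) • S.m y t

namespace IsEnergyWeight

variable {I : Inputs (m + 1)} {T : ℝ} {w : EuclideanSpace ℝ (Fin (m + 1)) → ℝ → ℝ}

theorem contDiffOn_flux (hS : S.Regular Ω) (hw : S.IsClassicalSolution Ω I T w) {t : ℝ}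
    (ht : t ∈ Ioo 0 T) : ContDiffOn ℝ 2 (fun y => S.g y t (w y t)) Ω := by
  have h1 : ContDiffOn ℝ 2 (fun y => ((y, t, w y t) : EuclideanSpace ℝ (Fin (m + 1)) × ℝ × ℝ)) Ω :=
    contDiffOn_id.prodMk (contDiffOn_const.prodMk (hw.diff_space t ht))
  exact (hS.g.of_le (by norm_num)).comp h1
    fun y hy => ⟨subset_closure hy, ht.1.le, mem_univ _⟩

theorem contDiffOn_energyField (hΩ : IsOpen Ω) (hP : IsWeight Ω P) (hS : S.Regular Ω)
    (hw : S.IsClassicalSolution Ω I T w) {δ ε t : ℝ} (hε : 0 < ε) (ht : t ∈ Ioo 0 T) :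
    ContDiffOn ℝ 1 (energyField S P w δ ε t) Ω := by
  have h2 := hw.diff_space t ht
  have hw1 : ContDiffOn ℝ 1 (fun y => w y t) Ω := h2.of_le (by norm_num)
  have hP1 : ContDiffOn ℝ 1 P Ω := hP.contDiffOn.of_le (by norm_num)
  have hgw : ContDiffOn ℝ 1 (gradient fun y => w y t) Ω := contDiffOn_gradient hΩ (by
    norm_num; exact h2)
  have hgP := hP.contDiffOn_gradient hΩ
  have ha : ContDiffOn ℝ 1 (fun y => S.a y t) Ω :=
    (contDiffOn_slice hS.a ht.1.le).of_le (by norm_num)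
  have hb : ContDiffOn ℝ 1 (fun y => S.b y t) Ω :=
    (contDiffOn_slice hS.b ht.1.le).of_le (by norm_num)
  have hm : ContDiffOn ℝ 1 (fun y => S.m y t) Ω :=
    (contDiffOn_slice hS.m ht.1.le).of_le (by norm_num)
  have hg : ContDiffOn ℝ 1 (fun y => S.g y t (w y t)) Ω :=
    (contDiffOn_flux hS hw ht).of_le (by norm_num)
  have e1 : ContDiffOn ℝ 1 (fun y => trunc δ (P y)) Ω :=
    ((contDiff_trunc δ).of_le (by norm_num)).comp_contDiffOn hP1
  have e2 : ContDiffOn ℝ 1 (fun y => truncD δ (P y)) Ω :=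
    ((contDiff_truncD δ).of_le (by norm_num)).comp_contDiffOn hP1
  have e3 : ContDiffOn ℝ 1 (fun y => absReg ε (w y t)) Ω :=
    ((contDiff_absReg hε).of_le (by norm_num)).comp_contDiffOn hw1
  have e4 : ContDiffOn ℝ 1 (fun y => w y t / absReg ε (w y t)) Ω :=
    ((contDiff_absReg_deriv hε).of_le (by norm_num)).comp_contDiffOn hw1
  exact ((((e1.mul e4).smul (ha.smul hgw)).sub ((e3.mul e2).smul (ha.smul hgP))).sub
    ((e1.mul e3).smul hb)).sub (((e4.mul hg).mul e1).smul hm)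

theorem energyField_eq_zero {δ ε t : ℝ} (hδ : 0 < δ)
    {x : EuclideanSpace ℝ (Fin (m + 1))} (hx : x ∈ Ω)
    (hxL : x ∉ closure Ω ∩ {x | δ ≤ P x}) : energyField S P w δ ε t x = 0 := by
  have h := (IsWeight.lt_of_notMem hx hxL).le
  simp [energyField, trunc_eq_zero hδ h, truncD_eq_zero hδ h]

/-- The pointwise energy inequality, uniformly on `Ω × (0,T)`. -/
theorem exists_energy_bound (hE : IsEnergyWeight S Ω μ P lam) (hΩ : IsC2Domain Ω)
    (hS : S.Regular Ω) {alo ahi clo : ℝ} (h1 : S.Assumption1 Ω alo ahi)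
    (h2 : S.Assumption2 Ω μ clo) (hw : S.IsClassicalSolution Ω I T w) :
    ∃ C, 0 ≤ C ∧ ∀ δ ε, 0 < δ → 0 < ε → ε ≤ 1 → ∀ x ∈ Ω, ∀ t ∈ Ioo 0 T,
      trunc δ (P x) * (w x t / absReg ε (w x t)) * deriv (fun r => w x r) t
          - divg (energyField S P w δ ε t) x ≤
        -(lam * (trunc δ (P x) * absReg ε (w x t))) + S.a x t * |w x t| * layer P δ x
          + ε * (S.a x t * layer P δ x) + P x * |I.f x t| + C * (δ + ε) := by
  have hP := hE.weight
  have hΩo := hΩ.isOpen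
  have hsubT : closure Ω ×ˢ Icc 0 T ⊆ closure Ω ×ˢ Ici (0 : ℝ) :=
    prod_mono_right Icc_subset_Ici_self
  -- uniform bounds
  obtain ⟨Wb, hWb0, hWb⟩ := hΩ.exists_bound hw.cont
  obtain ⟨cb, hcb0, hcb⟩ := hΩ.exists_bound (hS.c.continuousOn.mono hsubT)
  obtain ⟨μb, hμb0, hμb⟩ := hΩ.exists_bound (h2.μ_cont.mono hsubT)
  obtain ⟨mb, hmb0, hmb⟩ := hΩ.exists_bound (hS.m.continuousOn.mono hsubT)
  obtain ⟨bd, hbd0, hbd⟩ := hΩ.exists_bound_fderiv hS.b T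
  obtain ⟨md, hmd0, hmd⟩ := hΩ.exists_bound_fderiv hS.m T
  obtain ⟨s₀, g₀, hs₀, hg₀c, hg₀⟩ := h2.g_bound
  obtain ⟨g₀b, hg₀b0, hg₀b⟩ := hΩ.exists_bound (hg₀c.mono hsubT)
  obtain ⟨Gb, hGb0, hGb⟩ := hΩ.exists_bound (T := T) (f := fun x t => S.g x t (w x t)) (by
    refine hS.g.continuousOn.comp (f := fun z : EuclideanSpace ℝ (Fin (m + 1)) × ℝ =>
      (z.1, z.2, w z.1 z.2)) ?_ fun z hz => ⟨hz.1, hz.2.1, mem_univ _⟩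
    exact continuousOn_fst.prodMk (continuousOn_snd.prodMk hw.cont))
  obtain ⟨Pb, hPb⟩ := hΩ.isCompact_closure.exists_bound_of_continuousOn hP.continuousOn
  set n' : ℝ := ((m + 1 : ℕ) : ℝ)
  have hn' : 0 ≤ n' := Nat.cast_nonneg _
  set κB := n' * bd + cb + μb
  set Cρ := g₀b ^ 2 + Gb ^ 2 / s₀ ^ 3
  set Pc := |Pb|
  -- `C₁` and `C₂` are the coefficients of `δ` and `ε` in `energy_pointwise`, made uniform in `x`
  -- and `t`. They involve no bound on `∇w`, which may blow up at the boundary.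
  set C₁ := 2 * (Wb + 1) * (lam + κB) + 2 * Gb * (n' * md) with hC₁
  set C₂ := Pc * (cb + μb) + Pc * (Cρ * mb ^ 2 / (4 * alo)) with hC₂
  have hlam := hE.lam_nonneg
  have halo := h1.alo_pos
  have hC₁0 : 0 ≤ C₁ := by positivity
  have hC₂0 : 0 ≤ C₂ := by positivity
  refine ⟨C₁ + C₂, by positivity, fun δ ε hδ hε hε1 x hx t ht => ?_⟩
  have htT : t ∈ Icc 0 T := ⟨ht.1.le, ht.2.le⟩
  have htT' : t ∈ Ioc 0 T := ⟨ht.1, ht.2.le⟩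
  have hxc := subset_closure hx
  have hnh := hΩo.mem_nhds hx
  have da : DifferentiableAt ℝ (fun y => S.a y t) x :=
    ((contDiffOn_slice hS.a ht.1.le).contDiffAt hnh).differentiableAt (by norm_num)
  have db : DifferentiableAt ℝ (fun y => S.b y t) x :=
    ((contDiffOn_slice hS.b ht.1.le).contDiffAt hnh).differentiableAt (by norm_num)
  have dm : DifferentiableAt ℝ (fun y => S.m y t) x :=
    ((contDiffOn_slice hS.m ht.1.le).contDiffAt hnh).differentiableAt (by norm_num)
  have dW : DifferentiableAt ℝ (fun y => w y t) x :=
    ((hw.diff_space t ht).contDiffAt hnh).differentiableAt (by norm_num)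
  have dG : DifferentiableAt ℝ (fun y => S.g y t (w y t)) x :=
    ((contDiffOn_flux hS hw ht).contDiffAt hnh).differentiableAt (by norm_num)
  have dP : DifferentiableAt ℝ P x := (hP.hasGradientAt hΩo hx).differentiableAt
  have dgP : DifferentiableAt ℝ (gradient P) x :=
    ((hP.contDiffOn_gradient hΩo).contDiffAt hnh).differentiableAt (by norm_num)
  have dgW : DifferentiableAt ℝ (gradient fun y => w y t) x :=
    ((contDiffOn_gradient (k := 1) hΩo (by
      norm_num; exact hw.diff_space t ht)).contDiffAt hnh).differentiableAt (by norm_num)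
  have hdiv := divg_energy_field (a := fun y => S.a y t) (P := P) (W := fun y => w y t)
    (G := fun y => S.g y t (w y t)) (b := fun y => S.b y t) (m := fun y => S.m y t) (x := x)
    (Φ := trunc δ) (Φ₁ := truncD δ) (ρ := absReg ε) (ρ₁ := fun s => s / absReg ε s)
    da dP dW dG db dm dgP dgW (hasDerivAt_trunc δ _) (hasDerivAt_truncD δ _)
    (hasDerivAt_absReg hε _) (hasDerivAt_absReg_deriv hε _)
  have hdivE : divg (energyField S P w δ ε t) x = _ := hdiv
  have hPm : divg (fun y => P y • S.m y t) x =
      P x * divg (fun y => S.m y t) x + inner ℝ (gradient P x) (S.m x t) := divg_smul dP dm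
  have hsign := hE.sign x hx t ht.1 (w x t)
  rw [hPm] at hsign
  have hbdiv : |divg (fun y => S.b y t) x| ≤ n' * bd :=
    (abs_divg_le _ _).trans (mul_le_mul_of_nonneg_left (hbd x hx t htT') hn')
  have hmdiv : |divg (fun y => S.m y t) x| ≤ n' * md :=
    (abs_divg_le _ _).trans (mul_le_mul_of_nonneg_left (hmd x hx t htT') hn')
  have hcx := abs_le.1 (hcb x hxc t htT)
  have hμx := abs_le.1 (hμb x hxc t htT)
  have hbx := abs_le.1 hbdiv
  have hp0 := hP.nonneg x hx
  have hpP : P x ≤ Pc := (le_abs_self _).trans ((hPb x hxc).trans (le_abs_self _))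
  have hgx : |w x t| ≤ s₀ → |S.g x t (w x t)| ≤ |g₀b| * |w x t| := by
    intro h
    refine (hg₀ x hx t ht.1 (w x t) (abs_le.1 h)).trans ?_
    rw [abs_of_nonneg hg₀b0]
    exact mul_le_mul_of_nonneg_right (hg₀b x hxc t htT) (abs_nonneg _)
  have hmain := energy_pointwise (lam := lam) (p := P x) (Φ := trunc δ (P x))
    (Φ₁ := truncD δ (P x)) (Φ₂ := deriv (truncD δ) (P x)) (ε := ε) (δ := δ) (W := w x t)
    (a := S.a x t) (alo := alo) (c := S.c x t) (μ := μ x t) (f := I.f x t)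
    (h := S.h x t (w x t) (gradient (fun y => w y t) x)) (G := S.g x t (w x t))
    (divb := divg (fun y => S.b y t) x) (divm := divg (fun y => S.m y t) x)
    (dP := divg (fun y => S.a y t • gradient P y) x + inner ℝ (S.b x t) (gradient P x))
    (mP := inner ℝ (gradient P x) (S.m x t)) (gP := ‖gradient P x‖)
    (gW := ‖gradient (fun y => w y t) x‖) (mW := inner ℝ (gradient (fun y => w y t) x) (S.m x t))
    (nm := mb) (κB := κB) (Wb := Wb) (cB := cb + μb) (GB := Gb) (mB := n' * md) (Cρ := Cρ)
    hδ hε hε1 hlam (trunc_nonneg δ hp0) (trunc_le δ hp0) (truncD_nonneg δ _)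
    (deriv_truncD_nonneg hδ _) (abs_mul_truncD_sub_trunc_le hδ hp0) halo
    (h1.a_bounds x hxc t ht.1.le).1 (hE.super x hx t ht.1) (h2.h_sign x hx t ht.1 _ _)
    hsign
    (by
      refine (abs_real_inner_le_norm _ _).trans ?_
      rw [mul_comm]
      exact mul_le_mul_of_nonneg_right (hmb x hxc t htT) (norm_nonneg _))
    (abs_le.2 ⟨by simp only [κB]; linarith, by simp only [κB]; linarith⟩)
    (hWb x hxc t htT) (abs_le.2 ⟨by linarith, by linarith⟩) hmdiv (hGb x hxc t htT)
    (absReg_deriv2_mul_sq_le hε hε1 hs₀ hgx (hGb x hxc t htT))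
  have heq := hw.equation x hx t ht
  -- With `w_t` expressed through the equation, the second derivatives of `w` and the terms `b·∇w`
  -- and `m·∇g` cancel against the divergence of the energy field.
  have hwt : deriv (fun r => w x r) t =
      divg (fun y => S.a y t • gradient (fun y' => w y' t) y) x
      - inner ℝ (S.b x t) (gradient (fun y => w y t) x)
      - inner ℝ (S.m x t) (gradient (fun y => S.g y t (w y t)) x)
      + (-(S.c x t * w x t) - S.h x t (w x t) (gradient (fun y => w y t) x) + I.f x t) := by
    linarith
  have hC2x : P x * (cb + μb) + P x * (Cρ * mb ^ 2 / (4 * alo)) ≤ C₂ := by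
    have : 0 ≤ Cρ * mb ^ 2 / (4 * alo) := by positivity
    have : 0 ≤ cb + μb := by positivity
    rw [hC₂]; gcongr
  have e1 := mul_le_mul_of_nonneg_right hC2x hε.le
  have e2 : 0 ≤ C₁ * ε := by positivity
  have e3 : 0 ≤ C₂ * δ := by positivity
  rw [hdivE, hwt]
  unfold layer
  linarith

end IsEnergyWeight

end ParabolicISS

namespace ParabolicISS

/-! ### Integrals depending on time -/

section Param

variable {n : ℕ} {K : Set (EuclideanSpace ℝ (Fin n))} {ν : Measure (EuclideanSpace ℝ (Fin n))}
  {f : EuclideanSpace ℝ (Fin n) → ℝ → ℝ} {L : EuclideanSpace ℝ (Fin n) → ℝ} {T : ℝ}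

theorem aestronglyMeasurable_of_ae_mem (hK : IsCompact K) (hν : ∀ᵐ x ∂ν, x ∈ K)
    {g : EuclideanSpace ℝ (Fin n) → ℝ} (hg : ContinuousOn g K) : AEStronglyMeasurable g ν := by
  have := hg.aestronglyMeasurable (μ := ν) hK.isClosed.measurableSet
  rwa [Measure.restrict_eq_self_of_ae_mem hν] at this

theorem continuousOn_slice_time (hf : ContinuousOn (fun z : EuclideanSpace ℝ (Fin n) × ℝ =>
    f z.1 z.2) (K ×ˢ Icc 0 T)) {x : EuclideanSpace ℝ (Fin n)} (hx : x ∈ K) :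
    ContinuousOn (f x) (Icc 0 T) :=
  hf.comp (f := fun t => (x, t)) (by fun_prop) fun _ ht => ⟨hx, ht⟩

theorem continuousOn_slice_space (hf : ContinuousOn (fun z : EuclideanSpace ℝ (Fin n) × ℝ =>
    f z.1 z.2) (K ×ˢ Icc 0 T)) {t : ℝ} (ht : t ∈ Icc 0 T) : ContinuousOn (fun x => f x t) K :=
  hf.comp (f := fun x => (x, t)) (by fun_prop) fun _ hx => ⟨hx, ht⟩

theorem continuousOn_integral_mul (hK : IsCompact K) (hν : ∀ᵐ x ∂ν, x ∈ K)
    (hf : ContinuousOn (fun z : EuclideanSpace ℝ (Fin n) × ℝ => f z.1 z.2) (K ×ˢ Icc 0 T))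
    (hL : Integrable L ν) : ContinuousOn (fun t => ∫ x, f x t * L x ∂ν) (Icc 0 T) := by
  obtain ⟨C, hC⟩ := (hK.prod isCompact_Icc).exists_bound_of_continuousOn hf
  refine continuousOn_of_dominated (bound := fun x => C * ‖L x‖) (fun t ht => ?_) (fun t ht => ?_)
    (hL.norm.const_mul C) ?_
  · exact (aestronglyMeasurable_of_ae_mem hK hν (continuousOn_slice_space hf ht)).mul hL.1
  · filter_upwards [hν] with x hx
    rw [norm_mul]
    exact mul_le_mul_of_nonneg_right (hC (x, t) ⟨hx, ht⟩) (norm_nonneg _)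
  · filter_upwards [hν] with x hx
    exact (continuousOn_slice_time hf hx).mul continuousOn_const

theorem continuousOn_integral_time (hK : IsCompact K) (hT : 0 ≤ T)
    (hf : ContinuousOn (fun z : EuclideanSpace ℝ (Fin n) × ℝ => f z.1 z.2) (K ×ˢ Icc 0 T)) :
    ContinuousOn (fun x => ∫ t in (0 : ℝ)..T, f x t) K := by
  obtain ⟨C, hC⟩ := (hK.prod isCompact_Icc).exists_bound_of_continuousOn hf
  simp only [intervalIntegral.integral_of_le hT]
  refine continuousOn_of_dominated (bound := fun _ => C) (fun x hx => ?_) (fun x hx => ?_)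
    (integrable_const C) ?_
  · exact ((continuousOn_slice_time hf hx).mono Ioc_subset_Icc_self).aestronglyMeasurable
      measurableSet_Ioc
  · filter_upwards [ae_restrict_mem measurableSet_Ioc] with t ht
    exact hC (x, t) ⟨hx, Ioc_subset_Icc_self ht⟩
  · filter_upwards [ae_restrict_mem measurableSet_Ioc] with t ht
    exact continuousOn_slice_space hf (Ioc_subset_Icc_self ht)

/-- Fubini. The layer estimate concerns one fixed continuous function of `x`; integrating in time
first supplies such a function and avoids any uniformity in `t`. -/
theorem integral_time_integral_mul [SFinite ν] (hK : IsCompact K) (hν : ∀ᵐ x ∂ν, x ∈ K)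
    (hT : 0 ≤ T)
    (hf : ContinuousOn (fun z : EuclideanSpace ℝ (Fin n) × ℝ => f z.1 z.2) (K ×ˢ Icc 0 T))
    (hL : Integrable L ν) :
    ∫ t in (0 : ℝ)..T, ∫ x, f x t * L x ∂ν = ∫ x, (∫ t in (0 : ℝ)..T, f x t) * L x ∂ν := by
  obtain ⟨C, hC⟩ := (hK.prod isCompact_Icc).exists_bound_of_continuousOn hf
  have hKm := hK.isClosed.measurableSet
  have hprod : ((volume : Measure ℝ).restrict (Ioc 0 T)).prod ν =
      ((volume : Measure ℝ).prod ν).restrict (Ioc 0 T ×ˢ K) := by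
    rw [← Measure.prod_restrict, Measure.restrict_eq_self_of_ae_mem hν]
  have hfc : ContinuousOn (fun z : ℝ × EuclideanSpace ℝ (Fin n) => f z.2 z.1) (Ioc 0 T ×ˢ K) :=
    hf.comp (f := fun z : ℝ × EuclideanSpace ℝ (Fin n) => (z.2, z.1)) (by fun_prop)
      fun z hz => ⟨hz.2, Ioc_subset_Icc_self hz.1⟩
  have hmeas : MeasurableSet (Ioc 0 T ×ˢ K) := measurableSet_Ioc.prod hKm
  have hint : Integrable (Function.uncurry fun t x => f x t * L x)
      (((volume : Measure ℝ).restrict (Ioc 0 T)).prod ν) := by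
    have h1 : Integrable (fun z : ℝ × EuclideanSpace ℝ (Fin n) => (1 : ℝ) * L z.2)
        (((volume : Measure ℝ).restrict (Ioc 0 T)).prod ν) := (integrable_const (1 : ℝ)).mul_prod hL
    simp only [one_mul] at h1
    refine h1.bdd_mul (c := C) (f := fun z : ℝ × EuclideanSpace ℝ (Fin n) => f z.2 z.1) ?_ ?_
    · rw [hprod]
      exact hfc.aestronglyMeasurable hmeas
    · rw [hprod]
      filter_upwards [ae_restrict_mem hmeas] with z hz
      exact hC (z.2, z.1) ⟨hz.2, Ioc_subset_Icc_self hz.1⟩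
  simp only [intervalIntegral.integral_of_le hT]
  rw [integral_integral_swap hint]
  simp only [integral_mul_const]

end Param

variable {m : ℕ} {Ω : Set (EuclideanSpace ℝ (Fin (m + 1)))} {S : Coefficients (m + 1)}
  {μ : EuclideanSpace ℝ (Fin (m + 1)) → ℝ → ℝ} {P : EuclideanSpace ℝ (Fin (m + 1)) → ℝ} {lam : ℝ}
  {I : Inputs (m + 1)} {T : ℝ} {w : EuclideanSpace ℝ (Fin (m + 1)) → ℝ → ℝ}

theorem IsWeight.continuousOn_trunc (hP : IsWeight Ω P) (δ : ℝ) :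
    ContinuousOn (fun x => trunc δ (P x)) (closure Ω) :=
  (contDiff_trunc δ).continuous.comp_continuousOn hP.continuousOn

/-- Differentiation of the truncated energy. -/
theorem hasDerivAt_truncEnergy (hΩ : IsC2Domain Ω) (hP : IsWeight Ω P)
    (hw : S.IsClassicalSolution Ω I T w) {δ ε t : ℝ} (hδ : 0 < δ) (hε : 0 < ε)
    (ht : t ∈ Ioo 0 T) :
    IntegrableOn (fun x => trunc δ (P x) * (w x t / absReg ε (w x t)) *
        deriv (fun r => w x r) t) Ω ∧
      HasDerivAt (fun t => ∫ x in Ω, trunc δ (P x) * absReg ε (w x t))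
        (∫ x in Ω, trunc δ (P x) * (w x t / absReg ε (w x t)) * deriv (fun r => w x r) t) t := by
  have hΩo := hΩ.isOpen
  set L := closure Ω ∩ {x | δ ≤ P x} with hL
  have hLc : IsCompact L := hP.isCompact_superlevel hΩ δ
  have hLΩ : L ⊆ Ω := hP.superlevel_subset hΩ hδ
  have hPc : ContinuousOn P Ω := hP.contDiffOn.continuousOn
  obtain ⟨r, hr, hrs⟩ : ∃ r > 0, Icc (t - r) (t + r) ⊆ Ioo 0 T := by
    refine ⟨min t (T - t) / 2, half_pos (lt_min ht.1 (by linarith [ht.2])), fun s hs => ?_⟩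
    have h1 := min_le_left t (T - t)
    have h2 := min_le_right t (T - t)
    have := ht.1; have := ht.2
    have h3 : 0 < min t (T - t) := lt_min ht.1 (by linarith)
    exact ⟨by linarith [hs.1], by linarith [hs.2]⟩
  have htr : ContinuousOn (fun x => trunc δ (P x)) Ω :=
    (hP.continuousOn_trunc δ).mono subset_closure
  have hwc : ContinuousOn (fun z : EuclideanSpace ℝ (Fin (m + 1)) × ℝ => w z.1 z.2)
      (Ω ×ˢ Ioo 0 T) := hw.cont.mono (prod_mono subset_closure Ioo_subset_Icc_self)
  have hF'c : ContinuousOn (fun z : EuclideanSpace ℝ (Fin (m + 1)) × ℝ =>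
      trunc δ (P z.1) * (w z.1 z.2 / absReg ε (w z.1 z.2)) * deriv (fun r => w z.1 r) z.2)
      (Ω ×ˢ Ioo 0 T) := by
    refine ((htr.comp continuousOn_fst fun z hz => hz.1).mul ?_).mul hw.cont_time
    exact (contDiff_absReg_deriv hε).continuous.comp_continuousOn hwc
  -- The time derivative is bounded only on compact subsets of `Ω × (0,T)`. This is enough for
  -- domination, as the truncated weight vanishes off `L`.
  obtain ⟨C, hC⟩ := (hLc.prod isCompact_Icc).exists_bound_of_continuousOn
    (hF'c.mono (prod_mono hLΩ hrs))
  have hslice : ∀ s ∈ Ioo 0 T, ContinuousOn (fun x => trunc δ (P x) * absReg ε (w x s)) Ω := by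
    intro s hs
    exact htr.mul ((contDiff_absReg hε).continuous.comp_continuousOn
      (hwc.comp (f := fun x => (x, s)) (by fun_prop) fun x hx => ⟨hx, hs⟩))
  have hzero : ∀ x ∈ Ω, x ∉ L → trunc δ (P x) = 0 := fun x hx hxL =>
    trunc_eq_zero hδ (IsWeight.lt_of_notMem hx hxL).le
  have hs : Icc (t - r) (t + r) ∈ 𝓝 t := Icc_mem_nhds (by linarith) (by linarith)
  refine hasDerivAt_integral_of_dominated_loc_of_deriv_le (μ := volume.restrict Ω)
    (F := fun t x => trunc δ (P x) * absReg ε (w x t)) (bound := fun _ => |C|)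
    (F' := fun t x => trunc δ (P x) * (w x t / absReg ε (w x t)) * deriv (fun r => w x r) t)
    hs ?_ ?_ ?_ ?_ ?_ ?_
  · filter_upwards [hs] with s hs'
    exact (hslice s (hrs hs')).aestronglyMeasurable hΩo.measurableSet
  · exact integrableOn_of_compact hΩo hLc hLΩ (hslice t ht) fun x hx hxL => by
      simp [hzero x hx hxL]
  · exact (hF'c.comp (f := fun x => (x, t)) (by fun_prop)
      fun x hx => ⟨hx, ht⟩).aestronglyMeasurable hΩo.measurableSet
  · filter_upwards [ae_restrict_mem hΩo.measurableSet] with x hx s hs'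
    by_cases hxL : x ∈ L
    · exact (hC (x, s) ⟨hxL, hs'⟩).trans (le_abs_self C)
    · simp [hzero x hx hxL]
  · have := hΩ.volume_lt_top
    exact integrableOn_const this.ne
  · filter_upwards [ae_restrict_mem hΩo.measurableSet] with x hx s hs'
    have h1 := (hw.diff_time x hx s (hrs hs')).hasDerivAt
    have h2 := ((hasDerivAt_absReg hε (w x s)).comp s h1).const_mul (trunc δ (P x))
    exact h2.congr_deriv (mul_assoc _ _ _).symm

end ParabolicISS

namespace ParabolicISS

/-! ### The Laplacian of an energy weight and the integrated energy inequality -/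

variable {m : ℕ} {Ω : Set (EuclideanSpace ℝ (Fin (m + 1)))} {S : Coefficients (m + 1)}
  {μ : EuclideanSpace ℝ (Fin (m + 1)) → ℝ → ℝ} {P : EuclideanSpace ℝ (Fin (m + 1)) → ℝ} {lam : ℝ}
  {I : Inputs (m + 1)} {T : ℝ} {w : EuclideanSpace ℝ (Fin (m + 1)) → ℝ → ℝ}

theorem norm_gradient_eq {n : ℕ} (u : EuclideanSpace ℝ (Fin n) → ℝ)
    (x : EuclideanSpace ℝ (Fin n)) : ‖gradient u x‖ = ‖fderiv ℝ u x‖ :=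
  (InnerProductSpace.toDual ℝ (EuclideanSpace ℝ (Fin n))).symm.norm_map _

theorem IsWeight.nonneg_closure (hP : IsWeight Ω P) (hΩ : IsC2Domain Ω)
    {x : EuclideanSpace ℝ (Fin (m + 1))} (hx : x ∈ closure Ω) : 0 ≤ P x := by
  by_cases h : x ∈ Ω
  · exact hP.nonneg x h
  · exact (hP.frontier x (hΩ.mem_frontier_of hx h)).ge

namespace IsEnergyWeight

/-- The Laplacian of an energy weight is controlled from above by lower order terms. -/
theorem exists_laplacian_bound (hE : IsEnergyWeight S Ω μ P lam) (hΩ : IsC2Domain Ω)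
    (hS : S.Regular Ω) {alo ahi clo : ℝ} (h1 : S.Assumption1 Ω alo ahi)
    (h2 : S.Assumption2 Ω μ clo) :
    ∃ M, 0 ≤ M ∧ ∀ x ∈ Ω, divg (gradient P) x ≤ M * (P x + ‖gradient P x‖) := by
  have hΩo := hΩ.isOpen
  have hsubT : closure Ω ×ˢ Icc (0 : ℝ) 1 ⊆ closure Ω ×ˢ Ici (0 : ℝ) :=
    prod_mono_right Icc_subset_Ici_self
  obtain ⟨bb, hbb0, hbb⟩ := hΩ.exists_bound (hS.b.continuousOn.mono hsubT)
  obtain ⟨cb, hcb0, hcb⟩ := hΩ.exists_bound (hS.c.continuousOn.mono hsubT)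
  obtain ⟨μb, hμb0, hμb⟩ := hΩ.exists_bound (h2.μ_cont.mono hsubT)
  obtain ⟨ad, had0, had⟩ := hΩ.exists_bound_fderiv hS.a 1
  obtain ⟨bd, hbd0, hbd⟩ := hΩ.exists_bound_fderiv hS.b 1
  set n' : ℝ := ((m + 1 : ℕ) : ℝ)
  have hn' : 0 ≤ n' := Nat.cast_nonneg _
  have halo := h1.alo_pos
  set R := ad + bb + (n' * bd + cb + μb) with hR
  have hR0 : 0 ≤ R := by positivity
  refine ⟨R / alo, by positivity, fun x hx => ?_⟩
  have hxc := subset_closure hx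
  have h11 : (1 : ℝ) ∈ Icc (0 : ℝ) 1 := ⟨zero_le_one, le_rfl⟩
  have h11' : (1 : ℝ) ∈ Ioc (0 : ℝ) 1 := ⟨zero_lt_one, le_rfl⟩
  have hnh := hΩo.mem_nhds hx
  have da : DifferentiableAt ℝ (fun y => S.a y 1) x :=
    ((contDiffOn_slice hS.a zero_le_one).contDiffAt hnh).differentiableAt (by norm_num)
  have dgP : DifferentiableAt ℝ (gradient P) x :=
    ((hE.weight.contDiffOn_gradient hΩo).contDiffAt hnh).differentiableAt (by norm_num)
  -- `P` does not depend on time, so the weight inequality at one positive time suffices.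
  have hs := hE.super x hx 1 zero_lt_one
  rw [divg_smul da dgP] at hs
  have hP0 := hE.weight.nonneg x hx
  have hlam := mul_nonneg hE.lam_nonneg hP0
  have hg0 := norm_nonneg (gradient P x)
  have e1 : |inner ℝ (gradient (fun y => S.a y 1) x) (gradient P x)| ≤ ad * ‖gradient P x‖ := by
    refine (abs_real_inner_le_norm _ _).trans ?_
    gcongr
    rw [norm_gradient_eq]
    exact had x hx 1 h11'
  have e2 : |inner ℝ (S.b x 1) (gradient P x)| ≤ bb * ‖gradient P x‖ := by
    refine (abs_real_inner_le_norm _ _).trans ?_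
    gcongr
    exact hbb x hxc 1 h11
  have e3 : |divg (fun y => S.b y 1) x - S.c x 1 + μ x 1| ≤ n' * bd + cb + μb := by
    have k1 := (abs_divg_le (fun y => S.b y 1) x).trans
      (mul_le_mul_of_nonneg_left (hbd x hx 1 h11') hn')
    have k2 : |S.c x 1| ≤ cb := hcb x hxc 1 h11
    have k3 : |μ x 1| ≤ μb := hμb x hxc 1 h11
    rw [abs_le] at *
    constructor <;> linarith
  have e4 : -(P x * (n' * bd + cb + μb)) ≤
      P x * (divg (fun y => S.b y 1) x - S.c x 1 + μ x 1) := by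
    rw [← mul_neg]
    exact mul_le_mul_of_nonneg_left (abs_le.1 e3).1 hP0
  have hκ : 0 ≤ n' * bd + cb + μb := by positivity
  have e5 : S.a x 1 * divg (gradient P) x ≤ R * (P x + ‖gradient P x‖) := by
    have k1 := (abs_le.1 e1).1
    have k2 := (abs_le.1 e2).1
    have k3 := mul_nonneg hκ hg0
    have k4 := mul_nonneg (add_nonneg had0 hbb0) hP0
    rw [hR]
    linarith
  have hax := (h1.a_bounds x hxc 1 zero_le_one).1
  -- Division by `a` uses only `a ≥ alo`, which helps when the Laplacian is nonnegative; otherwise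
  -- there is nothing to prove.
  rcases le_total (divg (gradient P) x) 0 with h | h
  · exact h.trans (by positivity)
  · rw [div_mul_eq_mul_div, le_div_iff₀ halo]
    have := mul_le_mul_of_nonneg_right hax h
    linarith

/-- The integrated energy inequality for the truncated and regularised energy. -/
theorem truncEnergy_le (hE : IsEnergyWeight S Ω μ P lam) (hΩ : IsC2Domain Ω)
    (hS : S.Regular Ω) {alo ahi clo : ℝ} (h1 : S.Assumption1 Ω alo ahi)
    (h2 : S.Assumption2 Ω μ clo) (hI : I.Regular Ω) (hT : 0 < T)
    (hw : S.IsClassicalSolution Ω I T w) :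
    ∃ C, 0 ≤ C ∧ ∀ δ ε, 0 < δ → 0 < ε → ε ≤ 1 →
      Real.exp (lam * T) * (∫ x in Ω, trunc δ (P x) * absReg ε (w x T)) -
        (∫ x in Ω, trunc δ (P x) * absReg ε (w x 0)) ≤
      (∫ x in Ω, (∫ t in (0 : ℝ)..T, Real.exp (lam * t) * (S.a x t * |w x t|)) * layer P δ x)
      + ε * (∫ x in Ω, (∫ t in (0 : ℝ)..T, Real.exp (lam * t) * S.a x t) * layer P δ x)
      + (∫ t in (0 : ℝ)..T, Real.exp (lam * t) * ∫ x in Ω, |I.f x t| * P x)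
      + C * (δ + ε) := by
  have hP := hE.weight
  have hΩo := hΩ.isOpen
  have hK := hΩ.isCompact_closure
  have hν : ∀ᵐ x ∂(volume.restrict Ω), x ∈ closure Ω := by
    filter_upwards [ae_restrict_mem hΩo.measurableSet] with x hx using subset_closure hx
  have hsubT : closure Ω ×ˢ Icc 0 T ⊆ closure Ω ×ˢ Ici (0 : ℝ) :=
    prod_mono_right Icc_subset_Ici_self
  obtain ⟨C, hC0, hC⟩ := hE.exists_energy_bound hΩ hS h1 h2 hw
  set v := (volume : Measure (EuclideanSpace ℝ (Fin (m + 1)))).real Ω with hv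
  have hv0 : 0 ≤ v := measureReal_nonneg
  set J := ∫ t in (0 : ℝ)..T, Real.exp (lam * t) with hJ
  have hJ0 : 0 ≤ J := intervalIntegral.integral_nonneg hT.le fun t _ => (Real.exp_pos _).le
  refine ⟨J * (C * v), by positivity, fun δ ε hδ hε hε1 => ?_⟩
  set L := closure Ω ∩ {x | δ ≤ P x} with hL
  have hLc : IsCompact L := hP.isCompact_superlevel hΩ δ
  have hLΩ : L ⊆ Ω := hP.superlevel_subset hΩ hδ
  have hac : ContinuousOn (fun z : EuclideanSpace ℝ (Fin (m + 1)) × ℝ => S.a z.1 z.2)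
      (closure Ω ×ˢ Icc 0 T) := hS.a.continuousOn.mono hsubT
  have hawc : ContinuousOn (fun z : EuclideanSpace ℝ (Fin (m + 1)) × ℝ => S.a z.1 z.2 * |w z.1 z.2|)
      (closure Ω ×ˢ Icc 0 T) := hac.mul hw.cont.abs
  have hfc : ContinuousOn (fun z : EuclideanSpace ℝ (Fin (m + 1)) × ℝ => |I.f z.1 z.2|)
      (closure Ω ×ˢ Icc 0 T) := (hI.f.continuousOn.mono hsubT).abs
  have hrc : ContinuousOn (fun z : EuclideanSpace ℝ (Fin (m + 1)) × ℝ => absReg ε (w z.1 z.2))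
      (closure Ω ×ˢ Icc 0 T) := (contDiff_absReg hε).continuous.comp_continuousOn hw.cont
  have hexpc : ContinuousOn (fun z : EuclideanSpace ℝ (Fin (m + 1)) × ℝ => Real.exp (lam * z.2))
      (closure Ω ×ˢ Icc 0 T) := by fun_prop
  have hlayI : Integrable (layer P δ) (volume.restrict Ω) := by
    have := hP.integrableOn_mul_layer hΩ hδ (F := fun _ => 1) continuousOn_const
    simp only [one_mul] at this
    exact this
  have hPI : Integrable P (volume.restrict Ω) := integrableOn_of_closure hΩ.isBounded hP.continuousOn
  have htrI : Integrable (fun x => trunc δ (P x)) (volume.restrict Ω) :=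
    integrableOn_of_closure hΩ.isBounded (hP.continuousOn_trunc δ)
  set A : ℝ → ℝ := fun t => ∫ x in Ω, S.a x t * |w x t| * layer P δ x with hA
  set B : ℝ → ℝ := fun t => ∫ x in Ω, S.a x t * layer P δ x with hB
  set G : ℝ → ℝ := fun t => ∫ x in Ω, |I.f x t| * P x with hG
  set V : ℝ → ℝ := fun t => ∫ x in Ω, trunc δ (P x) * absReg ε (w x t) with hV
  have hAc : ContinuousOn A (Icc 0 T) :=
    continuousOn_integral_mul (f := fun x t => S.a x t * |w x t|) hK hν hawc hlayI
  have hBc : ContinuousOn B (Icc 0 T) := continuousOn_integral_mul (f := S.a) hK hν hac hlayI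
  have hGc : ContinuousOn G (Icc 0 T) :=
    continuousOn_integral_mul (f := fun x t => |I.f x t|) hK hν hfc hPI
  have hVc : ContinuousOn V (Icc 0 T) := by
    have := continuousOn_integral_mul (f := fun x t => absReg ε (w x t)) hK hν hrc htrI
    simpa only [hV, mul_comm] using this
  -- the differential inequality
  have hder : ∀ t ∈ Ioo 0 T, ∃ V', HasDerivAt V V' t ∧
      V' ≤ -(lam * V t) + A t + ε * B t + G t + C * (δ + ε) * v := by
    intro t ht
    have htT : t ∈ Icc 0 T := Ioo_subset_Icc_self ht
    obtain ⟨hint, hd⟩ := hasDerivAt_truncEnergy hΩ hP hw hδ hε ht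
    refine ⟨_, hd, ?_⟩
    -- The field is supported in the compact superlevel set, so no boundary term arises here.
    have hdiv0 := integral_divg_eq_zero hΩo hLc hLΩ (contDiffOn_energyField hΩo hP hS hw
      (δ := δ) hε ht) fun x hx hxL => energyField_eq_zero hδ hx hxL
    have hdivI : IntegrableOn (divg (energyField S P w δ ε t)) Ω := by
      refine integrableOn_of_compact hΩo hLc hLΩ (continuousOn_divg hΩo
        (contDiffOn_energyField hΩo hP hS hw hε ht)) fun x hx hxL => ?_
      have : energyField S P w δ ε t =ᶠ[𝓝 x] fun _ => 0 := by
        filter_upwards [hΩo.mem_nhds hx, hLc.isClosed.isOpen_compl.mem_nhds hxL] with y hy hyL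
        exact energyField_eq_zero hδ hy hyL
      rw [divg_congr this]
      simp [divg]
    have i1 : Integrable (fun x => trunc δ (P x) * absReg ε (w x t)) (volume.restrict Ω) :=
      integrableOn_of_closure hΩ.isBounded
        ((hP.continuousOn_trunc δ).mul (continuousOn_slice_space (f := fun x t => absReg ε (w x t)) hrc htT))
    have i2 : Integrable (fun x => S.a x t * |w x t| * layer P δ x) (volume.restrict Ω) :=
      hP.integrableOn_mul_layer hΩ hδ ((continuousOn_slice_space
        (f := fun x t => S.a x t * |w x t|) hawc htT).mono subset_closure)
    have i3 : Integrable (fun x => S.a x t * layer P δ x) (volume.restrict Ω) :=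
      hP.integrableOn_mul_layer hΩ hδ ((continuousOn_slice_space (f := S.a) hac htT).mono subset_closure)
    have i4 : Integrable (fun x => |I.f x t| * P x) (volume.restrict Ω) :=
      integrableOn_of_closure hΩ.isBounded ((continuousOn_slice_space (f := fun x t => |I.f x t|) hfc htT).mul hP.continuousOn)
    have i5 : Integrable (fun _ : EuclideanSpace ℝ (Fin (m + 1)) => C * (δ + ε))
        (volume.restrict Ω) := integrableOn_const hΩ.volume_lt_top.ne
    have j0 : Integrable (fun x => -(lam * (trunc δ (P x) * absReg ε (w x t))))
        (volume.restrict Ω) := (i1.const_mul lam).neg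
    have j1 : Integrable (fun x => -(lam * (trunc δ (P x) * absReg ε (w x t)))
        + S.a x t * |w x t| * layer P δ x) (volume.restrict Ω) := j0.add i2
    have j2 : Integrable (fun x => -(lam * (trunc δ (P x) * absReg ε (w x t)))
        + S.a x t * |w x t| * layer P δ x + ε * (S.a x t * layer P δ x)) (volume.restrict Ω) :=
      j1.add (i3.const_mul ε)
    have j3 : Integrable (fun x => -(lam * (trunc δ (P x) * absReg ε (w x t)))
        + S.a x t * |w x t| * layer P δ x + ε * (S.a x t * layer P δ x) + |I.f x t| * P x)
        (volume.restrict Ω) := j2.add i4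
    have hmono : ∫ x in Ω, (trunc δ (P x) * (w x t / absReg ε (w x t)) * deriv (fun r => w x r) t
        - divg (energyField S P w δ ε t) x) ≤
        ∫ x in Ω, (-(lam * (trunc δ (P x) * absReg ε (w x t))) + S.a x t * |w x t| * layer P δ x
          + ε * (S.a x t * layer P δ x) + |I.f x t| * P x + C * (δ + ε)) := by
      refine setIntegral_mono_on (hint.sub hdivI) (j3.add i5) hΩo.measurableSet fun x hx => ?_
      have := hC δ ε hδ hε hε1 x hx t ht
      rwa [mul_comm (P x)] at this
    rw [integral_sub hint hdivI, hdiv0, sub_zero] at hmono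
    refine hmono.trans_eq ?_
    rw [integral_add j3 i5, integral_add j2 i4, integral_add j1 (i3.const_mul ε),
      integral_add j0 i2, integral_neg, integral_const_mul, integral_const_mul,
      setIntegral_const]
    simp only [hA, hB, hG, hV, hv, smul_eq_mul]
    ring
  choose! V' hV' hV'le using hder
  have hec : Continuous fun t : ℝ => Real.exp (lam * t) := by fun_prop
  have c1 : ContinuousOn (fun t => Real.exp (lam * t) * A t) (Icc 0 T) := hec.continuousOn.mul hAc
  have c2 : ContinuousOn (fun t => ε * (Real.exp (lam * t) * B t)) (Icc 0 T) :=
    continuousOn_const.mul (hec.continuousOn.mul hBc)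
  have c3 : ContinuousOn (fun t => Real.exp (lam * t) * G t) (Icc 0 T) := hec.continuousOn.mul hGc
  have c4 : ContinuousOn (fun t => Real.exp (lam * t) * (C * (δ + ε) * v)) (Icc 0 T) :=
    hec.continuousOn.mul continuousOn_const
  -- Integrating factor `e^{lam t}`. The energy is differentiable only on the open interval and
  -- merely continuous at `0` and `T`, hence this form of the fundamental theorem.
  have hmain := intervalIntegral.sub_le_integral_of_hasDeriv_right_of_le (a := 0) (b := T)
    (g := fun t => Real.exp (lam * t) * V t)
    (g' := fun t => Real.exp (lam * t) * lam * V t + Real.exp (lam * t) * V' t)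
    (φ := fun t => Real.exp (lam * t) * A t + ε * (Real.exp (lam * t) * B t)
      + Real.exp (lam * t) * G t + Real.exp (lam * t) * (C * (δ + ε) * v)) hT.le
    (hec.continuousOn.mul hVc)
    (fun t ht => by
      have he : HasDerivAt (fun t : ℝ => Real.exp (lam * t)) (Real.exp (lam * t) * lam) t := by
        have := ((hasDerivAt_id t).const_mul lam).exp
        simpa using this
      exact (he.mul (hV' t ht)).hasDerivWithinAt)
    ((((c1.add c2).add c3).add c4).integrableOn_Icc)
    (fun t ht => by
      have := mul_le_mul_of_nonneg_left (hV'le t ht) (Real.exp_pos (lam * t)).le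
      linarith)
  have u1 := c1.intervalIntegrable_of_Icc (μ := volume) hT.le
  have u2 := c2.intervalIntegrable_of_Icc (μ := volume) hT.le
  have u3 := c3.intervalIntegrable_of_Icc (μ := volume) hT.le
  have u4 := c4.intervalIntegrable_of_Icc (μ := volume) hT.le
  rw [intervalIntegral.integral_add ((u1.add u2).add u3) u4,
    intervalIntegral.integral_add (u1.add u2) u3, intervalIntegral.integral_add u1 u2,
    intervalIntegral.integral_const_mul, intervalIntegral.integral_mul_const, ← hJ] at hmain
  have f1 : ∫ t in (0 : ℝ)..T, Real.exp (lam * t) * A t =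
      ∫ x in Ω, (∫ t in (0 : ℝ)..T, Real.exp (lam * t) * (S.a x t * |w x t|)) * layer P δ x := by
    rw [← integral_time_integral_mul (f := fun x t => Real.exp (lam * t) * (S.a x t * |w x t|))
      hK hν hT.le (hexpc.mul hawc) hlayI]
    simp only [hA, mul_assoc, integral_const_mul]
  have f2 : ∫ t in (0 : ℝ)..T, Real.exp (lam * t) * B t =
      ∫ x in Ω, (∫ t in (0 : ℝ)..T, Real.exp (lam * t) * S.a x t) * layer P δ x := by
    rw [← integral_time_integral_mul (f := fun x t => Real.exp (lam * t) * S.a x t)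
      hK hν hT.le (hexpc.mul hac) hlayI]
    simp only [hB, mul_assoc, integral_const_mul]
  rw [f1, f2] at hmain
  simp only [mul_zero, Real.exp_zero, one_mul] at hmain
  simp only [hV, hG] at hmain ⊢
  linarith

end IsEnergyWeight

end ParabolicISS

namespace ParabolicISS

/-! ### Passage to the limit in the regularised energy inequality -/

theorem le_of_eventually_le_add_mul {a b c : ℝ} (h : ∀ᶠ ε in 𝓝[>] (0 : ℝ), a ≤ b + ε * c) :
    a ≤ b := by
  have h1 : Tendsto (fun ε : ℝ => b + ε * c) (𝓝[>] 0) (𝓝 b) := by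
    have : Tendsto (fun ε : ℝ => b + ε * c) (𝓝 0) (𝓝 (b + 0 * c)) :=
      (Continuous.tendsto (by fun_prop) 0)
    rw [zero_mul, add_zero] at this
    exact this.mono_left nhdsWithin_le_nhds
  exact ge_of_tendsto h1 h

section Param

variable {n : ℕ} {K : Set (EuclideanSpace ℝ (Fin n))} {ν : Measure (EuclideanSpace ℝ (Fin n))}
  {f : EuclideanSpace ℝ (Fin n) → ℝ → ℝ} {L : EuclideanSpace ℝ (Fin n) → ℝ} {T : ℝ}

theorem integrable_slice_mul (hK : IsCompact K) (hν : ∀ᵐ x ∂ν, x ∈ K)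
    (hf : ContinuousOn (fun z : EuclideanSpace ℝ (Fin n) × ℝ => f z.1 z.2) (K ×ˢ Icc 0 T))
    (hL : Integrable L ν) {t : ℝ} (ht : t ∈ Icc 0 T) : Integrable (fun x => f x t * L x) ν := by
  obtain ⟨C, hC⟩ := (hK.prod isCompact_Icc).exists_bound_of_continuousOn hf
  refine hL.bdd_mul (c := C) (aestronglyMeasurable_of_ae_mem hK hν
    (continuousOn_slice_space hf ht)) ?_
  filter_upwards [hν] with x hx
  exact hC (x, t) ⟨hx, ht⟩

theorem ofReal_integral_slice_mul (hK : IsCompact K) (hν : ∀ᵐ x ∂ν, x ∈ K)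
    (hf : ContinuousOn (fun z : EuclideanSpace ℝ (Fin n) × ℝ => f z.1 z.2) (K ×ˢ Icc 0 T))
    (hf0 : ∀ x ∈ K, ∀ t ∈ Icc 0 T, 0 ≤ f x t) (hL : Integrable L ν) (hL0 : ∀ x ∈ K, 0 ≤ L x)
    {t : ℝ} (ht : t ∈ Icc 0 T) :
    ENNReal.ofReal (∫ x, f x t * L x ∂ν) = ∫⁻ x, ENNReal.ofReal (f x t * L x) ∂ν := by
  refine ofReal_integral_eq_lintegral_ofReal (integrable_slice_mul hK hν hf hL ht) ?_
  filter_upwards [hν] with x hx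
  exact mul_nonneg (hf0 x hx t ht) (hL0 x hx)

theorem ofReal_integral_time_mul (hT : 0 ≤ T) (hK : IsCompact K) (hν : ∀ᵐ x ∂ν, x ∈ K)
    (hf : ContinuousOn (fun z : EuclideanSpace ℝ (Fin n) × ℝ => f z.1 z.2) (K ×ˢ Icc 0 T))
    (hf0 : ∀ x ∈ K, ∀ t ∈ Icc 0 T, 0 ≤ f x t) (hL : Integrable L ν) (hL0 : ∀ x ∈ K, 0 ≤ L x)
    (lam : ℝ) :
    ENNReal.ofReal (∫ t in (0 : ℝ)..T, Real.exp (lam * t) * ∫ x, f x t * L x ∂ν) =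
      ∫⁻ t in Ioo 0 T, ENNReal.ofReal (Real.exp (lam * t)) *
        ∫⁻ x, ENNReal.ofReal (f x t * L x) ∂ν := by
  have hc := continuousOn_integral_mul hK hν hf hL
  have hec : Continuous fun t : ℝ => Real.exp (lam * t) := by fun_prop
  have hg : IntegrableOn (fun t => Real.exp (lam * t) * ∫ x, f x t * L x ∂ν) (Ioo 0 T) :=
    (hec.continuousOn.mul hc).integrableOn_Icc.mono_set Ioo_subset_Icc_self
  rw [intervalIntegral.integral_of_le hT, integral_Ioc_eq_integral_Ioo,
    ofReal_integral_eq_lintegral_ofReal hg]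
  · refine setLIntegral_congr_fun measurableSet_Ioo fun t ht => ?_
    rw [ENNReal.ofReal_mul (Real.exp_pos _).le,
      ofReal_integral_slice_mul hK hν hf hf0 hL hL0 (Ioo_subset_Icc_self ht)]
  · filter_upwards [ae_restrict_mem measurableSet_Ioo] with t ht
    refine mul_nonneg (Real.exp_pos _).le (integral_nonneg_of_ae ?_)
    filter_upwards [hν] with x hx
    exact mul_nonneg (hf0 x hx t (Ioo_subset_Icc_self ht)) (hL0 x hx)

end Param

variable {m : ℕ} {Ω : Set (EuclideanSpace ℝ (Fin (m + 1)))} {S : Coefficients (m + 1)}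
  {μ : EuclideanSpace ℝ (Fin (m + 1)) → ℝ → ℝ} {P : EuclideanSpace ℝ (Fin (m + 1)) → ℝ} {lam : ℝ}
  {I : Inputs (m + 1)} {T : ℝ} {w : EuclideanSpace ℝ (Fin (m + 1)) → ℝ → ℝ}

namespace IsEnergyWeight

/-- The weighted `L¹`-estimate with real-valued integrals. -/
theorem exp_mul_integral_le (hE : IsEnergyWeight S Ω μ P lam) (hΩ : IsC2Domain Ω)
    (hS : S.Regular Ω) {alo ahi clo : ℝ} (h1 : S.Assumption1 Ω alo ahi)
    (h2 : S.Assumption2 Ω μ clo) (hI : I.Regular Ω) (hT : 0 < T)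
    (hw : S.IsClassicalSolution Ω I T w) :
    Real.exp (lam * T) * (∫ x in Ω, |w x T| * P x) ≤ (∫ x in Ω, |w x 0| * P x)
      + (∫ t in (0 : ℝ)..T, Real.exp (lam * t) *
          ∫ x, S.a x t * |w x t| * ‖gradientWithin P (closure Ω) x‖ ∂(surfaceMeasure Ω))
      + (∫ t in (0 : ℝ)..T, Real.exp (lam * t) * ∫ x in Ω, |I.f x t| * P x) := by
  have hP := hE.weight
  have hΩo := hΩ.isOpen
  have hK := hΩ.isCompact_closure
  have hσ := hΩ.isFiniteMeasure_surfaceMeasure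
  have hνσ : ∀ᵐ x ∂(surfaceMeasure Ω), x ∈ closure Ω := by
    filter_upwards [ae_mem_frontier Ω] with x hx using frontier_subset_closure hx
  have hsubT : closure Ω ×ˢ Icc 0 T ⊆ closure Ω ×ˢ Ici (0 : ℝ) :=
    prod_mono_right Icc_subset_Ici_self
  have h0T : (0 : ℝ) ∈ Icc 0 T := ⟨le_rfl, hT.le⟩
  have hTT : T ∈ Icc 0 T := ⟨hT.le, le_rfl⟩
  obtain ⟨C, hC0, hC⟩ := hE.truncEnergy_le hΩ hS h1 h2 hI hT hw
  obtain ⟨M, hM0, hM⟩ := hE.exists_laplacian_bound hΩ hS h1 h2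
  set F : EuclideanSpace ℝ (Fin (m + 1)) → ℝ :=
    fun x => ∫ t in (0 : ℝ)..T, Real.exp (lam * t) * (S.a x t * |w x t|) with hF
  set N : EuclideanSpace ℝ (Fin (m + 1)) → ℝ := fun x => ‖gradientWithin P (closure Ω) x‖ with hN
  have hNc : ContinuousOn N (closure Ω) := (hΩ.continuousOn_gradientWithin hP.contDiffOn_closure).norm
  have hac : ContinuousOn (fun z : EuclideanSpace ℝ (Fin (m + 1)) × ℝ => S.a z.1 z.2)
      (closure Ω ×ˢ Icc 0 T) := hS.a.continuousOn.mono hsubT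
  have hFc' : ContinuousOn (fun z : EuclideanSpace ℝ (Fin (m + 1)) × ℝ =>
      Real.exp (lam * z.2) * (S.a z.1 z.2 * |w z.1 z.2|)) (closure Ω ×ˢ Icc 0 T) := by
    refine ContinuousOn.mul (by fun_prop) (hac.mul hw.cont.abs)
  have hFc : ContinuousOn F (closure Ω) := continuousOn_integral_time
    (f := fun x t => Real.exp (lam * t) * (S.a x t * |w x t|)) hK hT.le hFc'
  have ha0 : ∀ x ∈ closure Ω, ∀ t ∈ Icc 0 T, 0 ≤ S.a x t := fun x hx t ht =>
    h1.alo_pos.le.trans (h1.a_bounds x hx t ht.1).1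
  have hF0 : ∀ x ∈ closure Ω, 0 ≤ F x := fun x hx => intervalIntegral.integral_nonneg hT.le
    fun t ht => mul_nonneg (Real.exp_pos _).le (mul_nonneg (ha0 x hx t ht) (abs_nonneg _))
  have hJ : ∫ x, F x * N x ∂(surfaceMeasure Ω) = ∫ t in (0 : ℝ)..T, Real.exp (lam * t) *
      ∫ x, S.a x t * |w x t| * N x ∂(surfaceMeasure Ω) := by
    rw [← integral_time_integral_mul (f := fun x t => Real.exp (lam * t) * (S.a x t * |w x t|))
      hK hνσ hT.le hFc' (hΩ.integrable_surfaceMeasure hNc)]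
    simp only [mul_assoc, integral_const_mul]
  rw [← hJ]
  have hPc := hP.continuousOn
  have hwT : ContinuousOn (fun x => w x T) (closure Ω) := continuousOn_slice_space hw.cont hTT
  have hw0 : ContinuousOn (fun x => w x 0) (closure Ω) := continuousOn_slice_space hw.cont h0T
  have hb := hΩ.isBounded
  set W := ∫ x in Ω, |w x T| with hW
  have iP : Integrable P (volume.restrict Ω) := integrableOn_of_closure hb hPc
  have iT : Integrable (fun x => |w x T|) (volume.restrict Ω) :=
    integrableOn_of_closure hb hwT.abs
  have iTP : Integrable (fun x => |w x T| * P x) (volume.restrict Ω) :=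
    integrableOn_of_closure hb (hwT.abs.mul hPc)
  have i0P : Integrable (fun x => |w x 0| * P x) (volume.restrict Ω) :=
    integrableOn_of_closure hb (hw0.abs.mul hPc)
  have hV0 : ∀ δ ε, 0 < ε →
      ∫ x in Ω, trunc δ (P x) * absReg ε (w x 0) ≤
        (∫ x in Ω, |w x 0| * P x) + ε * ∫ x in Ω, P x := by
    intro δ ε hε
    rw [← integral_const_mul, ← integral_add i0P (iP.const_mul ε)]
    refine setIntegral_mono_on (integrableOn_of_closure hb ((hP.continuousOn_trunc δ).mul
      ((contDiff_absReg hε).continuous.comp_continuousOn hw0)))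
      (i0P.add (iP.const_mul ε)) hΩo.measurableSet fun x hx => ?_
    have hx0 := hP.nonneg x hx
    calc trunc δ (P x) * absReg ε (w x 0) ≤ P x * (|w x 0| + ε) :=
          mul_le_mul (trunc_le δ hx0) (absReg_le hε _) (absReg_nonneg _ _) hx0
      _ = _ := by ring
  have hVT : ∀ δ ε, 0 < δ → 0 < ε →
      (∫ x in Ω, |w x T| * P x) - δ * (2 * W) ≤
        ∫ x in Ω, trunc δ (P x) * absReg ε (w x T) := by
    intro δ ε hδ hε
    rw [hW, ← mul_assoc, ← integral_const_mul,
      ← integral_sub iTP (iT.const_mul _)]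
    refine setIntegral_mono_on (iTP.sub (iT.const_mul _))
      (integrableOn_of_closure hb ((hP.continuousOn_trunc δ).mul
      ((contDiff_absReg hε).continuous.comp_continuousOn hwT))) hΩo.measurableSet fun x hx => ?_
    have hx0 := hP.nonneg x hx
    calc |w x T| * P x - δ * 2 * |w x T| = (P x - 2 * δ) * |w x T| := by ring
      _ ≤ trunc δ (P x) * |w x T| :=
          mul_le_mul_of_nonneg_right (sub_le_trunc hδ hx0) (abs_nonneg _)
      _ ≤ _ := mul_le_mul_of_nonneg_left (abs_le_absReg _ _) (trunc_nonneg δ hx0)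
  have hexp := Real.exp_pos (lam * T)
  refine le_of_forall_pos_le_add fun η hη => ?_
  -- The order of limits is `ε → 0` for fixed `δ`, then `δ → 0`, then `η → 0`. Thus the term `ε ∫
  -- (…) layer P δ` disappears without a bound on the layer uniform in `δ`.
  refine le_of_eventually_le_add_mul (c := C + Real.exp (lam * T) * (2 * W)) ?_
  filter_upwards [hP.eventually_integral_layer_le hΩ hM0 hM hNc
    (fun x hx => by rw [hN]; simp only; rw [hΩ.gradientWithin_eq P hx])
    (fun x _ => norm_nonneg _) hFc hF0 hη, self_mem_nhdsWithin] with δ hδL hδ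
  have hδ : 0 < δ := hδ
  refine le_of_eventually_le_add_mul (c := (∫ x in Ω, (∫ t in (0 : ℝ)..T,
    Real.exp (lam * t) * S.a x t) * layer P δ x) + C + ∫ x in Ω, P x) ?_
  filter_upwards [Ioc_mem_nhdsGT zero_lt_one] with ε hε
  have k1 := hC δ ε hδ hε.1 hε.2
  have k2 := hV0 δ ε hε.1
  have k3 := mul_le_mul_of_nonneg_left (hVT δ ε hδ hε.1) hexp.le
  linarith

/-- The weighted `L¹`-estimate with lower Lebesgue integrals. -/
theorem exp_mul_lintegral_le (hE : IsEnergyWeight S Ω μ P lam) (hΩ : IsC2Domain Ω)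
    (hS : S.Regular Ω) {alo ahi clo : ℝ} (h1 : S.Assumption1 Ω alo ahi)
    (h2 : S.Assumption2 Ω μ clo) (hI : I.Regular Ω) (hT : 0 < T)
    (hw : S.IsClassicalSolution Ω I T w) :
    ENNReal.ofReal (Real.exp (lam * T)) * (∫⁻ x in Ω, ENNReal.ofReal (|w x T| * P x)) ≤
      (∫⁻ x in Ω, ENNReal.ofReal (|I.w₀ x| * P x))
      + (∫⁻ t in Ioo 0 T, ENNReal.ofReal (Real.exp (lam * t)) *
          ∫⁻ x, ENNReal.ofReal (S.a x t * |w x t| * ‖gradientWithin P (closure Ω) x‖)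
            ∂(surfaceMeasure Ω))
      + (∫⁻ t in Ioo 0 T, ENNReal.ofReal (Real.exp (lam * t)) *
          ∫⁻ x in Ω, ENNReal.ofReal (|I.f x t| * P x)) := by
  have hP := hE.weight
  have hK := hΩ.isCompact_closure
  have hν : ∀ᵐ x ∂(volume.restrict Ω), x ∈ closure Ω := by
    filter_upwards [ae_restrict_mem hΩ.isOpen.measurableSet] with x hx using subset_closure hx
  have hνσ : ∀ᵐ x ∂(surfaceMeasure Ω), x ∈ closure Ω := by
    filter_upwards [ae_mem_frontier Ω] with x hx using frontier_subset_closure hx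
  have hsubT : closure Ω ×ˢ Icc 0 T ⊆ closure Ω ×ˢ Ici (0 : ℝ) :=
    prod_mono_right Icc_subset_Ici_self
  have hPI : Integrable P (volume.restrict Ω) :=
    integrableOn_of_closure hΩ.isBounded hP.continuousOn
  have hP0 : ∀ x ∈ closure Ω, 0 ≤ P x := fun x hx => hP.nonneg_closure hΩ hx
  have hwa : ∀ x ∈ closure Ω, ∀ t ∈ Icc 0 T, 0 ≤ |w x t| := fun _ _ _ _ => abs_nonneg _
  have hNI := hΩ.integrable_surfaceMeasure
    (hΩ.continuousOn_gradientWithin hP.contDiffOn_closure).norm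
  rw [← ofReal_integral_slice_mul (f := fun x t => |w x t|) hK hν hw.cont.abs hwa hPI hP0
      ⟨hT.le, le_rfl⟩,
    ← ofReal_integral_time_mul (f := fun x t => S.a x t * |w x t|) hT.le hK hνσ
      ((hS.a.continuousOn.mono hsubT).mul hw.cont.abs)
      (fun x hx t ht => mul_nonneg (h1.alo_pos.le.trans (h1.a_bounds x hx t ht.1).1) (abs_nonneg _))
      hNI (fun _ _ => norm_nonneg _),
    ← ofReal_integral_time_mul (f := fun x t => |I.f x t|) hT.le hK hν
      (hI.f.continuousOn.mono hsubT).abs (fun _ _ _ _ => abs_nonneg _) hPI hP0,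
    ← ENNReal.ofReal_mul (Real.exp_pos _).le]
  have h0 : ∫⁻ x in Ω, ENNReal.ofReal (|I.w₀ x| * P x) =
      ENNReal.ofReal (∫ x in Ω, |w x 0| * P x) := by
    rw [ofReal_integral_slice_mul (f := fun x t => |w x t|) hK hν hw.cont.abs hwa hPI hP0
      ⟨le_rfl, hT.le⟩]
    refine setLIntegral_congr_fun hΩ.isOpen.measurableSet fun x hx => ?_
    simp only [hw.initial x hx]
  rw [h0]
  refine (ENNReal.ofReal_le_ofReal (hE.exp_mul_integral_le hΩ hS h1 h2 hI hT hw)).trans ?_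
  refine ENNReal.ofReal_add_le.trans ?_
  gcongr
  exact ENNReal.ofReal_add_le

end IsEnergyWeight

end ParabolicISS

namespace ParabolicISS

/-! ### Hölder's inequality with exponential weights -/

/-- Enlarging the interval to `(-∞, T]` gives an exact integral and a bound free of `1 - e^{-cT}`.
-/
theorem lintegral_exp_mul_le {c : ℝ} (hc : 0 < c) (T : ℝ) :
    ∫⁻ t in Ioo 0 T, ENNReal.ofReal (Real.exp (c * t)) ≤
      ENNReal.ofReal (Real.exp (c * T)) * (ENNReal.ofReal c)⁻¹ := by
  calc ∫⁻ t in Ioo 0 T, ENNReal.ofReal (Real.exp (c * t))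
      ≤ ∫⁻ t in Iic T, ENNReal.ofReal (Real.exp (c * t)) :=
        lintegral_mono_set fun t ht => ht.2.le
    _ = ENNReal.ofReal (∫ t in Iic T, Real.exp (c * t)) :=
        (ofReal_integral_eq_lintegral_ofReal (integrableOn_exp_mul_Iic hc T)
          (ae_of_all _ fun t => (Real.exp_pos _).le)).symm
    _ = _ := by
        rw [integral_exp_mul_Iic hc, ENNReal.ofReal_div_of_pos hc, div_eq_mul_inv]

theorem lintegral_exp_mul_le_one_norm {lam T : ℝ} (hlam : 0 ≤ lam) (u : ℝ → ℝ≥0∞) :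
    ∫⁻ t in Ioo 0 T, ENNReal.ofReal (Real.exp (lam * t)) * u t ≤
      ENNReal.ofReal (Real.exp (lam * T)) * eLpNorm u 1 (volume.restrict (Ioo 0 T)) := by
  rw [eLpNorm_one_eq_lintegral_enorm, ← lintegral_const_mul' _ _ ENNReal.ofReal_ne_top]
  refine setLIntegral_mono_ae' measurableSet_Ioo (ae_of_all _ fun t ht => ?_)
  have := ht.2.le
  simp only [enorm_eq_self]
  gcongr

/-- Hölder with the exponential in `L^{q'}`, whose norm on `(0,T)` is at most `e^{lam T} (lam
q')^{-1/q'}`. The endpoints `q = 1` and `q = ∞` are separate because real exponents are unavailable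
there; for `q' = ∞` the constant is `0 ^ 0 = 1`. -/
theorem lintegral_exp_mul_le_holder {lam T : ℝ} (hlam : 0 < lam) {q q' : ℝ≥0∞}
    (hq : ENNReal.HolderConjugate q q') {u : ℝ → ℝ≥0∞}
    (hu : AEMeasurable u (volume.restrict (Ioo 0 T))) :
    ∫⁻ t in Ioo 0 T, ENNReal.ofReal (Real.exp (lam * t)) * u t ≤
      ENNReal.ofReal (Real.exp (lam * T)) *
        (holderConst lam q' * eLpNorm u q (volume.restrict (Ioo 0 T))) := by
  have hqq := hq.inv_add_inv_eq_one
  by_cases h1 : q = 1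
  · subst h1
    have hq' : q' = ∞ := by
      have h : (1 : ℝ≥0∞) + q'⁻¹ = 1 + 0 := by simpa using hqq
      exact ENNReal.inv_eq_zero.1 ((ENNReal.add_right_inj ENNReal.one_ne_top).1 h)
    have : holderConst lam q' = 1 := by simp [holderConst, hq']
    rw [this, one_mul]
    exact lintegral_exp_mul_le_one_norm hlam.le u
  by_cases h2 : q = ∞
  · subst h2
    have hq' : q' = 1 := by simpa using hqq
    have : holderConst lam q' = (ENNReal.ofReal lam)⁻¹ := by simp [holderConst, hq']
    rw [this, eLpNorm_exponent_top, ← mul_assoc]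
    calc ∫⁻ t in Ioo 0 T, ENNReal.ofReal (Real.exp (lam * t)) * u t
        ≤ ∫⁻ t in Ioo 0 T, ENNReal.ofReal (Real.exp (lam * t)) *
            eLpNormEssSup u (volume.restrict (Ioo 0 T)) := by
          refine lintegral_mono_ae ?_
          filter_upwards [enorm_ae_le_eLpNormEssSup u (volume.restrict (Ioo 0 T))] with t ht
          rw [enorm_eq_self] at ht
          gcongr
      _ = (∫⁻ t in Ioo 0 T, ENNReal.ofReal (Real.exp (lam * t))) *
            eLpNormEssSup u (volume.restrict (Ioo 0 T)) :=
          lintegral_mul_const _ (by fun_prop)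
      _ ≤ _ := by
          gcongr
          exact lintegral_exp_mul_le hlam T
  have hq1 : 1 < q := lt_of_le_of_ne hq.one_le (Ne.symm h1)
  have hq1r : 1 < q.toReal := by
    rw [← ENNReal.toReal_one]
    exact (ENNReal.toReal_lt_toReal ENNReal.one_ne_top h2).2 hq1
  have hr : q.toReal.HolderConjugate q'.toReal := ENNReal.HolderConjugate.toReal hq1r
  have hr' := hr.symm.pos
  have hq'top : q' ≠ ∞ := by
    rintro rfl
    simp at hr'
  have hq0 : q ≠ 0 := (zero_lt_one.trans hq1).ne'
  have hh := ENNReal.lintegral_mul_le_Lp_mul_Lq (volume.restrict (Ioo 0 T)) hr.symm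
    (f := fun t => ENNReal.ofReal (Real.exp (lam * t))) (g := u)
    (Measurable.aemeasurable (by fun_prop)) hu
  simp only [Pi.mul_apply] at hh
  refine hh.trans ?_
  rw [eLpNorm_eq_lintegral_rpow_enorm_toReal hq0 h2, ← mul_assoc]
  simp only [enorm_eq_self]
  gcongr
  have e1 : ∀ t : ℝ, ENNReal.ofReal (Real.exp (lam * t)) ^ q'.toReal =
      ENNReal.ofReal (Real.exp ((lam * q'.toReal) * t)) := fun t => by
    rw [ENNReal.ofReal_rpow_of_pos (Real.exp_pos _), ← Real.exp_mul]
    ring_nf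
  simp only [e1]
  calc (∫⁻ t in Ioo 0 T, ENNReal.ofReal (Real.exp (lam * q'.toReal * t))) ^ (1 / q'.toReal)
      ≤ (ENNReal.ofReal (Real.exp (lam * q'.toReal * T)) *
          (ENNReal.ofReal (lam * q'.toReal))⁻¹) ^ (1 / q'.toReal) := by
        gcongr
        exact lintegral_exp_mul_le (by positivity) T
    _ = _ := by
        rw [ENNReal.mul_rpow_of_nonneg _ _ (by positivity),
          ENNReal.ofReal_rpow_of_pos (Real.exp_pos _), ← Real.exp_mul, holderConst,
          ENNReal.ofReal_mul hlam.le, ENNReal.ofReal_toReal hq'top, ENNReal.toReal_inv, one_div]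
        have : lam * q'.toReal * T * q'.toReal⁻¹ = lam * T := by field_simp
        rw [this]

end ParabolicISS

namespace ParabolicISS

/-! ### The elliptic operator on products with a function of one coordinate -/

section Coordinate

variable {n : ℕ} {j : Fin n} {φ φ₁ φ₂ : ℝ → ℝ} {a p : EuclideanSpace ℝ (Fin n) → ℝ}
  {x : EuclideanSpace ℝ (Fin n)}

theorem divg_add {X Y : EuclideanSpace ℝ (Fin n) → EuclideanSpace ℝ (Fin n)}
    (hX : DifferentiableAt ℝ X x) (hY : DifferentiableAt ℝ Y x) :
    divg (fun y => X y + Y y) x = divg X x + divg Y x := by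
  unfold divg
  rw [← Finset.sum_add_distrib, fderiv_fun_add hX hY]
  simp

theorem hasGradientAt_coord (j : Fin n) (x : EuclideanSpace ℝ (Fin n)) :
    HasGradientAt (fun y : EuclideanSpace ℝ (Fin n) => y j) (EuclideanSpace.single j (1 : ℝ)) x := by
  rw [hasGradientAt_iff_hasFDerivAt]
  refine (EuclideanSpace.proj (𝕜 := ℝ) j).hasFDerivAt.congr_fderiv ?_
  ext v
  simp [EuclideanSpace.inner_single_left]

theorem hasGradientAt_comp_coord (h1 : ∀ s, HasDerivAt φ (φ₁ s) s) (x : EuclideanSpace ℝ (Fin n)) :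
    HasGradientAt (fun y : EuclideanSpace ℝ (Fin n) => φ (y j))
      (φ₁ (x j) • EuclideanSpace.single j (1 : ℝ)) x :=
  hasGradientAt_comp (h1 _) (hasGradientAt_coord j x)

theorem divg_smul_single {u : EuclideanSpace ℝ (Fin n) → ℝ} (hu : DifferentiableAt ℝ u x) :
    divg (fun y => u y • EuclideanSpace.single j (1 : ℝ)) x = (gradient u x) j := by
  rw [divg_smul hu (differentiableAt_const _)]
  rw [inner_gradient_apply, gradient_coord]
  simp [divg]

/-- The action of the elliptic operator on a product with a function of one coordinate. -/
theorem elliptic_mul_comp_coord {b : EuclideanSpace ℝ (Fin n)} (ha : DifferentiableAt ℝ a x)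
    (hp : ∀ᶠ y in 𝓝 x, DifferentiableAt ℝ p y) (hgp : DifferentiableAt ℝ (gradient p) x)
    (h1 : ∀ s, HasDerivAt φ (φ₁ s) s) (h2 : ∀ s, HasDerivAt φ₁ (φ₂ s) s) :
    divg (fun y => a y • gradient (fun z => p z * φ (z j)) y) x
        + inner ℝ b (gradient (fun z => p z * φ (z j)) x) =
      φ (x j) * (divg (fun y => a y • gradient p y) x + inner ℝ b (gradient p x))
        + 2 * a x * φ₁ (x j) * (gradient p x) j
        + p x * ((b j + (gradient a x) j) * φ₁ (x j) + a x * φ₂ (x j)) := by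
  have hg : ∀ᶠ y in 𝓝 x, gradient (fun z => p z * φ (z j)) y =
      φ (y j) • gradient p y + (p y * φ₁ (y j)) • EuclideanSpace.single j (1 : ℝ) := by
    filter_upwards [hp] with y hy
    rw [(hasGradientAt_mul hy.hasGradientAt (hasGradientAt_comp_coord h1 y)).gradient, smul_smul]
    abel
  have hpx := hp.self_of_nhds
  have g1 := hasGradientAt_comp_coord (j := j) h1 x
  have g2 := hasGradientAt_comp_coord (j := j) h2 x
  have gq := hasGradientAt_mul ha.hasGradientAt (hasGradientAt_mul hpx.hasGradientAt g2)
  have d1 := g1.differentiableAt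
  have d2 := g2.differentiableAt
  have e : (fun y => a y • gradient (fun z => p z * φ (z j)) y) =ᶠ[𝓝 x]
      fun y => φ (y j) • (a y • gradient p y)
        + (a y * (p y * φ₁ (y j))) • EuclideanSpace.single j (1 : ℝ) := by
    filter_upwards [hg] with y hy
    rw [hy, smul_add, smul_comm, smul_smul, smul_smul]
  have hX1 : DifferentiableAt ℝ (fun y => a y • gradient p y) x := ha.smul hgp
  have hX : DifferentiableAt ℝ (fun y => φ (y j) • (a y • gradient p y)) x := d1.smul hX1
  have hY : DifferentiableAt ℝ (fun y => (a y * (p y * φ₁ (y j))) •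
      EuclideanSpace.single j (1 : ℝ)) x := gq.differentiableAt.smul (differentiableAt_const _)
  rw [divg_congr e, hg.self_of_nhds, divg_add hX hY, divg_smul d1 hX1,
    divg_smul_single gq.differentiableAt, g1.gradient, gq.gradient]
  simp [inner_add_right, inner_smul_right, EuclideanSpace.inner_single_right, gradient_coord]
  ring

end Coordinate

end ParabolicISS

namespace ParabolicISS

/-! ### The weak maximum principle for the weight -/

/-- The Laplacian is a sum of second derivatives along coordinate lines, and each of them is
nonnegative at a minimum. -/
theorem divg_gradient_nonneg {n : ℕ} {v : EuclideanSpace ℝ (Fin n) → ℝ}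
    {x : EuclideanSpace ℝ (Fin n)} (hv : ∀ᶠ y in 𝓝 x, DifferentiableAt ℝ v y)
    (hg : DifferentiableAt ℝ (gradient v) x) (hmin : IsLocalMin v x) :
    0 ≤ divg (gradient v) x := by
  refine Finset.sum_nonneg fun i _ => ?_
  by_contra! hneg
  set e : EuclideanSpace ℝ (Fin n) := EuclideanSpace.single i 1 with he
  have hline : ∀ s, HasDerivAt (fun s : ℝ => x + s • e) e s := fun s => by
    simpa using ((hasDerivAt_id s).smul_const e).const_add x
  have hlt : Tendsto (fun s : ℝ => x + s • e) (𝓝 0) (𝓝 x) := by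
    have : Continuous fun s : ℝ => x + s • e := by fun_prop
    simpa using this.tendsto 0
  set f : ℝ → ℝ := fun s => v (x + s • e) with hf
  have hfd : ∀ᶠ s in 𝓝 (0 : ℝ), HasDerivAt f ((gradient v (x + s • e)) i) s := by
    filter_upwards [hlt.eventually hv] with s hs
    rw [gradient_coord]
    exact hs.hasFDerivAt.comp_hasDerivAt s (hline s)
  have hfmin : IsLocalMin f 0 := by
    filter_upwards [hlt.eventually hmin] with s hs
    simpa [hf] using hs
  have hderiv : deriv f =ᶠ[𝓝 0] fun s => (gradient v (x + s • e)) i := by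
    filter_upwards [hfd] with s hs using hs.deriv
  have hx0 : x + (0 : ℝ) • e = x := by simp
  have hg' : HasDerivAt (fun s : ℝ => (gradient v (x + s • e)) i)
      ((fderiv ℝ (gradient v) x e) i) 0 := by
    have h1 : HasFDerivAt (gradient v) (fderiv ℝ (gradient v) x) (x + (0 : ℝ) • e) := by
      rw [hx0]; exact hg.hasFDerivAt
    have h2 : HasDerivAt (fun s : ℝ => gradient v (x + s • e)) (fderiv ℝ (gradient v) x e) 0 :=
      h1.comp_hasDerivAt_of_eq (0 : ℝ) (hline 0) rfl
    exact (EuclideanSpace.proj (𝕜 := ℝ) i).hasFDerivAt.comp_hasDerivAt (0 : ℝ) h2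
  have h2 : deriv (deriv f) 0 < 0 := by
    rw [hderiv.deriv_eq, hg'.deriv]
    exact hneg
  -- A negative second derivative makes the minimum a maximum as well, so `f` is locally constant,
  -- contradicting `f'' < 0`.
  have hmax := isLocalMax_of_deriv_deriv_neg h2 hfmin.deriv_eq_zero
    hfd.self_of_nhds.continuousAt
  have hconst : f =ᶠ[𝓝 0] fun _ => f 0 := by
    filter_upwards [hfmin, hmax] with s h3 h4 using le_antisymm h4 h3
  have : deriv f =ᶠ[𝓝 0] fun _ => 0 := by
    filter_upwards [hconst.eventuallyEq_nhds] with s hs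
    rw [hs.deriv_eq, deriv_const]
  rw [this.deriv_eq, deriv_const] at h2
  exact lt_irrefl _ h2

variable {m : ℕ} {Ω : Set (EuclideanSpace ℝ (Fin (m + 1)))} {S : Coefficients (m + 1)}
  {p : EuclideanSpace ℝ (Fin (m + 1)) → ℝ} {p₀ : ℝ}
  {ψ₁ : EuclideanSpace ℝ (Fin (m + 1)) → ℝ → ℝ} {ψ₂ : ℝ → ℝ}

/-- The weight is nonnegative. -/
theorem Coefficients.Assumption3'.nonneg (h3 : S.Assumption3' Ω p p₀ ψ₁ ψ₂) (hΩ : IsC2Domain Ω)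
    (hS : S.Regular Ω) {alo ahi : ℝ} (h1 : S.Assumption1 Ω alo ahi) :
    ∀ x ∈ Ω, 0 ≤ p x := by
  have hΩo := hΩ.isOpen
  have halo := h1.alo_pos
  obtain ⟨bb, hbb0, hbb⟩ := hΩ.exists_bound (T := 1) (hS.b.continuousOn.mono
    (prod_mono_right Icc_subset_Ici_self))
  obtain ⟨ad, had0, had⟩ := hΩ.exists_bound_fderiv hS.a 1
  -- So large that `a κ` exceeds `|b| + |∇a|`; then the elliptic operator is positive on `e^{κ y₀}`,
  -- making `p - ε e^{κ y₀}` a strict supersolution.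
  set κ := (ad + bb + 1) / alo with hκ
  have hκ0 : 0 < κ := by positivity
  have hκa : alo * κ = ad + bb + 1 := by rw [hκ]; field_simp
  obtain ⟨B, hB⟩ := hΩ.isCompact_closure.exists_bound_of_continuousOn
    (f := fun y : EuclideanSpace ℝ (Fin (m + 1)) => Real.exp (κ * y 0)) (by fun_prop)
  intro x hx
  refine le_of_eventually_le_add_mul (c := B) ?_
  filter_upwards [self_mem_nhdsWithin] with ε hε
  have hε : 0 < ε := hε
  have he1 : ∀ s : ℝ, HasDerivAt (fun s => ε * Real.exp (κ * s)) (ε * (κ * Real.exp (κ * s))) s :=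
    fun s => by
      have := (((hasDerivAt_id s).const_mul κ).exp).const_mul ε
      simpa [mul_comm, mul_left_comm] using this
  have he2 : ∀ s : ℝ, HasDerivAt (fun s => ε * (κ * Real.exp (κ * s)))
      (ε * (κ * (κ * Real.exp (κ * s)))) s := fun s => by
    have := ((((hasDerivAt_id s).const_mul κ).exp).const_mul κ).const_mul ε
    simpa [mul_comm, mul_left_comm] using this
  -- The factor `1` gives `E` the shape of `elliptic_mul_comp_coord` with constant first factor.
  set E : EuclideanSpace ℝ (Fin (m + 1)) → ℝ := fun y => 1 * (ε * Real.exp (κ * y 0)) with hE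
  set v : EuclideanSpace ℝ (Fin (m + 1)) → ℝ := fun y => p y - E y with hv
  have hEs : ContDiff ℝ 2 E := by
    have : ContDiff ℝ 2 fun y : EuclideanSpace ℝ (Fin (m + 1)) => y 0 :=
      (EuclideanSpace.proj (𝕜 := ℝ) (0 : Fin (m + 1))).contDiff
    exact contDiff_const.mul (contDiff_const.mul (contDiff_const.mul this).exp)
  have hvc : ContinuousOn v (closure Ω) := h3.p_C1.continuousOn.sub hEs.continuous.continuousOn
  obtain ⟨y, hy, hymin⟩ := hΩ.isCompact_closure.exists_isMinOn
    (hΩ.isConnected.nonempty.mono subset_closure) hvc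
  -- At an interior minimum of `v` the gradient vanishes and `div (a ∇v) = a Δv ≥ 0`, which
  -- contradicts the strict supersolution property. On the boundary `p = 0`, hence `v ≥ -ε B`.
  have hyF : y ∈ frontier Ω := by
    refine hΩ.mem_frontier_of hy fun hyΩ => ?_
    have hnh := hΩo.mem_nhds hyΩ
    have hloc : IsLocalMin v y := hymin.isLocalMin (mem_of_superset hnh subset_closure)
    have dp : ∀ᶠ z in 𝓝 y, DifferentiableAt ℝ p z := by
      filter_upwards [hnh] with z hz
      exact (h3.p_C2.contDiffAt (hΩo.mem_nhds hz)).differentiableAt (by norm_num)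
    have dE : ∀ z, DifferentiableAt ℝ E z := fun z => hEs.differentiable (by norm_num) z
    have hgE : DifferentiableAt ℝ (gradient E) y :=
      ((contDiffOn_gradient (k := 1) isOpen_univ (by
        norm_num; exact hEs.contDiffOn)).contDiffAt univ_mem).differentiableAt (by norm_num)
    have hgp : DifferentiableAt ℝ (gradient p) y :=
      ((contDiffOn_gradient (k := 1) hΩo (by
        norm_num; exact h3.p_C2)).contDiffAt hnh).differentiableAt (by norm_num)
    have dv : ∀ᶠ z in 𝓝 y, DifferentiableAt ℝ v z := by
      filter_upwards [dp] with z hz using hz.sub (dE z)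
    have gv : ∀ᶠ z in 𝓝 y, gradient v z = gradient p z - gradient E z := by
      filter_upwards [dp] with z hz
      unfold gradient
      rw [hv, fderiv_fun_sub hz (dE z), map_sub]
    have hgv : DifferentiableAt ℝ (gradient v) y :=
      (hgp.sub hgE).congr_of_eventuallyEq gv
    have da : DifferentiableAt ℝ (fun z => S.a z 1) y :=
      ((contDiffOn_slice hS.a zero_le_one).contDiffAt hnh).differentiableAt (by norm_num)
    have hgv0 : gradient v y = 0 := by
      unfold gradient
      rw [hloc.fderiv_eq_zero, map_zero]
    have hL1 : 0 ≤ divg (fun z => S.a z 1 • gradient v z) y := by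
      rw [divg_smul da hgv, hgv0, inner_zero_right, add_zero]
      exact mul_nonneg (halo.le.trans (h1.a_bounds y hy 1 zero_le_one).1)
        (divg_gradient_nonneg dv hgv hloc)
    have hcongr : (fun z => S.a z 1 • gradient v z) =ᶠ[𝓝 y]
        fun z => S.a z 1 • gradient p z - S.a z 1 • gradient E z := by
      filter_upwards [gv] with z hz
      rw [hz, smul_sub]
    have hap : DifferentiableAt ℝ (fun z => S.a z 1 • gradient p z) y := da.smul hgp
    have haE : DifferentiableAt ℝ (fun z => S.a z 1 • gradient E z) y := da.smul hgE
    rw [divg_congr hcongr, divg_sub hap haE] at hL1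
    have hgpE : gradient p y = gradient E y := by
      have := gv.self_of_nhds
      rw [hgv0] at this
      exact (sub_eq_zero.1 this.symm)
    have hLp := h3.p_super y hyΩ 1 zero_lt_one
    have g0 : (gradient fun _ : EuclideanSpace ℝ (Fin (m + 1)) => (1 : ℝ)) = fun _ => 0 := by
      funext z
      simp [gradient]
    have hLE := elliptic_mul_comp_coord (j := (0 : Fin (m + 1))) (p := fun _ => 1)
      (b := S.b y 1) da (Eventually.of_forall fun _ => differentiableAt_const _)
      (by rw [g0]; exact differentiableAt_const _) he1 he2
    have hLE' : divg (fun z => S.a z 1 • gradient E z) y + inner ℝ (S.b y 1) (gradient E y) =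
        ε * κ * Real.exp (κ * y 0) *
          ((S.b y 1) 0 + (gradient (fun z => S.a z 1) y) 0 + S.a y 1 * κ) := by
      rw [hE, hLE, g0]
      simp [divg]
      ring
    have h11 : (1 : ℝ) ∈ Icc (0 : ℝ) 1 := ⟨zero_le_one, le_rfl⟩
    have k1 : |(S.b y 1) 0| ≤ bb := (PiLp.norm_apply_le (S.b y 1) 0).trans (hbb y hy 1 h11)
    have k2 : |(gradient (fun z => S.a z 1) y) 0| ≤ ad := by
      refine (PiLp.norm_apply_le (gradient (fun z => S.a z 1) y) 0).trans ?_
      rw [norm_gradient_eq]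
      exact had y hyΩ 1 ⟨zero_lt_one, le_rfl⟩
    have k3 := mul_le_mul_of_nonneg_right (h1.a_bounds y hy 1 zero_le_one).1 hκ0.le
    have k4 : 0 < (S.b y 1) 0 + (gradient (fun z => S.a z 1) y) 0 + S.a y 1 * κ := by
      have := (abs_le.1 k1).1
      have := (abs_le.1 k2).1
      linarith
    have k5 : 0 < ε * κ * Real.exp (κ * y 0) *
        ((S.b y 1) 0 + (gradient (fun z => S.a z 1) y) 0 + S.a y 1 * κ) := by positivity
    have := h3.p₀_nonneg
    rw [hgpE] at hLp
    linarith
  have hvx : v y ≤ v x := hymin (subset_closure hx)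
  have hBy := (le_abs_self _).trans (hB y hy)
  have hpy := h3.p_boundary y hyF
  simp only [hv, hE, one_mul, hpy] at hvx
  have k6 : 0 < ε * Real.exp (κ * x 0) := by positivity
  have k7 := mul_le_mul_of_nonneg_left hBy hε.le
  linarith

/-! ### Bounds on the domain -/

namespace IsC2Domain

/-- The norm attains its maximum over the closure on the boundary, because an interior point can be
pushed radially outwards (in any direction if it is the origin). -/
theorem norm_le_maxDist (hΩ : IsC2Domain Ω) {x : EuclideanSpace ℝ (Fin (m + 1))}
    (hx : x ∈ Ω) : ‖x‖ ≤ maxDist Ω := by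
  obtain ⟨y, hy, hymax⟩ := hΩ.isCompact_closure.exists_isMaxOn
    (hΩ.isConnected.nonempty.mono subset_closure) continuous_norm.continuousOn
  have hyF : y ∈ frontier Ω := by
    refine hΩ.mem_frontier_of hy fun hyΩ => ?_
    obtain ⟨u, hu, hyu⟩ : ∃ u : EuclideanSpace ℝ (Fin (m + 1)), ‖u‖ = 1 ∧ y = ‖y‖ • u := by
      by_cases h : y = 0
      · exact ⟨EuclideanSpace.single 0 1, by simp, by simp [h]⟩
      · have h' : ‖y‖ ≠ 0 := norm_ne_zero_iff.2 h
        exact ⟨‖y‖⁻¹ • y, by rw [norm_smul, norm_inv, norm_norm, inv_mul_cancel₀ h'],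
          by rw [smul_smul, mul_inv_cancel₀ h', one_smul]⟩
    have hlt : Tendsto (fun s : ℝ => y + s • u) (𝓝[>] 0) (𝓝 y) := by
      have : Continuous fun s : ℝ => y + s • u := by fun_prop
      have := this.tendsto 0
      rw [zero_smul, add_zero] at this
      exact this.mono_left nhdsWithin_le_nhds
    obtain ⟨s, hs, hs0⟩ := ((hlt.eventually (hΩ.isOpen.mem_nhds hyΩ)).and
      self_mem_nhdsWithin).exists
    have hs0 : 0 < s := hs0
    have h1 : ‖y + s • u‖ ≤ ‖y‖ := hymax (subset_closure hs)
    have h2 : y + s • u = (‖y‖ + s) • u := by rw [add_smul, ← hyu]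
    rw [h2, norm_smul, hu, mul_one, Real.norm_of_nonneg (by positivity)] at h1
    linarith
  have hb : BddAbove ((fun x => ‖x‖) '' frontier Ω) :=
    (hΩ.isCompact_frontier.image continuous_norm).bddAbove
  exact (hymax (subset_closure hx)).trans (le_csSup hb (mem_image_of_mem _ hyF))

theorem abs_coord_le_maxDist (hΩ : IsC2Domain Ω) {x : EuclideanSpace ℝ (Fin (m + 1))}
    (hx : x ∈ closure Ω) (j : Fin (m + 1)) : |x j| ≤ maxDist Ω := by
  have hc : IsClosed {x : EuclideanSpace ℝ (Fin (m + 1)) | ‖x‖ ≤ maxDist Ω} :=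
    isClosed_le continuous_norm continuous_const
  have : ‖x‖ ≤ maxDist Ω := closure_minimal (fun y hy => hΩ.norm_le_maxDist hy) hc hx
  exact (PiLp.norm_apply_le x j).trans this

theorem abs_gradient_coord_le_maxPartial (hΩ : IsC2Domain Ω)
    (hp : ContDiffOn ℝ 1 p (closure Ω)) (j : Fin (m + 1)) {x : EuclideanSpace ℝ (Fin (m + 1))}
    (hx : x ∈ Ω) : |(gradient p x) j| ≤ maxPartial Ω p j := by
  have hc : ContinuousOn (fun x => |(gradientWithin p (closure Ω) x) j|) (closure Ω) :=
    ((EuclideanSpace.proj (𝕜 := ℝ) j).continuous.comp_continuousOn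
      (hΩ.continuousOn_gradientWithin hp)).abs
  have hb := (hΩ.isCompact_closure.image_of_continuousOn hc).bddAbove
  rw [← hΩ.gradientWithin_eq p hx]
  exact le_csSup hb (mem_image_of_mem (fun x => |(gradientWithin p (closure Ω) x) j|)
    (subset_closure hx))

end IsC2Domain

end ParabolicISS

namespace ParabolicISS

/-! ### The weights of the two parts of the theorem -/

section Factor

variable {l k : ℝ}

theorem hasDerivAt_weightFactor (hk : 0 < k) (s : ℝ) :
    HasDerivAt (fun s => (k + Real.exp (l * s))⁻¹)
      (-(l * Real.exp (l * s)) / (k + Real.exp (l * s)) ^ 2) s := by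
  have h1 : HasDerivAt (fun s : ℝ => k + Real.exp (l * s)) (l * Real.exp (l * s)) s := by
    have := (((hasDerivAt_id s).const_mul l).exp).const_add k
    simpa [mul_comm] using this
  exact h1.inv (by positivity)

theorem hasDerivAt_weightFactor_deriv (hk : 0 < k) (s : ℝ) :
    HasDerivAt (fun s => -(l * Real.exp (l * s)) / (k + Real.exp (l * s)) ^ 2)
      (-(l ^ 2 * Real.exp (l * s)) / (k + Real.exp (l * s)) ^ 2 +
        2 * l ^ 2 * Real.exp (l * s) ^ 2 / (k + Real.exp (l * s)) ^ 3) s := by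
  have h0 : HasDerivAt (fun s : ℝ => Real.exp (l * s)) (l * Real.exp (l * s)) s := by
    have := ((hasDerivAt_id s).const_mul l).exp
    simpa [mul_comm] using this
  have hp : 0 < k + Real.exp (l * s) := by positivity
  have hn : HasDerivAt (fun s : ℝ => -(l * Real.exp (l * s))) (-(l * (l * Real.exp (l * s)))) s :=
    (h0.const_mul l).neg
  have hd : HasDerivAt (fun s : ℝ => (k + Real.exp (l * s)) ^ 2)
      (2 * (k + Real.exp (l * s)) * (l * Real.exp (l * s))) s :=
    ((h0.const_add k).pow 2).congr_deriv (by norm_num)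
  refine (hn.div hd (by positivity)).congr_deriv ?_
  field_simp
  ring

variable {alo blo D : ℝ}

theorem drift_margin_pos (hl : 0 < l) (hlb : 0 < l + blo)
    (hk : 2 * l * Real.exp (l * D) / (l + blo) < k) :
    0 < k ∧ 0 < l + blo - 2 / k * l * Real.exp (l * D) := by
  have hk0 : 0 < k := lt_of_le_of_lt (by positivity) hk
  refine ⟨hk0, ?_⟩
  rw [div_lt_iff₀ hlb] at hk
  rw [sub_pos, show 2 / k * l * Real.exp (l * D) = 2 * l * Real.exp (l * D) / k by ring,
    div_lt_iff₀ hk0]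
  linarith

theorem hatc_pos (halo : 0 < alo) (hl : 0 < l) (hlb : 0 < l + blo)
    (hk : 2 * l * Real.exp (l * D) / (l + blo) < k) : 0 < hatc alo blo D l k := by
  obtain ⟨hk0, hm⟩ := drift_margin_pos hl hlb hk
  unfold hatc
  positivity

theorem Ckl_pos (hk : 0 < k) : 0 < Ckl D l k := by
  unfold Ckl
  positivity

/-- With `e = e^{l x_j}` and `B = b_j + ∂_j a`, the left side is exactly `-(a l e/(k+e)) (B/a + l -
2 l e/(k+e)) (k+e)⁻¹`. Both factors are minimised separately by means of `e^{-lD} ≤ e ≤ e^{lD}` and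
`e/(k+e) ≤ e^{lD}/k`, which is how the formula for `hatc` arises. -/
theorem weightFactor_operator_le {a B e : ℝ} (halo : 0 < alo) (ha : alo ≤ a) (hl : 0 < l)
    (hlb : 0 < l + blo) (hB : blo ≤ B / a) (hk : 2 * l * Real.exp (l * D) / (l + blo) < k)
    (he1 : Real.exp (-(l * D)) ≤ e) (he2 : e ≤ Real.exp (l * D)) :
    B * (-(l * e) / (k + e) ^ 2) + a * (-(l ^ 2 * e) / (k + e) ^ 2 +
      2 * l ^ 2 * e ^ 2 / (k + e) ^ 3) ≤ -(hatc alo blo D l k * (k + e)⁻¹) := by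
  obtain ⟨hk0, hm⟩ := drift_margin_pos hl hlb hk
  have ha0 : 0 < a := halo.trans_le ha
  set X := Real.exp (l * D) with hX
  set Y := Real.exp (-(l * D)) with hY
  have hX0 : 0 < X := Real.exp_pos _
  have hY0 : 0 < Y := Real.exp_pos _
  have he0 : 0 < e := hY0.trans_le he1
  have hke : 0 < k + e := by positivity
  set Q := l + blo - 2 / k * l * X with hQ
  have e1 : e / (k + e) ≤ X / k := by
    rw [div_le_div_iff₀ hke hk0]
    nlinarith
  have e2 : Q ≤ B / a + l - 2 * l * (e / (k + e)) := by
    have : 2 * l * (e / (k + e)) ≤ 2 * l * (X / k) := by gcongr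
    have h3 : 2 / k * l * X = 2 * l * (X / k) := by ring
    rw [hQ, h3]
    linarith
  have e3 : alo * l * Y / (k + X) ≤ a * l * e / (k + e) := by
    gcongr
  have e4 : hatc alo blo D l k ≤ a * l * e / (k + e) * (B / a + l - 2 * l * (e / (k + e))) := by
    unfold hatc
    rw [← hX, ← hY, ← hQ]
    exact mul_le_mul e3 e2 hm.le (by positivity)
  have e5 := mul_le_mul_of_nonneg_right e4 (inv_nonneg.2 hke.le)
  have e6 : B * (-(l * e) / (k + e) ^ 2) + a * (-(l ^ 2 * e) / (k + e) ^ 2 +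
      2 * l ^ 2 * e ^ 2 / (k + e) ^ 3) =
      -(a * l * e / (k + e) * (B / a + l - 2 * l * (e / (k + e))) * (k + e)⁻¹) := by
    field_simp
    ring
  rw [e6]
  linarith

end Factor

variable {m : ℕ} {Ω : Set (EuclideanSpace ℝ (Fin (m + 1)))} {S : Coefficients (m + 1)}
  {μ : EuclideanSpace ℝ (Fin (m + 1)) → ℝ → ℝ} {p : EuclideanSpace ℝ (Fin (m + 1)) → ℝ}
  {p₀ : ℝ} {ψ₁ : EuclideanSpace ℝ (Fin (m + 1)) → ℝ → ℝ} {ψ₂ : ℝ → ℝ} {alo ahi clo : ℝ}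

theorem Coefficients.Assumption3'.isWeight (h3 : S.Assumption3' Ω p p₀ ψ₁ ψ₂) (hΩ : IsC2Domain Ω)
    (hS : S.Regular Ω) (h1 : S.Assumption1 Ω alo ahi) : IsWeight Ω p :=
  ⟨h3.p_C2, h3.p_C1, h3.nonneg hΩ hS h1, h3.p_boundary⟩

theorem Coefficients.Assumption3'.flux_sign (h3 : S.Assumption3' Ω p p₀ ψ₁ ψ₂)
    (hΩ : IsC2Domain Ω) {x : EuclideanSpace ℝ (Fin (m + 1))} (hx : x ∈ Ω) {t : ℝ} (ht : 0 < t)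
    (s : ℝ) : S.g x t s * s * divg (fun y => p y • S.m y t) x ≤ 0 := by
  have := h3.g_sign x (subset_closure hx) t ht.le s
  rwa [hΩ.divgWithin_eq _ hx] at this

/-- Here the decay comes from the zeroth order term alone: `p (div b - c + μ) ≤ -clo p`, since `p ≥
0`. -/
theorem Coefficients.Assumption3'.isEnergyWeight (h3 : S.Assumption3' Ω p p₀ ψ₁ ψ₂)
    (hΩ : IsC2Domain Ω) (hS : S.Regular Ω) (h1 : S.Assumption1 Ω alo ahi)
    (h2 : S.Assumption2 Ω μ clo) : IsEnergyWeight S Ω μ p clo where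
  weight := h3.isWeight hΩ hS h1
  lam_nonneg := h2.clo_nonneg
  super := fun x hx t ht => by
    have e1 := h3.p_super x hx t ht
    have e2 := mul_le_mul_of_nonneg_left (h2.clo_le x hx t ht) (h3.nonneg hΩ hS h1 x hx)
    have e3 := h3.p₀_nonneg
    linarith
  sign := fun x hx t ht s => h3.flux_sign hΩ hx ht s

section Coordinate

variable {j : Fin (m + 1)} {blo mbar l k : ℝ}

theorem IsC2Domain.exp_coord_bounds (hΩ : IsC2Domain Ω) (hl : 0 < l) (j : Fin (m + 1))
    {x : EuclideanSpace ℝ (Fin (m + 1))} (hx : x ∈ closure Ω) :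
    Real.exp (-(l * maxDist Ω)) ≤ Real.exp (l * x j) ∧
      Real.exp (l * x j) ≤ Real.exp (l * maxDist Ω) := by
  have h := abs_le.1 (hΩ.abs_coord_le_maxDist hx j)
  have h4 := mul_le_mul_of_nonneg_left h.1 hl.le
  have h5 := mul_le_mul_of_nonneg_left h.2 hl.le
  exact ⟨Real.exp_le_exp.2 (by linarith), Real.exp_le_exp.2 h5⟩

theorem isWeight_mul_weightFactor (hp : IsWeight Ω p) (hk : 0 < k) :
    IsWeight Ω (fun x => p x * (k + Real.exp (l * x j))⁻¹) := by
  have hs : ContDiff ℝ 2 fun x : EuclideanSpace ℝ (Fin (m + 1)) => (k + Real.exp (l * x j))⁻¹ := by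
    have : ContDiff ℝ 2 fun y : EuclideanSpace ℝ (Fin (m + 1)) => y j :=
      (EuclideanSpace.proj (𝕜 := ℝ) j).contDiff
    exact (contDiff_const.add (contDiff_const.mul this).exp).inv fun x => by positivity
  exact ⟨hp.contDiffOn.mul hs.contDiffOn,
    hp.contDiffOn_closure.mul (hs.contDiffOn.of_le (by norm_num)),
    fun x hx => mul_nonneg (hp.nonneg x hx) (by positivity),
    fun x hx => by rw [hp.frontier x hx, zero_mul]⟩

/-- For `P = p φ(x_j)` the elliptic operator splits into `φ` times its value at `p`, at most `-p₀
φ`, a cross term `2 a φ' ∂_j p`, and `p ((b_j + ∂_j a) φ' + a φ'')`. The last gives the rate `hatc`,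
and `p₀` pays for the cross term when `k` is large. The flux condition changes by `φ' p m_j`,
controlled by its sign or by its size relative to `div (p m)`. -/
theorem Coefficients.Assumption3'.isEnergyWeight_mul (h3 : S.Assumption3' Ω p p₀ ψ₁ ψ₂)
    (hΩ : IsC2Domain Ω) (hS : S.Regular Ω) (h1 : S.Assumption1 Ω alo ahi)
    (h2 : S.Assumption2 Ω μ 0) (hp₀ : 0 < p₀) (hdrift : DriftLowerBound S Ω j blo)
    (hl : 0 < l) (hlb : 0 < l + blo)
    (hk1 : 2 * l * Real.exp (l * maxDist Ω) / (l + blo) < k)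
    (hk2 : 2 * ahi * l * Real.exp (l * maxDist Ω) / p₀ * maxPartial Ω p j < k)
    (hsign : SignCondition S Ω p j ∨ DivergenceCondition S Ω p j mbar ∧
      2 * l * Real.exp (l * maxDist Ω) * mbar < k) :
    IsEnergyWeight S Ω μ (fun x => p x * (k + Real.exp (l * x j))⁻¹)
      (hatc alo blo (maxDist Ω) l k) := by
  have hΩo := hΩ.isOpen
  have hw := h3.isWeight hΩ hS h1
  have hk0 := (drift_margin_pos hl hlb hk1).1
  have hd1 := hasDerivAt_weightFactor (l := l) hk0
  have hd2 := hasDerivAt_weightFactor_deriv (l := l) hk0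
  refine ⟨isWeight_mul_weightFactor hw hk0, (hatc_pos h1.alo_pos hl hlb hk1).le, ?_, ?_⟩
  · intro x hx t ht
    have hxc := subset_closure hx
    have hnh := hΩo.mem_nhds hx
    have hpx := hw.nonneg x hx
    obtain ⟨he1, he2⟩ := hΩ.exp_coord_bounds hl j hxc
    have ha := h1.a_bounds x hxc t ht.le
    have ha0 := h1.alo_pos.trans_le ha.1
    have da : DifferentiableAt ℝ (fun y => S.a y t) x :=
      ((contDiffOn_slice hS.a ht.le).contDiffAt hnh).differentiableAt (by norm_num)
    have dp : ∀ᶠ y in 𝓝 x, DifferentiableAt ℝ p y := by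
      filter_upwards [hnh] with y hy using (hw.hasGradientAt hΩo hy).differentiableAt
    have dgp : DifferentiableAt ℝ (gradient p) x :=
      ((hw.contDiffOn_gradient hΩo).contDiffAt hnh).differentiableAt (by norm_num)
    rw [elliptic_mul_comp_coord (b := S.b x t) (j := j) da dp dgp hd1 hd2]
    have hdr := hdrift x hx t ht
    rw [← gradient_coord] at hdr
    have hop := weightFactor_operator_le h1.alo_pos ha.1 hl hlb hdr hk1 he1 he2
    have hs := h3.p_super x hx t ht
    have hκ : divg (fun y => S.b y t) x - S.c x t + μ x t ≤ 0 := by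
      have := h2.clo_le x hx t ht
      linarith
    have hmp := hΩ.abs_gradient_coord_le_maxPartial h3.p_C1 j hx
    set X := Real.exp (l * maxDist Ω) with hX
    set e := Real.exp (l * x j) with he
    have he0 : 0 < e := Real.exp_pos _
    have hX0 : 0 < X := Real.exp_pos _
    have hke : 0 < k + e := by positivity
    have hr : 0 < (k + e)⁻¹ := inv_pos.2 hke
    have t1 := mul_le_mul_of_nonneg_left hs hr.le
    have t2 := mul_le_mul_of_nonneg_left hop hpx
    have t3 : p x * (k + e)⁻¹ * (divg (fun y => S.b y t) x - S.c x t + μ x t) ≤ 0 :=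
      mul_nonpos_of_nonneg_of_nonpos (by positivity) hκ
    -- The cross term has an additional power of `(k + e)⁻¹` compared with `p₀ φ`; this is the
    -- purpose of the lower bound on `k` involving `maxPartial`.
    have t4 : 2 * S.a x t * (-(l * e) / (k + e) ^ 2) * (gradient p x) j ≤ (k + e)⁻¹ * p₀ := by
      have u1 : 2 * ahi * l * X * maxPartial Ω p j ≤ p₀ * k := by
        rw [div_mul_eq_mul_div, div_lt_iff₀ hp₀] at hk2
        linarith
      have u2 : 2 * S.a x t * l * e * |(gradient p x) j| ≤ p₀ * (k + e) := by
        calc 2 * S.a x t * l * e * |(gradient p x) j|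
            ≤ 2 * ahi * l * X * maxPartial Ω p j := by
              have := ha.2
              have := h1.ahi_pos
              gcongr
          _ ≤ p₀ * k := u1
          _ ≤ p₀ * (k + e) := by
              have : 0 ≤ p₀ * e := by positivity
              linarith
      have u3 : -(2 * S.a x t * l * e * (gradient p x) j) ≤ p₀ * (k + e) := by
        have := mul_le_mul_of_nonneg_left (neg_abs_le ((gradient p x) j))
          (show 0 ≤ 2 * S.a x t * l * e by positivity)
        linarith
      have u4 := mul_le_mul_of_nonneg_right u3 (show 0 ≤ ((k + e) ^ 2)⁻¹ by positivity)
      calc 2 * S.a x t * (-(l * e) / (k + e) ^ 2) * (gradient p x) j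
          = -(2 * S.a x t * l * e * (gradient p x) j) * ((k + e) ^ 2)⁻¹ := by ring
        _ ≤ p₀ * (k + e) * ((k + e) ^ 2)⁻¹ := u4
        _ = (k + e)⁻¹ * p₀ := by field_simp
    linarith
  · intro x hx t ht s
    have hxc := subset_closure hx
    have hnh := hΩo.mem_nhds hx
    have hpx := hw.nonneg x hx
    obtain ⟨he1, he2⟩ := hΩ.exp_coord_bounds hl j hxc
    have hgs := h3.flux_sign hΩ hx ht s
    have dm : DifferentiableAt ℝ (fun y => S.m y t) x :=
      ((contDiffOn_slice hS.m ht.le).contDiffAt hnh).differentiableAt (by norm_num)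
    have dpm : DifferentiableAt ℝ (fun y => p y • S.m y t) x :=
      (hw.hasGradientAt hΩo hx).differentiableAt.smul dm
    have g1 := hasGradientAt_comp_coord (j := j) hd1 x
    have hdiv : divg (fun y => (p y * (k + Real.exp (l * y j))⁻¹) • S.m y t) x =
        (k + Real.exp (l * x j))⁻¹ * divg (fun y => p y • S.m y t) x +
          -(l * Real.exp (l * x j)) / (k + Real.exp (l * x j)) ^ 2 * (p x * (S.m x t) j) := by
      have : (fun y => (p y * (k + Real.exp (l * y j))⁻¹) • S.m y t) =
          fun y => (k + Real.exp (l * y j))⁻¹ • (p y • S.m y t) := by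
        funext y
        rw [smul_smul, mul_comm]
      rw [this, divg_smul g1.differentiableAt dpm, g1.gradient]
      simp [inner_smul_left, inner_smul_right, EuclideanSpace.inner_single_left]
      ring
    rw [hdiv]
    set X := Real.exp (l * maxDist Ω) with hX
    set e := Real.exp (l * x j) with he
    have he0 : 0 < e := Real.exp_pos _
    have hX0 : 0 < X := Real.exp_pos _
    have hke : 0 < k + e := by positivity
    have hr : 0 < (k + e)⁻¹ := inv_pos.2 hke
    set V := divg (fun y => p y • S.m y t) x with hV
    set G := S.g x t s * s with hG
    rcases hsign with hA | ⟨hB, hkm⟩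
    · have hAx : -(p x * (S.m x t) j * G) ≤ 0 := by
        have := hA x hx t ht s
        rw [hG]
        linarith
      have u1 := mul_nonpos_of_nonneg_of_nonpos hr.le hgs
      have u2 := mul_nonpos_of_nonneg_of_nonpos
        (show 0 ≤ l * e / (k + e) ^ 2 by positivity) hAx
      calc G * ((k + e)⁻¹ * V + -(l * e) / (k + e) ^ 2 * (p x * (S.m x t) j))
          = (k + e)⁻¹ * (G * V) + l * e / (k + e) ^ 2 * -(p x * (S.m x t) j * G) := by ring
        _ ≤ 0 := by linarith
    · obtain ⟨hV0, hVb⟩ := hB x hx t ht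
      rw [abs_div, div_le_iff₀ (abs_pos.2 hV0)] at hVb
      -- The perturbation is at most `mbar` times the main term, whose sign is known, and its
      -- coefficient `l e / (k + e)²` is small enough once `l e mbar ≤ k + e`.
      have u1 : -(p x * (S.m x t) j * G) ≤ mbar * -(G * V) := by
        calc -(p x * (S.m x t) j * G) ≤ |p x * (S.m x t) j * G| := neg_le_abs _
          _ = |p x * (S.m x t) j| * |G| := abs_mul _ _
          _ ≤ mbar * |V| * |G| := by gcongr
          _ = mbar * |G * V| := by rw [abs_mul G V]; ring
          _ = mbar * -(G * V) := by rw [abs_of_nonpos hgs]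
      have hmb : 0 ≤ mbar := by
        by_contra! hneg
        have := mul_neg_of_neg_of_pos hneg (abs_pos.2 hV0)
        have := abs_nonneg (p x * (S.m x t) j)
        linarith
      have u2 : l * e * mbar ≤ k + e := by
        have v1 : l * e * mbar ≤ l * X * mbar := by gcongr
        have v2 : 0 ≤ l * X * mbar := by positivity
        linarith
      have u3 := mul_le_mul_of_nonneg_left u1 (show 0 ≤ l * e by positivity)
      have u4 := mul_le_mul_of_nonneg_right u2 (neg_nonneg.2 hgs)
      have u5 : (k + e) * (G * V) + l * e * -(p x * (S.m x t) j * G) ≤ 0 := by linarith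
      calc G * ((k + e)⁻¹ * V + -(l * e) / (k + e) ^ 2 * (p x * (S.m x t) j))
          = ((k + e) * (G * V) + l * e * -(p x * (S.m x t) j * G)) * ((k + e) ^ 2)⁻¹ := by
            field_simp
        _ ≤ 0 := mul_nonpos_of_nonpos_of_nonneg u5 (by positivity)

/-- Since `p = 0` on the boundary, the derivative falls on `p` only. The boundary terms of the two
weights are therefore comparable with the same constants as the weights themselves. -/
theorem norm_gradientWithin_mul_weightFactor (hΩ : IsC2Domain Ω) (hp : IsWeight Ω p) (hk : 0 < k)
    {x : EuclideanSpace ℝ (Fin (m + 1))} (hx : x ∈ frontier Ω) :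
    ‖gradientWithin (fun x => p x * (k + Real.exp (l * x j))⁻¹) (closure Ω) x‖ =
      (k + Real.exp (l * x j))⁻¹ * ‖gradientWithin p (closure Ω) x‖ := by
  have hxc := frontier_subset_closure hx
  have hu := hΩ.uniqueDiffOn_closure x hxc
  have g1 := (hasGradientAt_comp_coord (j := j) (hasDerivAt_weightFactor (l := l) hk) x)
  have d1 := g1.differentiableAt.differentiableWithinAt (s := closure Ω)
  have dp : DifferentiableWithinAt ℝ p (closure Ω) x :=
    (hp.contDiffOn_closure.differentiableOn (by norm_num)) x hxc
  unfold gradientWithin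
  rw [fderivWithin_fun_mul hu dp d1, hp.frontier x hx, zero_smul, zero_add, map_smul, norm_smul,
    Real.norm_of_nonneg (by positivity)]

end Coordinate

end ParabolicISS

namespace ParabolicISS

variable {m : ℕ} {Ω : Set (EuclideanSpace ℝ (Fin (m + 1)))} {S : Coefficients (m + 1)}
  {μ : EuclideanSpace ℝ (Fin (m + 1)) → ℝ → ℝ} {p P : EuclideanSpace ℝ (Fin (m + 1)) → ℝ}
  {p₀ : ℝ} {ψ₁ : EuclideanSpace ℝ (Fin (m + 1)) → ℝ → ℝ} {ψ₂ : ℝ → ℝ} {alo ahi clo lam T : ℝ}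
  {I : Inputs (m + 1)} {w : EuclideanSpace ℝ (Fin (m + 1)) → ℝ → ℝ} {q q' : ℝ≥0∞}

/-! ### Estimates for a fixed solution -/

/-- The boundary condition can be solved for `w`; this converts `a |w| |∇p|` into the boundary
disturbance term. -/
theorem Coefficients.IsClassicalSolution.invFun_eq (hw : S.IsClassicalSolution Ω I T w)
    (h3 : S.Assumption3' Ω p p₀ ψ₁ ψ₂) {x : EuclideanSpace ℝ (Fin (m + 1))}
    (hx : x ∈ frontier Ω) {t : ℝ} (ht : t ∈ Ioo 0 T) :
    I.d x t / ψ₁ x t = ψ₂ (w x t) ∧ Function.invFun ψ₂ (I.d x t / ψ₁ x t) = w x t := by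
  obtain ⟨ψlo, hψlo, hψ⟩ := h3.ψ₁_lower
  have h0 : ψ₁ x t ≠ 0 := (hψlo.trans_le (hψ x hx t ht.1.le)).ne'
  have h : I.d x t / ψ₁ x t = ψ₂ (w x t) := by
    rw [← hw.boundary x hx t ht, h3.ψ_eq x hx t ht.1.le, mul_div_cancel_left₀ _ h0]
  exact ⟨h, by rw [h]; exact Function.leftInverse_invFun h3.ψ₂_strictMono.injective _⟩

theorem enorm_boundaryTerm (hw : S.IsClassicalSolution Ω I T w)
    (h1 : S.Assumption1 Ω alo ahi) (h3 : S.Assumption3' Ω p p₀ ψ₁ ψ₂)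
    {x : EuclideanSpace ℝ (Fin (m + 1))} (hx : x ∈ frontier Ω) {t : ℝ} (ht : t ∈ Ioo 0 T) :
    ‖boundaryTerm S Ω p ψ₁ ψ₂ I x t‖ₑ =
      ENNReal.ofReal (S.a x t * |w x t| * ‖gradientWithin p (closure Ω) x‖) := by
  have ha := h1.alo_pos.le.trans (h1.a_bounds x (frontier_subset_closure hx) t ht.1.le).1
  rw [Real.enorm_eq_ofReal_abs, boundaryTerm, (hw.invFun_eq h3 hx ht).2, abs_mul, abs_mul,
    abs_of_nonneg ha, abs_norm]

theorem lintegral_boundaryTerm (hw : S.IsClassicalSolution Ω I T w)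
    (h1 : S.Assumption1 Ω alo ahi) (h3 : S.Assumption3' Ω p p₀ ψ₁ ψ₂) {t : ℝ}
    (ht : t ∈ Ioo 0 T) :
    ∫⁻ x, ‖boundaryTerm S Ω p ψ₁ ψ₂ I x t‖ₑ ∂(surfaceMeasure Ω) =
      ∫⁻ x, ENNReal.ofReal (S.a x t * |w x t| * ‖gradientWithin p (closure Ω) x‖)
        ∂(surfaceMeasure Ω) := by
  refine lintegral_congr_ae ?_
  filter_upwards [ae_mem_frontier Ω] with x hx
  exact enorm_boundaryTerm hw h1 h3 hx ht

theorem aemeasurable_lintegral_slice_mul {n : ℕ} {K : Set (EuclideanSpace ℝ (Fin n))}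
    {ν : Measure (EuclideanSpace ℝ (Fin n))} {f : EuclideanSpace ℝ (Fin n) → ℝ → ℝ}
    {L : EuclideanSpace ℝ (Fin n) → ℝ} (hK : IsCompact K) (hν : ∀ᵐ x ∂ν, x ∈ K)
    (hf : ContinuousOn (fun z : EuclideanSpace ℝ (Fin n) × ℝ => f z.1 z.2) (K ×ˢ Icc 0 T))
    (hf0 : ∀ x ∈ K, ∀ t ∈ Icc 0 T, 0 ≤ f x t) (hL : Integrable L ν) (hL0 : ∀ x ∈ K, 0 ≤ L x) :
    AEMeasurable (fun t => ∫⁻ x, ENNReal.ofReal (f x t * L x) ∂ν)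
      (volume.restrict (Ioo 0 T)) := by
  have h1 : AEMeasurable (fun t => ENNReal.ofReal (∫ x, f x t * L x ∂ν))
      (volume.restrict (Ioo 0 T)) :=
    (((continuousOn_integral_mul hK hν hf hL).mono Ioo_subset_Icc_self).aemeasurable
      measurableSet_Ioo).ennreal_ofReal
  refine h1.congr ?_
  filter_upwards [ae_restrict_mem measurableSet_Ioo] with t ht
  exact ofReal_integral_slice_mul hK hν hf hf0 hL hL0 (Ioo_subset_Icc_self ht)

theorem enorm_weight_mul (hp : IsWeight Ω p) {x : EuclideanSpace ℝ (Fin (m + 1))} (hx : x ∈ Ω)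
    (r : ℝ) : ‖p x * r‖ₑ = ENNReal.ofReal (|r| * p x) := by
  rw [Real.enorm_eq_ofReal_abs, abs_mul, abs_of_nonneg (hp.nonneg x hx), mul_comm]

/-- The weighted `L¹`-estimate in terms of a comparable energy weight `P`, given an estimate of
exponentially weighted time integrals. -/
theorem IsEnergyWeight.L1norm_le (hE : IsEnergyWeight S Ω μ P lam) (hΩ : IsC2Domain Ω)
    (hS : S.Regular Ω) (h1 : S.Assumption1 Ω alo ahi) (h2 : S.Assumption2 Ω μ clo)
    (h3 : S.Assumption3' Ω p p₀ ψ₁ ψ₂) {Elo Ehi : ℝ} (hElo : 0 < Elo) (hEhi : 0 < Ehi)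
    (hlo : ∀ x ∈ Ω, Elo * p x ≤ P x) (hhi : ∀ x ∈ Ω, P x ≤ Ehi * p x)
    (hN : ∀ x ∈ frontier Ω,
      ‖gradientWithin P (closure Ω) x‖ ≤ Ehi * ‖gradientWithin p (closure Ω) x‖)
    {κ : ℝ≥0∞} (hI : I.Regular Ω) (hT : 0 < T)
    (hκ : ∀ u : ℝ → ℝ≥0∞, AEMeasurable u (volume.restrict (Ioo 0 T)) →
      ∫⁻ t in Ioo 0 T, ENNReal.ofReal (Real.exp (lam * t)) * u t ≤
        ENNReal.ofReal (Real.exp (lam * T)) * (κ * eLpNorm u q (volume.restrict (Ioo 0 T))))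
    (hw : S.IsClassicalSolution Ω I T w) :
    L1norm Ω (fun x => p x * w x T) ≤
      ENNReal.ofReal (Ehi / Elo * Real.exp (-(lam * T))) * L1norm Ω (fun x => p x * I.w₀ x)
        + ENNReal.ofReal (Ehi / Elo) * κ *
          mixedNorm q T (surfaceMeasure Ω) (boundaryTerm S Ω p ψ₁ ψ₂ I)
        + ENNReal.ofReal (Ehi / Elo) * κ *
          mixedNorm q T (volume.restrict Ω) (fun x t => p x * I.f x t) := by
  have hp := h3.isWeight hΩ hS h1
  have hΩm := hΩ.isOpen.measurableSet
  have hK := hΩ.isCompact_closure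
  have hν : ∀ᵐ x ∂(volume.restrict Ω), x ∈ closure Ω := by
    filter_upwards [ae_restrict_mem hΩm] with x hx using subset_closure hx
  have hνσ : ∀ᵐ x ∂(surfaceMeasure Ω), x ∈ closure Ω := by
    filter_upwards [ae_mem_frontier Ω] with x hx using frontier_subset_closure hx
  have hsubT : closure Ω ×ˢ Icc 0 T ⊆ closure Ω ×ˢ Ici (0 : ℝ) :=
    prod_mono_right Icc_subset_Ici_self
  have ha0 : ∀ x ∈ closure Ω, ∀ t, 0 ≤ t → 0 ≤ S.a x t := fun x hx t ht =>
    h1.alo_pos.le.trans (h1.a_bounds x hx t ht).1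
  set σ := surfaceMeasure Ω with hσ
  set ub : ℝ → ℝ≥0∞ := fun t =>
    ∫⁻ x, ENNReal.ofReal (S.a x t * |w x t| * ‖gradientWithin p (closure Ω) x‖) ∂σ with hub
  set uf : ℝ → ℝ≥0∞ := fun t => ∫⁻ x in Ω, ENNReal.ofReal (|I.f x t| * p x) with huf
  have hubm : AEMeasurable ub (volume.restrict (Ioo 0 T)) :=
    aemeasurable_lintegral_slice_mul (f := fun x t => S.a x t * |w x t|) hK hνσ
      ((hS.a.continuousOn.mono hsubT).mul hw.cont.abs)
      (fun x hx t ht => mul_nonneg (ha0 x hx t ht.1) (abs_nonneg _))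
      (hΩ.integrable_surfaceMeasure (hΩ.continuousOn_gradientWithin hp.contDiffOn_closure).norm)
      fun _ _ => norm_nonneg _
  have hufm : AEMeasurable uf (volume.restrict (Ioo 0 T)) :=
    aemeasurable_lintegral_slice_mul (f := fun x t => |I.f x t|) hK hν
      (hI.f.continuousOn.mono hsubT).abs (fun _ _ _ _ => abs_nonneg _)
      (integrableOn_of_closure hΩ.isBounded hp.continuousOn)
      fun x hx => hp.nonneg_closure hΩ hx
  have hbT : mixedNorm q T σ (boundaryTerm S Ω p ψ₁ ψ₂ I) =
      eLpNorm ub q (volume.restrict (Ioo 0 T)) := by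
    refine eLpNorm_congr_ae ?_
    filter_upwards [ae_restrict_mem measurableSet_Ioo] with t ht
    exact lintegral_boundaryTerm hw h1 h3 ht
  have hfT : mixedNorm q T (volume.restrict Ω) (fun x t => p x * I.f x t) =
      eLpNorm uf q (volume.restrict (Ioo 0 T)) := by
    refine eLpNorm_congr_ae (Eventually.of_forall fun t => ?_)
    exact setLIntegral_congr_fun hΩm fun x hx => enorm_weight_mul hp hx _
  have hkey := hE.exp_mul_lintegral_le hΩ hS h1 h2 hI hT hw
  -- comparison of the weights
  have c0 : ENNReal.ofReal Elo * L1norm Ω (fun x => p x * w x T) ≤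
      ∫⁻ x in Ω, ENNReal.ofReal (|w x T| * P x) := by
    rw [L1norm, ← lintegral_const_mul' _ _ ENNReal.ofReal_ne_top]
    refine setLIntegral_mono_ae' hΩm (ae_of_all _ fun x hx => ?_)
    rw [enorm_weight_mul hp hx, ← ENNReal.ofReal_mul hElo.le]
    refine ENNReal.ofReal_le_ofReal ?_
    have := mul_le_mul_of_nonneg_left (hlo x hx) (abs_nonneg (w x T))
    linarith
  have c1 : ∀ r : EuclideanSpace ℝ (Fin (m + 1)) → ℝ,
      ∫⁻ x in Ω, ENNReal.ofReal (|r x| * P x) ≤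
        ENNReal.ofReal Ehi * ∫⁻ x in Ω, ENNReal.ofReal (|r x| * p x) := by
    intro r
    rw [← lintegral_const_mul' _ _ ENNReal.ofReal_ne_top]
    refine setLIntegral_mono_ae' hΩm (ae_of_all _ fun x hx => ?_)
    rw [← ENNReal.ofReal_mul hEhi.le]
    refine ENNReal.ofReal_le_ofReal ?_
    have := mul_le_mul_of_nonneg_left (hhi x hx) (abs_nonneg (r x))
    linarith
  have c2 : ∀ t ∈ Ioo 0 T,
      ∫⁻ x, ENNReal.ofReal (S.a x t * |w x t| * ‖gradientWithin P (closure Ω) x‖) ∂σ ≤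
        ENNReal.ofReal Ehi * ub t := by
    intro t ht
    rw [hub, ← lintegral_const_mul' _ _ ENNReal.ofReal_ne_top]
    refine lintegral_mono_ae ?_
    filter_upwards [ae_mem_frontier Ω] with x hx
    rw [← ENNReal.ofReal_mul hEhi.le]
    refine ENNReal.ofReal_le_ofReal ?_
    have := mul_le_mul_of_nonneg_left (hN x hx)
      (mul_nonneg (ha0 x (frontier_subset_closure hx) t ht.1.le) (abs_nonneg (w x t)))
    linarith
  have hL0 : ∫⁻ x in Ω, ENNReal.ofReal (|I.w₀ x| * p x) = L1norm Ω (fun x => p x * I.w₀ x) :=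
    (setLIntegral_congr_fun hΩm fun x hx => enorm_weight_mul hp hx _).symm
  have c3 : ∀ (U V : ℝ → ℝ≥0∞), AEMeasurable V (volume.restrict (Ioo 0 T)) →
      (∀ t ∈ Ioo 0 T, U t ≤ ENNReal.ofReal Ehi * V t) →
      ∫⁻ t in Ioo 0 T, ENNReal.ofReal (Real.exp (lam * t)) * U t ≤ ENNReal.ofReal Ehi *
        (ENNReal.ofReal (Real.exp (lam * T)) *
          (κ * eLpNorm V q (volume.restrict (Ioo 0 T)))) := by
    intro U V hV hUV
    refine le_trans ?_ (mul_le_mul_right (hκ V hV) _)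
    rw [← lintegral_const_mul' _ _ ENNReal.ofReal_ne_top]
    refine setLIntegral_mono_ae' measurableSet_Ioo (ae_of_all _ fun t ht => ?_)
    rw [mul_left_comm]
    exact mul_le_mul_right (hUV t ht) _
  have hmain : ENNReal.ofReal (Real.exp (lam * T)) *
      (ENNReal.ofReal Elo * L1norm Ω (fun x => p x * w x T)) ≤
      ENNReal.ofReal Ehi * L1norm Ω (fun x => p x * I.w₀ x)
      + ENNReal.ofReal Ehi * (ENNReal.ofReal (Real.exp (lam * T)) *
          (κ * eLpNorm ub q (volume.restrict (Ioo 0 T))))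
      + ENNReal.ofReal Ehi * (ENNReal.ofReal (Real.exp (lam * T)) *
          (κ * eLpNorm uf q (volume.restrict (Ioo 0 T)))) := by
    refine (mul_le_mul_right c0 _).trans (hkey.trans ?_)
    refine add_le_add (add_le_add ?_ (c3 _ ub hubm c2)) (c3 _ uf hufm fun t _ => c1 _)
    rw [← hL0]
    exact c1 _
  rw [hbT, hfT]
  set X := L1norm Ω (fun x => p x * w x T)
  set e := ENNReal.ofReal (Real.exp (lam * T))
  have hei : ENNReal.ofReal (Real.exp (-(lam * T))) * e = 1 := by
    rw [← ENNReal.ofReal_mul (Real.exp_pos _).le, ← Real.exp_add, neg_add_cancel, Real.exp_zero,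
      ENNReal.ofReal_one]
  have hEi : ENNReal.ofReal Elo⁻¹ * ENNReal.ofReal Elo = 1 := by
    rw [← ENNReal.ofReal_mul (by positivity), inv_mul_cancel₀ hElo.ne', ENNReal.ofReal_one]
  have hC : ENNReal.ofReal (Ehi / Elo) = ENNReal.ofReal Ehi * ENNReal.ofReal Elo⁻¹ := by
    rw [div_eq_mul_inv, ENNReal.ofReal_mul hEhi.le]
  rw [ENNReal.ofReal_mul (by positivity), hC]
  set ei := ENNReal.ofReal (Real.exp (-(lam * T)))
  set Ei := ENNReal.ofReal Elo⁻¹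
  set E1 := ENNReal.ofReal Elo
  set E2 := ENNReal.ofReal Ehi
  -- The norms may be infinite a priori, so division is done by multiplying with the explicit finite
  -- inverses `ei` and `Ei`.
  calc X = (ei * e) * (Ei * E1) * X := by rw [hei, hEi, one_mul, one_mul]
    _ = ei * Ei * (e * (E1 * X)) := by ring
    _ ≤ ei * Ei * _ := mul_le_mul_right hmain _
    _ = E2 * Ei * ei * L1norm Ω (fun x => p x * I.w₀ x)
        + (ei * e) * (E2 * Ei * κ * eLpNorm ub q (volume.restrict (Ioo 0 T)))
        + (ei * e) * (E2 * Ei * κ * eLpNorm uf q (volume.restrict (Ioo 0 T))) := by ring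
    _ = _ := by rw [hei, one_mul, one_mul]

end ParabolicISS

namespace ParabolicISS

/-! ### Input-to-state stability -/

theorem isClassK_mul_left {c : ℝ≥0} (hc : 0 < c) : IsClassK fun r => c * r where
  continuous := by fun_prop
  strictMono := fun _ _ h => mul_lt_mul_of_pos_left h hc
  zero := mul_zero c

theorem isClassKL_exp {C lam : ℝ} (hC : 0 < C) (hlam : 0 < lam) :
    IsClassKL fun r t => C.toNNReal * (Real.exp (-(lam * t))).toNNReal * r where
  continuous := by
    have h : Continuous fun z : ℝ≥0 × ℝ≥0 => (Real.exp (-(lam * z.2))).toNNReal :=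
      continuous_real_toNNReal.comp (by fun_prop)
    exact (continuous_const.mul h).mul continuous_fst
  classK := fun t => isClassK_mul_left
    (mul_pos (Real.toNNReal_pos.2 hC) (Real.toNNReal_pos.2 (Real.exp_pos _)))
  classL := fun r hr => by
    refine ⟨?_, fun s t hst => ?_, ?_⟩
    · have h : Continuous fun t : ℝ≥0 => (Real.exp (-(lam * t))).toNNReal :=
        continuous_real_toNNReal.comp (by fun_prop)
      exact (continuous_const.mul h).mul continuous_const
    · have hst' : (s : ℝ) < t := hst
      refine mul_lt_mul_of_pos_right (mul_lt_mul_of_pos_left ?_ (Real.toNNReal_pos.2 hC)) hr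
      refine (Real.toNNReal_lt_toNNReal_iff (Real.exp_pos _)).2 (Real.exp_lt_exp.2 ?_)
      have := mul_lt_mul_of_pos_left hst' hlam
      linarith
    · have h1 : Tendsto (fun t : ℝ≥0 => Real.exp (-(lam * t))) atTop (𝓝 0) := by
        refine Real.tendsto_exp_atBot.comp (tendsto_neg_atTop_atBot.comp ?_)
        exact (NNReal.tendsto_coe_atTop.2 tendsto_id).const_mul_atTop hlam
      have h2 := ((continuous_real_toNNReal.tendsto 0).comp h1).const_mul C.toNNReal
      simpa using h2.mul_const r

/-- Stability is phrased through `toNNReal`, which sends `∞` to `0`; finiteness of the disturbance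
norms ensures that nothing is lost. -/
theorem mixedNorm_lt_top {n : ℕ} {K : Set (EuclideanSpace ℝ (Fin n))}
    {σ : Measure (EuclideanSpace ℝ (Fin n))} [IsFiniteMeasure σ] (hσ : ∀ᵐ x ∂σ, x ∈ K) {T : ℝ}
    {u : EuclideanSpace ℝ (Fin n) → ℝ → ℝ} {C : ℝ}
    (hu : ∀ x ∈ K, ∀ t ∈ Icc 0 T, ‖u x t‖ ≤ C) (q : ℝ≥0∞) : mixedNorm q T σ u < ∞ := by
  have h : ∀ᵐ t ∂(volume.restrict (Ioo 0 T)),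
      ‖∫⁻ x, ‖u x t‖ₑ ∂σ‖ₑ ≤ ENNReal.ofReal C * σ univ := by
    filter_upwards [ae_restrict_mem measurableSet_Ioo] with t ht
    rw [enorm_eq_self, ← lintegral_const]
    refine lintegral_mono_ae ?_
    filter_upwards [hσ] with x hx
    rw [← ofReal_norm]
    exact ENNReal.ofReal_le_ofReal (hu x hx t (Ioo_subset_Icc_self ht))
  refine (eLpNorm_le_of_ae_enorm_bound h).trans_lt ?_
  rw [smul_eq_mul]
  refine ENNReal.mul_lt_top (ENNReal.mul_lt_top ENNReal.ofReal_lt_top (measure_lt_top σ _)) ?_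
  refine ENNReal.rpow_lt_top_of_nonneg (by positivity) ?_
  simp

theorem mixedNorm_le_mul {n : ℕ} {σ : Measure (EuclideanSpace ℝ (Fin n))} {T : ℝ}
    {u v : EuclideanSpace ℝ (Fin n) → ℝ → ℝ} {C : ℝ≥0}
    (h : ∀ t ∈ Ioo 0 T, ∀ᵐ x ∂σ, |u x t| ≤ C * |v x t|) (q : ℝ≥0∞) :
    mixedNorm q T σ u ≤ C * mixedNorm q T σ v := by
  refine eLpNorm_le_mul_eLpNorm_of_ae_le_mul' ?_ q
  filter_upwards [ae_restrict_mem measurableSet_Ioo] with t ht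
  rw [enorm_eq_self, enorm_eq_self, ← lintegral_const_mul' _ _ ENNReal.coe_ne_top]
  refine lintegral_mono_ae ?_
  filter_upwards [h t ht] with x hx
  rw [Real.enorm_eq_ofReal_abs, Real.enorm_eq_ofReal_abs, ← ENNReal.ofReal_coe_nnreal,
    ← ENNReal.ofReal_mul C.coe_nonneg]
  exact ENNReal.ofReal_le_ofReal hx

theorem holderConst_ne_top {lam : ℝ} (hlam : 0 < lam) {q q' : ℝ≥0∞}
    (hq : ENNReal.HolderConjugate q q') : holderConst lam q' ≠ ∞ := by
  have h1 : q' ≠ 0 := (zero_lt_one.trans_le hq.symm.one_le).ne'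
  refine ENNReal.rpow_ne_top_of_nonneg ENNReal.toReal_nonneg ?_
  exact ENNReal.inv_ne_top.2 (mul_ne_zero (ENNReal.ofReal_pos.2 hlam).ne' h1)

variable {m : ℕ} {Ω : Set (EuclideanSpace ℝ (Fin (m + 1)))} {S : Coefficients (m + 1)}
  {p : EuclideanSpace ℝ (Fin (m + 1)) → ℝ}
  {p₀ : ℝ} {ψ₁ : EuclideanSpace ℝ (Fin (m + 1)) → ℝ → ℝ} {ψ₂ : ℝ → ℝ} {alo ahi lam : ℝ}
  {q : ℝ≥0∞}

/-- An exponential estimate with linear gains yields input-to-state stability. -/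
theorem isLqISS_of_estimate (hΩ : IsC2Domain Ω) (h1 : S.Assumption1 Ω alo ahi)
    (h3 : S.Assumption3' Ω p p₀ ψ₁ ψ₂) (hinv : InverseLinearBound ψ₂) {C : ℝ} (hC : 0 < C)
    (hlam : 0 < lam) {κ : ℝ≥0∞} (hκ : κ ≠ ∞)
    (hest : ∀ I : Inputs (m + 1), I.Regular Ω → S.Assumption4 Ω I → ∀ T : ℝ, 0 < T →
      ∀ w, S.IsClassicalSolution Ω I T w →
        L1norm Ω (fun x => p x * w x T) ≤
          ENNReal.ofReal (C * Real.exp (-(lam * T))) * L1norm Ω (fun x => p x * I.w₀ x)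
            + ENNReal.ofReal C * κ *
              mixedNorm q T (surfaceMeasure Ω) (boundaryTerm S Ω p ψ₁ ψ₂ I)
            + ENNReal.ofReal C * κ *
              mixedNorm q T (volume.restrict Ω) (fun x t => p x * I.f x t)) :
    IsLqISSWeightedL1 S Ω p q := by
  obtain ⟨Cψ, hCψ, hψ⟩ := hinv
  obtain ⟨ψlo, hψlo, hψ₁⟩ := h3.ψ₁_lower
  have hpc := h3.p_C1.continuousOn
  obtain ⟨Nb, hNb⟩ := hΩ.isCompact_closure.exists_bound_of_continuousOn
    (hΩ.continuousOn_gradientWithin h3.p_C1)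
  obtain ⟨Pb, hPb⟩ := hΩ.isCompact_closure.exists_bound_of_continuousOn hpc
  have hσ := hΩ.isFiniteMeasure_surfaceMeasure
  have hfin : IsFiniteMeasure ((volume : Measure (EuclideanSpace ℝ (Fin (m + 1)))).restrict Ω) :=
    ⟨by simpa using hΩ.volume_lt_top⟩
  set Kb : ℝ≥0 := (ahi * (Cψ / ψlo) * |Nb|).toNNReal with hKb
  set Kf : ℝ≥0 := |Pb|.toNNReal with hKf
  set G := C.toNNReal * κ.toNNReal with hG
  -- The summand `1` keeps the gains strictly increasing even if `G`, `Kb` or `Kf` vanishes.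
  refine ⟨fun r t => C.toNNReal * (Real.exp (-(lam * t))).toNNReal * r,
    fun r => (G * Kb + 1) * r, fun r => (G * Kf + 1) * r, isClassKL_exp hC hlam,
    isClassK_mul_left (by positivity), isClassK_mul_left (by positivity),
    fun I hI h4 T hT w hw => ?_⟩
  have hsubT : closure Ω ×ˢ Icc 0 T ⊆ closure Ω ×ˢ Ici (0 : ℝ) :=
    prod_mono_right Icc_subset_Ici_self
  obtain ⟨db, _, hdb⟩ := hΩ.exists_bound (hI.d.continuousOn.mono hsubT)
  obtain ⟨fb, _, hfb⟩ := hΩ.exists_bound (hI.f.continuousOn.mono hsubT)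
  have hνσ : ∀ᵐ x ∂(surfaceMeasure Ω), x ∈ closure Ω := by
    filter_upwards [ae_mem_frontier Ω] with x hx using frontier_subset_closure hx
  have hν : ∀ᵐ x ∂(volume.restrict Ω), x ∈ closure Ω := by
    filter_upwards [ae_restrict_mem hΩ.isOpen.measurableSet] with x hx using subset_closure hx
  have hd := (mixedNorm_lt_top hνσ hdb q).ne
  have hf := (mixedNorm_lt_top hν hfb q).ne
  have h0 : L1norm Ω (fun x => p x * I.w₀ x) ≠ ∞ :=
    (integrableOn_of_closure hΩ.isBounded (hpc.mul hI.w₀.continuousOn)).2.ne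
  have hbd : mixedNorm q T (surfaceMeasure Ω) (boundaryTerm S Ω p ψ₁ ψ₂ I) ≤
      Kb * mixedNorm q T (surfaceMeasure Ω) I.d := by
    refine mixedNorm_le_mul (fun t ht => ?_) q
    filter_upwards [ae_mem_frontier Ω] with x hx
    have hxc := frontier_subset_closure hx
    have ha := h1.a_bounds x hxc t ht.1.le
    have hψx := hψ₁ x hx t ht.1.le
    have ha0 := h1.alo_pos.trans_le ha.1
    -- The linear bound on the inverse holds only on the range of `ψ₂`; the existence of the
    -- solution puts `d/ψ₁` there.
    have hrange := hψ (I.d x t / ψ₁ x t) ⟨w x t, ((hw.invFun_eq h3 hx ht).1).symm⟩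
    have e1 : |I.d x t / ψ₁ x t| ≤ |I.d x t| / ψlo := by
      rw [abs_div, abs_of_pos (hψlo.trans_le hψx)]
      gcongr
    have e2 : ‖gradientWithin p (closure Ω) x‖ ≤ |Nb| := (hNb x hxc).trans (le_abs_self _)
    have hahi := h1.ahi_pos
    rw [boundaryTerm, abs_mul, abs_mul, abs_norm, abs_of_pos ha0, hKb,
      Real.coe_toNNReal _ (by positivity)]
    calc S.a x t * |Function.invFun ψ₂ (I.d x t / ψ₁ x t)| * ‖gradientWithin p (closure Ω) x‖
        ≤ ahi * (Cψ * (|I.d x t| / ψlo)) * |Nb| := by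
          have := hrange.trans (mul_le_mul_of_nonneg_left e1 hCψ.le)
          have := ha.2
          gcongr
      _ = _ := by ring
  have hfd : mixedNorm q T (volume.restrict Ω) (fun x t => p x * I.f x t) ≤
      Kf * mixedNorm q T (volume.restrict Ω) I.f := by
    refine mixedNorm_le_mul (fun t ht => ?_) q
    filter_upwards [hν] with x hx
    rw [abs_mul, hKf, Real.coe_toNNReal _ (abs_nonneg _)]
    exact mul_le_mul_of_nonneg_right ((hPb x hx).trans (le_abs_self _)) (abs_nonneg _)
  have hGκ : ENNReal.ofReal C * κ = (G : ℝ≥0∞) := by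
    rw [hG, ENNReal.coe_mul, ENNReal.coe_toNNReal hκ]
    rfl
  refine (hest I hI h4 T hT w hw).trans ?_
  rw [hGκ]
  push_cast
  rw [ENNReal.coe_toNNReal h0, ENNReal.coe_toNNReal hd, ENNReal.coe_toNNReal hf,
    ENNReal.ofReal_mul hC.le, Real.coe_toNNReal T hT.le]
  refine add_le_add (add_le_add le_rfl ?_) ?_
  · calc (G : ℝ≥0∞) * mixedNorm q T (surfaceMeasure Ω) (boundaryTerm S Ω p ψ₁ ψ₂ I)
        ≤ G * (Kb * mixedNorm q T (surfaceMeasure Ω) I.d) := mul_le_mul_right hbd _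
      _ = (G * Kb) * mixedNorm q T (surfaceMeasure Ω) I.d := (mul_assoc _ _ _).symm
      _ ≤ _ := mul_le_mul_left le_self_add _
  · calc (G : ℝ≥0∞) * mixedNorm q T (volume.restrict Ω) (fun x t => p x * I.f x t)
        ≤ G * (Kf * mixedNorm q T (volume.restrict Ω) I.f) := mul_le_mul_right hfd _
      _ = (G * Kf) * mixedNorm q T (volume.restrict Ω) I.f := (mul_assoc _ _ _).symm
      _ ≤ _ := mul_le_mul_left le_self_add _

end ParabolicISS

namespace ParabolicISS

/-! ### The three estimates and the theorem -/

variable {m : ℕ} {Ω : Set (EuclideanSpace ℝ (Fin (m + 1)))} {S : Coefficients (m + 1)}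
  {μ : EuclideanSpace ℝ (Fin (m + 1)) → ℝ → ℝ} {p : EuclideanSpace ℝ (Fin (m + 1)) → ℝ}
  {p₀ : ℝ} {ψ₁ : EuclideanSpace ℝ (Fin (m + 1)) → ℝ → ℝ} {ψ₂ : ℝ → ℝ} {alo ahi clo T : ℝ}
  {I : Inputs (m + 1)} {w : EuclideanSpace ℝ (Fin (m + 1)) → ℝ → ℝ} {q q' : ℝ≥0∞}
  {j : Fin (m + 1)} {blo mbar l k : ℝ}

/-- The weighted `L¹`-estimate without decay. -/
theorem estimate_one (hΩ : IsC2Domain Ω) (hS : S.Regular Ω) (h1 : S.Assumption1 Ω alo ahi)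
    (h2 : S.Assumption2 Ω μ clo) (h3 : S.Assumption3' Ω p p₀ ψ₁ ψ₂) (hI : I.Regular Ω)
    (hT : 0 < T) (hw : S.IsClassicalSolution Ω I T w) :
    L1norm Ω (fun x => p x * w x T) ≤
      ENNReal.ofReal (Real.exp (-(clo * T))) * L1norm Ω (fun x => p x * I.w₀ x)
        + mixedNorm 1 T (surfaceMeasure Ω) (boundaryTerm S Ω p ψ₁ ψ₂ I)
        + mixedNorm 1 T (volume.restrict Ω) (fun x t => p x * I.f x t) := by
  have := (h3.isEnergyWeight hΩ hS h1 h2).L1norm_le (q := 1) (κ := 1) hΩ hS h1 h2 h3 one_pos one_pos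
    (fun x _ => (one_mul _).le) (fun x _ => (one_mul _).ge) (fun x _ => (one_mul _).ge) hI hT
    (fun u _ => by
      rw [one_mul]
      exact lintegral_exp_mul_le_one_norm h2.clo_nonneg u) hw
  simpa using this

/-- The weighted `L¹`-estimate with decay rate `clo > 0`. -/
theorem estimate_of_clo_pos (hΩ : IsC2Domain Ω) (hS : S.Regular Ω)
    (h1 : S.Assumption1 Ω alo ahi) (h2 : S.Assumption2 Ω μ clo)
    (h3 : S.Assumption3' Ω p p₀ ψ₁ ψ₂) (hq : ENNReal.HolderConjugate q q') (hI : I.Regular Ω)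
    (hT : 0 < T) (hw : S.IsClassicalSolution Ω I T w) (hclo : 0 < clo) :
    L1norm Ω (fun x => p x * w x T) ≤
      ENNReal.ofReal (Real.exp (-(clo * T))) * L1norm Ω (fun x => p x * I.w₀ x)
        + holderConst clo q' *
          mixedNorm q T (surfaceMeasure Ω) (boundaryTerm S Ω p ψ₁ ψ₂ I)
        + holderConst clo q' *
          mixedNorm q T (volume.restrict Ω) (fun x t => p x * I.f x t) := by
  have := (h3.isEnergyWeight hΩ hS h1 h2).L1norm_le (q := q) (κ := holderConst clo q') hΩ hS h1 h2
    h3 one_pos one_pos (fun x _ => (one_mul _).le) (fun x _ => (one_mul _).ge)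
    (fun x _ => (one_mul _).ge) hI hT (fun u hu => lintegral_exp_mul_le_holder hclo hq hu) hw
  simpa using this

/-- The weighted `L¹`-estimate with decay generated by the drift. -/
theorem estimate_of_drift (hΩ : IsC2Domain Ω) (hS : S.Regular Ω) (h1 : S.Assumption1 Ω alo ahi)
    (h2 : S.Assumption2 Ω μ 0) (h3 : S.Assumption3' Ω p p₀ ψ₁ ψ₂)
    (hq : ENNReal.HolderConjugate q q') (hp₀ : 0 < p₀) (hdrift : DriftLowerBound S Ω j blo)
    (hl : 0 < l) (hlb : 0 < l + blo)
    (hk1 : 2 * l * Real.exp (l * maxDist Ω) / (l + blo) < k)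
    (hk2 : 2 * ahi * l * Real.exp (l * maxDist Ω) / p₀ * maxPartial Ω p j < k)
    (hsign : SignCondition S Ω p j ∨ DivergenceCondition S Ω p j mbar ∧
      2 * l * Real.exp (l * maxDist Ω) * mbar < k)
    (hI : I.Regular Ω) (hT : 0 < T) (hw : S.IsClassicalSolution Ω I T w) :
    L1norm Ω (fun x => p x * w x T) ≤
      ENNReal.ofReal (Ckl (maxDist Ω) l k * Real.exp (-(hatc alo blo (maxDist Ω) l k * T)))
          * L1norm Ω (fun x => p x * I.w₀ x)
        + ENNReal.ofReal (Ckl (maxDist Ω) l k) * holderConst (hatc alo blo (maxDist Ω) l k) q' *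
          mixedNorm q T (surfaceMeasure Ω) (boundaryTerm S Ω p ψ₁ ψ₂ I)
        + ENNReal.ofReal (Ckl (maxDist Ω) l k) * holderConst (hatc alo blo (maxDist Ω) l k) q' *
          mixedNorm q T (volume.restrict Ω) (fun x t => p x * I.f x t) := by
  have hp := h3.isWeight hΩ hS h1
  have hk := (drift_margin_pos hl hlb hk1).1
  have hlo : ∀ x ∈ closure Ω, (k + Real.exp (l * maxDist Ω))⁻¹ ≤ (k + Real.exp (l * x j))⁻¹ :=
    fun x hx => by
      have := (hΩ.exp_coord_bounds hl j hx).2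
      gcongr
  have hhi : ∀ x ∈ closure Ω, (k + Real.exp (l * x j))⁻¹ ≤ (k + Real.exp (-(l * maxDist Ω)))⁻¹ :=
    fun x hx => by
      have := (hΩ.exp_coord_bounds hl j hx).1
      gcongr
  have := (h3.isEnergyWeight_mul hΩ hS h1 h2 hp₀ hdrift hl hlb hk1 hk2 hsign).L1norm_le (q := q)
    (κ := holderConst (hatc alo blo (maxDist Ω) l k) q') (Elo := (k + Real.exp (l * maxDist Ω))⁻¹)
    (Ehi := (k + Real.exp (-(l * maxDist Ω)))⁻¹) hΩ hS h1 h2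
    h3 (by positivity) (by positivity)
    (fun x hx => by
      rw [mul_comm]
      exact mul_le_mul_of_nonneg_left (hlo x (subset_closure hx)) (hp.nonneg x hx))
    (fun x hx => by
      rw [mul_comm]
      exact mul_le_mul_of_nonneg_right (hhi x (subset_closure hx)) (hp.nonneg x hx))
    (fun x hx => by
      rw [norm_gradientWithin_mul_weightFactor hΩ hp hk hx]
      exact mul_le_mul_of_nonneg_right (hhi x (frontier_subset_closure hx)) (norm_nonneg _)) hI hT
    (fun u hu => lintegral_exp_mul_le_holder (hatc_pos h1.alo_pos hl hlb hk1) hq hu) hw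
  have hC : (k + Real.exp (-(l * maxDist Ω)))⁻¹ / (k + Real.exp (l * maxDist Ω))⁻¹ =
      Ckl (maxDist Ω) l k := by
    rw [Ckl, div_inv_eq_mul, mul_comm, div_eq_mul_inv]
  rwa [hC] at this

end ParabolicISS

theorem mainTheorem2 (n : ℕ) (hn : 1 ≤ n) (Ω : Set (EuclideanSpace ℝ (Fin n)))
    (hΩ : IsC2Domain Ω) (S : Coefficients n) (hS : S.Regular Ω)
    (alo ahi : ℝ) (h1 : S.Assumption1 Ω alo ahi)
    (μ : EuclideanSpace ℝ (Fin n) → ℝ → ℝ) (clo : ℝ) (h2 : S.Assumption2 Ω μ clo)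
    (p : EuclideanSpace ℝ (Fin n) → ℝ) (p₀ : ℝ)
    (ψ₁ : EuclideanSpace ℝ (Fin n) → ℝ → ℝ) (ψ₂ : ℝ → ℝ)
    (h3 : S.Assumption3' Ω p p₀ ψ₁ ψ₂)
    (q q' : ℝ≥0∞) (hq : ENNReal.HolderConjugate q q') :
    -- Part (i)
    ((∀ I : Inputs n, I.Regular Ω → S.Assumption4 Ω I → ∀ T : ℝ, 0 < T →
        ∀ w, S.IsClassicalSolution Ω I T w →
          L1norm Ω (fun x => p x * w x T) ≤
              ENNReal.ofReal (Real.exp (-(clo * T))) * L1norm Ω (fun x => p x * I.w₀ x)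
                + mixedNorm 1 T (surfaceMeasure Ω) (boundaryTerm S Ω p ψ₁ ψ₂ I)
                + mixedNorm 1 T (volume.restrict Ω) (fun x t => p x * I.f x t) ∧
          (0 < clo →
            L1norm Ω (fun x => p x * w x T) ≤
              ENNReal.ofReal (Real.exp (-(clo * T))) * L1norm Ω (fun x => p x * I.w₀ x)
                + holderConst clo q' *
                  mixedNorm q T (surfaceMeasure Ω) (boundaryTerm S Ω p ψ₁ ψ₂ I)
                + holderConst clo q' *
                  mixedNorm q T (volume.restrict Ω) (fun x t => p x * I.f x t))) ∧
      (0 < clo →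
        InverseLinearBound ψ₂ →
        IsLqISSWeightedL1 S Ω p q)) ∧
    -- Part (ii)
    (clo = 0 → 0 < p₀ → ∀ (j : Fin n) (blo mbar : ℝ), 0 ≤ mbar →
      DriftLowerBound S Ω j blo →
      (∀ l k : ℝ, max 0 (-blo) < l →
        ((SignCondition S Ω p j ∧
            max (2 * l * Real.exp (l * maxDist Ω) / (l + blo))
              (2 * ahi * l * Real.exp (l * maxDist Ω) / p₀ * maxPartial Ω p j) < k) ∨
          (DivergenceCondition S Ω p j mbar ∧
            max (max (2 * l * Real.exp (l * maxDist Ω) / (l + blo))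
                (2 * l * Real.exp (l * maxDist Ω) * mbar))
              (2 * ahi * l * Real.exp (l * maxDist Ω) / p₀ * maxPartial Ω p j) < k)) →
        0 < hatc alo blo (maxDist Ω) l k ∧ 0 < Ckl (maxDist Ω) l k ∧
        ∀ I : Inputs n, I.Regular Ω → S.Assumption4 Ω I → ∀ T : ℝ, 0 < T →
          ∀ w, S.IsClassicalSolution Ω I T w →
            L1norm Ω (fun x => p x * w x T) ≤
              ENNReal.ofReal (Ckl (maxDist Ω) l k
                  * Real.exp (-(hatc alo blo (maxDist Ω) l k * T)))
                  * L1norm Ω (fun x => p x * I.w₀ x)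
                + ENNReal.ofReal (Ckl (maxDist Ω) l k)
                  * holderConst (hatc alo blo (maxDist Ω) l k) q' *
                  mixedNorm q T (surfaceMeasure Ω) (boundaryTerm S Ω p ψ₁ ψ₂ I)
                + ENNReal.ofReal (Ckl (maxDist Ω) l k)
                  * holderConst (hatc alo blo (maxDist Ω) l k) q' *
                  mixedNorm q T (volume.restrict Ω) (fun x t => p x * I.f x t)) ∧
      ((SignCondition S Ω p j ∨ DivergenceCondition S Ω p j mbar) →
        InverseLinearBound ψ₂ →
        IsLqISSWeightedL1 S Ω p q)) := by
  obtain ⟨m, rfl⟩ : ∃ m, n = m + 1 := ⟨n - 1, by omega⟩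
  refine ⟨⟨fun I hI _ T hT w hw => ⟨?_, fun hclo => estimate_of_clo_pos hΩ hS h1 h2 h3 hq hI hT
    hw hclo⟩, fun hclo hinv => ?_⟩, fun hclo hp₀ j blo mbar _ hdrift => ⟨fun l k hl hlk => ?_,
    fun hsign hinv => ?_⟩⟩
  · exact estimate_one hΩ hS h1 h2 h3 hI hT hw
  · refine isLqISS_of_estimate hΩ h1 h3 hinv one_pos hclo (holderConst_ne_top hclo hq)
      fun I hI _ T hT w hw => ?_
    simpa using estimate_of_clo_pos hΩ hS h1 h2 h3 hq hI hT hw hclo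
  · subst hclo
    have hl0 : 0 < l := (le_max_left _ _).trans_lt hl
    have hlb : 0 < l + blo := by linarith [(le_max_right 0 (-blo)).trans_lt hl]
    have hk : 2 * l * Real.exp (l * maxDist Ω) / (l + blo) < k := by
      rcases hlk with ⟨_, h⟩ | ⟨_, h⟩
      · exact (le_max_left _ _).trans_lt h
      · exact ((le_max_left _ _).trans (le_max_left _ _)).trans_lt h
    have hk2 : 2 * ahi * l * Real.exp (l * maxDist Ω) / p₀ * maxPartial Ω p j < k := by
      rcases hlk with ⟨_, h⟩ | ⟨_, h⟩ <;> exact (le_max_right _ _).trans_lt h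
    refine ⟨hatc_pos h1.alo_pos hl0 hlb hk, Ckl_pos (drift_margin_pos hl0 hlb hk).1,
      fun I hI _ T hT w hw => ?_⟩
    refine estimate_of_drift (mbar := mbar) hΩ hS h1 h2 h3 hq hp₀ hdrift hl0 hlb hk hk2 ?_ hI hT hw
    rcases hlk with ⟨h, _⟩ | ⟨h, h'⟩
    · exact Or.inl h
    · exact Or.inr ⟨h, ((le_max_right _ _).trans (le_max_left _ _)).trans_lt h'⟩
  · subst hclo
    obtain ⟨l, hl⟩ := exists_gt (max 0 (-blo))
    have hl0 : 0 < l := (le_max_left _ _).trans_lt hl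
    have hlb : 0 < l + blo := by linarith [(le_max_right 0 (-blo)).trans_lt hl]
    -- Stability allows any admissible `l` and `k`; the larger threshold of case (B) serves both
    -- cases.
    obtain ⟨k, hkk⟩ := exists_gt (max (max (2 * l * Real.exp (l * maxDist Ω) / (l + blo))
      (2 * l * Real.exp (l * maxDist Ω) * mbar))
      (2 * ahi * l * Real.exp (l * maxDist Ω) / p₀ * maxPartial Ω p j))
    have hk := ((le_max_left _ _).trans (le_max_left _ _)).trans_lt hkk
    have hc := hatc_pos h1.alo_pos hl0 hlb hk
    refine isLqISS_of_estimate hΩ h1 h3 hinv (C := Ckl (maxDist Ω) l k)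
      (Ckl_pos (drift_margin_pos hl0 hlb hk).1) hc
      (holderConst_ne_top hc hq) fun I hI _ T hT w hw => ?_
    exact estimate_of_drift (mbar := mbar) hΩ hS h1 h2 h3 hq hp₀ hdrift hl0 hlb hk
      ((le_max_right _ _).trans_lt hkk)
      (hsign.imp_right fun h => ⟨h, ((le_max_right _ _).trans (le_max_left _ _)).trans_lt hkk⟩)
      hI hT hw
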